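/- **Model.** All algorithms run on a real RAM: cells and registers hold real numbers; the operations $+,-,\times,\div,\le$, the floor function, a memory access, an access to the input, and the drawing of a uniformly random element of $[0,1]$ (independent draws) take one unit of time each. Space is the number of memory cells. A time series $\langle x_1,\dots,x_m\rangle$ is the curve $[0,1]\to\mathbb R$ that linearly interpolates the reals $x_1,\dots,x_m$; it is given by this sequence of length $m$. The Fréchet distance of two curves is $$d_F(\pi,\tau)=\inf_{f,g}\ \max_{\alpha\in[0,1]}|\pi(f(\alpha))-\tau(g(\alpha))|,$$ where $f,g:[0,1]\to[0,1]$ range over the continuous non-decreasing functions with $f(0)=g(0)=0$ and $f(1)=g(1)=1$. Given curves $\pi_1,\dots,\pi_n$, a threshold $r>0$ and a factor $a>1$, a correct answer to the *$a$-ANN problem* for a query $\tau$ is: a curve $\pi_j$ with $d_F(\pi_j,\tau)\le a r$, if some $\pi_i$ has $d_F(\pi_i,\tau)\le r$; "no", if all $\pi_i$ have $d_F(\pi_i,\tau)\ge a r$; and otherwise either "no" or a curve $\pi_j$ with $d_F(\pi_j,\tau)\le a r$. **Theorem.** For every $c\in\mathbb N$ there are a randomized preprocessing program, a deterministic query program,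 and a constant $C$ such that the following holds for all integers $n\ge 2$, $m\ge 1$, $k\ge 1$, all $r>0$, and all sets of $n$ time series given by vertex sequences of length $m$. The preprocessing reads $n,m,k,r$ and the time series, and builds a data structure in memory; the query program reads only this data structure and a query time series given by a vertex sequence of length $k$. 1. The expected preprocessing time is at most $C\,nm\log n$. 2. Whenever the preprocessing halts, it has used at most $C\,(n\log n+nm)$ memory cells, and the data structure answers every query (with "no" or with one of the $n$ curves) in time at most $C\,k\log n$. 3. For every fixed query $\tau$, with probability at least $1-n^{-c}$ over the preprocessing, it halts and the answer of the data structure to $\tau$ is a correct answer to the $(24k+1)$-ANN problem. -/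

import Mathlib

open MeasureTheory

/-! ## Time series and the continuous Fréchet distance -/

/-- A matching: a pair of continuous non-decreasing surjective reparametrizations of `[0,1]`. -/
structure Matching where
  f : unitInterval → unitInterval
  g : unitInterval → unitInterval
  continuous_f : Continuous f
  continuous_g : Continuous g
  monotone_f : Monotone f
  monotone_g : Monotone g
  f_zero : f 0 = 0
  g_zero : g 0 = 0
  f_one : f 1 = 1
  g_one : g 1 = 1

/-- The continuous Fréchet distance of two curves `[0,1] → ℝ`. -/
noncomputable def frechetDist (p q : C(unitInterval, ℝ)) : ℝ :=
  ⨅ φ : Matching, ⨆ a : unitInterval, |p (φ.f a) - q (φ.g a)|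

/-- The `i`-th vertex (counted from `0`) of a vertex sequence, and `0` beyond its end. -/
noncomputable def vertexAt {m : ℕ} (x : Fin m → ℝ) (i : ℕ) : ℝ :=
  if h : i < m then x ⟨i, h⟩ else 0

/-- The time series `⟨x₀, …, x_{m-1}⟩`: the linear interpolation of the values `x i`, with `x i`
attained at the parameter `i / (m - 1)`. The summand of index `i` is the part of the edge from
`x i` to `x (i+1)` that has been traversed at the parameter `t`
(see `timeSeries_apply`). For `m = 1` it is constant. -/
noncomputable def timeSeries {m : ℕ} (x : Fin m → ℝ) : C(unitInterval, ℝ) where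
  toFun t := vertexAt x 0 + ∑ i ∈ Finset.range (m - 1),
    (vertexAt x (i + 1) - vertexAt x i) * max 0 (min 1 (((m - 1 : ℕ) : ℝ) * (t : ℝ) - (i : ℝ)))
  continuous_toFun := by fun_prop

theorem timeSeries_apply {m : ℕ} (x : Fin m → ℝ) (t : unitInterval) (j : ℕ) (hj : j < m - 1)
    (h₁ : (j : ℝ) ≤ ((m - 1 : ℕ) : ℝ) * (t : ℝ))
    (h₂ : ((m - 1 : ℕ) : ℝ) * (t : ℝ) ≤ (j : ℝ) + 1) :
    timeSeries x t = vertexAt x j +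
      (((m - 1 : ℕ) : ℝ) * (t : ℝ) - (j : ℝ)) * (vertexAt x (j + 1) - vertexAt x j) := by
  change vertexAt x 0 + ∑ i ∈ Finset.range (m - 1),
    (vertexAt x (i + 1) - vertexAt x i) *
      max 0 (min 1 (((m - 1 : ℕ) : ℝ) * (t : ℝ) - (i : ℝ))) = _
  generalize ((m - 1 : ℕ) : ℝ) * (t : ℝ) = u at *
  rw [← Finset.sum_range_add_sum_Ico _ (Nat.succ_le_of_lt hj), Finset.sum_range_succ]
  have e1 : ∑ i ∈ Finset.range j, (vertexAt x (i + 1) - vertexAt x i) *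
      max 0 (min 1 (u - (i : ℝ))) = vertexAt x j - vertexAt x 0 := by
    rw [← Finset.sum_range_sub]
    refine Finset.sum_congr rfl fun i hi => ?_
    have : (i : ℝ) + 1 ≤ j := by exact_mod_cast Finset.mem_range.1 hi
    rw [min_eq_left (by linarith), max_eq_right (by norm_num), mul_one]
  have e2 : ∑ i ∈ Finset.Ico (j + 1) (m - 1), (vertexAt x (i + 1) - vertexAt x i) *
      max 0 (min 1 (u - (i : ℝ))) = 0 := by
    refine Finset.sum_eq_zero fun i hi => ?_
    have : (j : ℝ) + 1 ≤ i := by exact_mod_cast (Finset.mem_Ico.1 hi).1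
    rw [max_eq_left (min_le_of_right_le (by linarith)), mul_zero]
  rw [e1, Nat.succ_eq_add_one, e2, min_eq_right (by linarith), max_eq_right (by linarith)]
  ring

/-- The answer `a` (`none` means "no", `some i` means the input curve of index `i`) is a correct
answer to the query `q` for the `c`-approximate near neighbour problem with threshold `r`
on the input curves `P`. -/
def IsANNAnswer {n : ℕ} (c r : ℝ) (P : Fin n → C(unitInterval, ℝ)) (q : C(unitInterval, ℝ))
    (a : Option (Fin n)) : Prop :=
  ((∃ i, frechetDist (P i) q ≤ r) → ∃ j, a = some j ∧ frechetDist (P j) q ≤ c * r) ∧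
  ((∀ i, c * r ≤ frechetDist (P i) q) → a = none) ∧
  (∀ j, a = some j → frechetDist (P j) q ≤ c * r)

/-! ## The real RAM with floor function and random real numbers

Programs are finite pieces of text over real registers, a random-access memory of real cells and a
read-only input array. Each of `+`, `-`, `*`, `/`, `≤`, floor, a memory access, an access
to the input, and a draw of a random number takes one unit of time. -/

namespace RealRAM

/-- Expressions. `reg i` is a register; `mem e` and `inp e` are the memory cell and the input entry
with address `e`. Only integer constants are available. -/
inductive RExpr where
  | lit (z : ℤ)
  | reg (i : ℕ)
  | add (a b : RExpr)
  | sub (a b : RExpr)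
  | mul (a b : RExpr)
  | div (a b : RExpr)
  | floor (a : RExpr)
  | mem (a : RExpr)
  | inp (a : RExpr)

/-- Boolean conditions. -/
inductive RCond where
  | le (a b : RExpr)
  | not (b : RCond)
  | and (b c : RCond)

/-- Programs. `store a b` writes the value of `b` to the memory cell with address `a`,
`rand i` draws a fresh uniformly random element of `[0,1]` into the register `i`. -/
inductive Prog where
  | skip
  | assign (i : ℕ) (a : RExpr)
  | store (a b : RExpr)
  | rand (i : ℕ)
  | seq (p q : Prog)
  | ite (b : RCond) (p q : Prog)
  | loop (b : RCond) (p : Prog)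

/-- Configurations. `used` is one more than the largest address of a memory cell written so far
(`0` if none has been written); `rnd` is the stream of random numbers that are still to be drawn. -/
structure State where
  reg : ℕ → ℝ
  mem : ℕ → ℝ
  used : ℕ
  inp : ℕ → ℝ
  rnd : ℕ → unitInterval

/-- Value of an expression. An address is rounded down to a natural number; division by zero
yields zero. -/
noncomputable def RExpr.eval (s : State) : RExpr → ℝ
  | .lit z => z
  | .reg i => s.reg i
  | .add a b => a.eval s + b.eval s
  | .sub a b => a.eval s - b.eval s
  | .mul a b => a.eval s * b.eval s
  | .div a b => a.eval s / b.eval s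
  | .floor a => (⌊a.eval s⌋ : ℤ)
  | .mem a => s.mem ⌊a.eval s⌋₊
  | .inp a => s.inp ⌊a.eval s⌋₊

/-- Time for evaluating an expression: its number of constants, registers and operations. -/
def RExpr.cost : RExpr → ℕ
  | .lit _ => 1
  | .reg _ => 1
  | .add a b => a.cost + b.cost + 1
  | .sub a b => a.cost + b.cost + 1
  | .mul a b => a.cost + b.cost + 1
  | .div a b => a.cost + b.cost + 1
  | .floor a => a.cost + 1
  | .mem a => a.cost + 1
  | .inp a => a.cost + 1

/-- Truth of a condition. -/
def RCond.Holds (s : State) : RCond → Prop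
  | .le a b => a.eval s ≤ b.eval s
  | .not b => ¬ b.Holds s
  | .and b c => b.Holds s ∧ c.Holds s

/-- Time for evaluating a condition. -/
def RCond.cost : RCond → ℕ
  | .le a b => a.cost + b.cost + 1
  | .not b => b.cost + 1
  | .and b c => b.cost + c.cost + 1

/-- `s` after writing `v` to the register `i`. -/
noncomputable def State.setReg (s : State) (i : ℕ) (v : ℝ) : State :=
  { s with reg := Function.update s.reg i v }

/-- `s` after writing `v` to the memory cell `a`. -/
noncomputable def State.setMem (s : State) (a : ℕ) (v : ℝ) : State :=
  { s with mem := Function.update s.mem a v, used := max s.used (a + 1) }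

/-- `s` after drawing the next random number into the register `i`. -/
noncomputable def State.draw (s : State) (i : ℕ) : State :=
  { s with reg := Function.update s.reg i (s.rnd 0 : ℝ), rnd := fun j => s.rnd (j + 1) }

/-- `Exec p s t s'`: started in `s`, the program `p` halts after `t` units of time in `s'`. -/
inductive Exec : Prog → State → ℕ → State → Prop where
  | skip (s : State) : Exec .skip s 1 s
  | assign (i : ℕ) (a : RExpr) (s : State) :
      Exec (.assign i a) s (a.cost + 1) (s.setReg i (a.eval s))
  | store (a b : RExpr) (s : State) :
      Exec (.store a b) s (a.cost + b.cost + 1) (s.setMem ⌊a.eval s⌋₊ (b.eval s))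
  | rand (i : ℕ) (s : State) : Exec (.rand i) s 1 (s.draw i)
  | seq {p q : Prog} {s s₁ s₂ : State} {t₁ t₂ : ℕ} (h₁ : Exec p s t₁ s₁) (h₂ : Exec q s₁ t₂ s₂) :
      Exec (.seq p q) s (t₁ + t₂) s₂
  | ite_true {b : RCond} {p q : Prog} {s s₁ : State} {t : ℕ} (hb : b.Holds s)
      (h : Exec p s t s₁) : Exec (.ite b p q) s (b.cost + 1 + t) s₁
  | ite_false {b : RCond} {p q : Prog} {s s₁ : State} {t : ℕ} (hb : ¬ b.Holds s)
      (h : Exec q s t s₁) : Exec (.ite b p q) s (b.cost + 1 + t) s₁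
  | loop_true {b : RCond} {p : Prog} {s s₁ s₂ : State} {t₁ t₂ : ℕ} (hb : b.Holds s)
      (h₁ : Exec p s t₁ s₁) (h₂ : Exec (.loop b p) s₁ t₂ s₂) :
      Exec (.loop b p) s (b.cost + 1 + t₁ + t₂) s₂
  | loop_false {b : RCond} {p : Prog} {s : State} (hb : ¬ b.Holds s) :
      Exec (.loop b p) s (b.cost + 1) s

/-- Programs are deterministic once the random numbers are fixed. -/
theorem Exec.unique {p : Prog} {s s₁ s₂ : State} {t₁ t₂ : ℕ} (h₁ : Exec p s t₁ s₁)
    (h₂ : Exec p s t₂ s₂) : t₁ = t₂ ∧ s₁ = s₂ := by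
  induction h₁ generalizing t₂ s₂ with
  | skip s => cases h₂; exact ⟨rfl, rfl⟩
  | assign i a s => cases h₂; exact ⟨rfl, rfl⟩
  | store a b s => cases h₂; exact ⟨rfl, rfl⟩
  | rand i s => cases h₂; exact ⟨rfl, rfl⟩
  | seq _ _ ih₁ ih₂ =>
    cases h₂ with
    | seq k₁ k₂ =>
      obtain ⟨rfl, rfl⟩ := ih₁ k₁
      obtain ⟨rfl, rfl⟩ := ih₂ k₂
      exact ⟨rfl, rfl⟩
  | ite_true hb _ ih =>
    cases h₂ with
    | ite_true _ k => obtain ⟨rfl, rfl⟩ := ih k; exact ⟨rfl, rfl⟩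
    | ite_false hb' _ => exact absurd hb hb'
  | ite_false hb _ ih =>
    cases h₂ with
    | ite_true hb' _ => exact absurd hb' hb
    | ite_false _ k => obtain ⟨rfl, rfl⟩ := ih k; exact ⟨rfl, rfl⟩
  | loop_true hb _ _ ih₁ ih₂ =>
    cases h₂ with
    | loop_true _ k₁ k₂ =>
      obtain ⟨rfl, rfl⟩ := ih₁ k₁
      obtain ⟨rfl, rfl⟩ := ih₂ k₂
      exact ⟨rfl, rfl⟩
    | loop_false hb' => exact absurd hb hb'
  | loop_false hb =>
    cases h₂ with
    | loop_true hb' _ _ => exact absurd hb' hb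
    | loop_false _ => exact ⟨rfl, rfl⟩

/-- The running time of `p` started in `s`; it is infinite if `p` does not halt. -/
noncomputable def runTime (p : Prog) (s : State) : ENNReal :=
  ⨅ (t : ℕ) (_ : ∃ s', Exec p s t s'), (t : ENNReal)

/-- The law of a sequence of independent uniformly random elements of `[0,1]`. -/
noncomputable def randomStream : Measure (ℕ → unitInterval) :=
  Measure.infinitePi fun _ : ℕ => (volume : Measure unitInterval)

end RealRAM

open RealRAM

/-! ## Data structures -/

/-- Start of the preprocessing: registers and memory are zero, and the input array holds
`n, m, k, r` followed by the `n` vertex sequences of length `m`, one after the other. -/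
noncomputable def preprocessStart {n m : ℕ} (k : ℕ) (r : ℝ) (X : Fin n → Fin m → ℝ)
    (ω : ℕ → unitInterval) : State where
  reg := fun _ => 0
  mem := fun _ => 0
  used := 0
  inp := fun a =>
    match a with
    | 0 => (n : ℝ)
    | 1 => (m : ℝ)
    | 2 => (k : ℝ)
    | 3 => r
    | b + 4 => if h : b / m < n then vertexAt (X ⟨b / m, h⟩) (b % m) else 0
  rnd := ω

/-- Start of a query: the memory holds the data structure `D`, the registers are zero, and the
input array holds the vertex sequence of the query. The query has no access to the input of the
preprocessing and no source of randomness. -/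
noncomputable def queryStart {k : ℕ} (D : ℕ → ℝ) (y : Fin k → ℝ) : State where
  reg := fun _ => 0
  mem := D
  used := 0
  inp := vertexAt y
  rnd := fun _ => 0

/-- The number that encodes an answer: `0` is "no", and `i + 1` is (a pointer to) the input
curve of index `i`. -/
def encodeAnswer {n : ℕ} : Option (Fin n) → ℝ
  | none => 0
  | some i => (i : ℕ) + 1

/-- The query program `Q`, run on the data structure `D` with the query `y`, halts after `t` units
of time and returns the answer `a` (in the register `0`). -/
def Answers {n k : ℕ} (Q : Prog) (D : ℕ → ℝ) (y : Fin k → ℝ) (t : ℕ) (a : Option (Fin n)) : Prop :=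
  ∃ s : State, Exec Q (queryStart D y) t s ∧ s.reg 0 = encodeAnswer a

/-- On the random numbers `ω`, the preprocessing succeeds for the query `y`: it halts, and
the data structure that it builds gives a correct answer to `y`. -/
def PreprocessSucceeds {n m k : ℕ} (P Q : Prog) (c r : ℝ) (X : Fin n → Fin m → ℝ)
    (y : Fin k → ℝ) (ω : ℕ → unitInterval) : Prop :=
  ∃ (t : ℕ) (s : State), Exec P (preprocessStart k r X ω) t s ∧
    ∃ (t' : ℕ) (a : Option (Fin n)), Answers Q s.mem y t' a ∧
      IsANNAnswer c r (fun i => timeSeries (X i)) (timeSeries y) a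

/-!
Every curve gets, for each of a few shifts of a one-dimensional grid of width `w = 12 k r`, a single
natural number as its key, and a query is answered by looking up its own keys in sorted arrays.

The key comes from a walk on the grid points with hysteresis (`walkStep`): the position is an
integer, and it moves only when the curve reaches the next grid point, at distance one. The key
encodes the starting point and the word of unit steps of the walk. The word is encoded as a node of
the Calkin-Wilf tree (`treeNode`), where a run of `d` equal steps is one addition of `d` times an
entry; hence the code of a curve is computed with constantly many operations per vertex, no matter
how long its edges are (`wp_codeProg`).

*Equal keys mean small distance* (`frechetDist_le_of_walkCode_eq`). A curve stays within `w` of the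
curve that its word describes (`exists_factor`), so two curves with the same key have Fréchet
distance at most `2 w = 24 k r`, which is less than `(24 k + 1) r`. Hence every curve that is found
is a correct answer, with certainty.

*Near curves have equal keys* (`walkCode_eq_of_frechetDist_lt`). Let the curves have distance at
most `r`, and let the vertices of one of them keep distance more than `r` from the grid points.
Along an edge of that curve the walk of the other one only moves in the direction of the edge, and
at the end of the edge both walks agree on the last grid point that is reached. Which of the two
curves has the clear vertices does not matter.

*Some shift is clear.* The `k` vertices of a query are clear for a random shift with probability at
least `1 / 2`, so `c ⌈log₂ n⌉` independent random shifts fail with probability at most `n ^ (-c)`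
(`one_sub_le_randomStream`). If `min m k + 1` is not larger than this number, then that many equally
spaced shifts are used instead. Each vertex spoils at most one of them, so by the pigeonhole
principle one of them is clear of the vertices of the curve with fewer vertices
(`exists_clear_shift`).

*Time and space.* The number `R` of shifts is thus `O(log n)`, `O(m)` and `O(k)`. Coding all curves
takes time `O(n m R) = O(n m log n)`, and merge sort takes time `O(R n log n) = O(n m log n)`. A
query costs `O(R k)` for its codes and `O(R log n)` for binary searches, both `O(k log n)`, and the
arrays occupy `O(R n) = O(n log n)` cells. The programs are verified with a calculus of weakest
preconditions with a clock (`WP`).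
-/

/-! ### The hysteresis walk of a sequence of reals -/

/-- One step of the hysteresis walk. The state is the current integer position together with the
word of unit steps made so far, oldest first (`true` is a step up, `false` a step down). The
position moves only when the new value `z` has distance at least `1` from it, and then to the
last integer that is met on the way to `z`. -/
noncomputable def walkStep (S : ℤ × List Bool) (z : ℝ) : ℤ × List Bool :=
  if (S.1 : ℝ) + 1 ≤ z then (⌊z⌋, S.2 ++ List.replicate (⌊z⌋ - S.1).toNat true)
  else if z ≤ (S.1 : ℝ) - 1 then (⌈z⌉, S.2 ++ List.replicate (S.1 - ⌈z⌉).toNat false)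
  else S

/-- The walk that starts in the state `S` and visits `z 1, z 2, …, z i`. -/
noncomputable def walkFrom (S : ℤ × List Bool) (z : ℕ → ℝ) : ℕ → ℤ × List Bool
  | 0 => S
  | i + 1 => walkStep (walkFrom S z i) (z (i + 1))

/-- The walk of the sequence `z 0, z 1, …`, started at the integer below `z 0`. -/
noncomputable def walk (z : ℕ → ℝ) (i : ℕ) : ℤ × List Bool :=
  walkFrom (⌊z 0⌋, []) z i

theorem walkStep_of_abs_lt {S : ℤ × List Bool} {z : ℝ} (h : |z - S.1| < 1) :
    walkStep S z = S := by
  rw [abs_lt] at h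
  rw [walkStep, if_neg (by linarith), if_neg (by linarith)]

theorem abs_sub_walkStep_lt (S : ℤ × List Bool) (z : ℝ) : |z - (walkStep S z).1| < 1 := by
  unfold walkStep
  rw [abs_lt]
  split_ifs with h1 h2
  · constructor <;> simp only <;> linarith [Int.floor_le z, Int.lt_floor_add_one z]
  · constructor <;> simp only <;> linarith [Int.le_ceil z, Int.ceil_lt_add_one z]
  · constructor <;> linarith

theorem abs_sub_walkFrom_lt {S : ℤ × List Bool} {z : ℕ → ℝ} (h : |z 0 - S.1| < 1) (i : ℕ) :
    |z i - (walkFrom S z i).1| < 1 := by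
  cases i with
  | zero => exact h
  | succ i => exact abs_sub_walkStep_lt _ _

theorem abs_sub_floor_lt (x : ℝ) : |x - ⌊x⌋| < 1 := by
  rw [abs_lt]; constructor <;> linarith [Int.floor_le x, Int.lt_floor_add_one x]

theorem abs_sub_walk_lt (z : ℕ → ℝ) (i : ℕ) : |z i - (walk z i).1| < 1 :=
  abs_sub_walkFrom_lt (abs_sub_floor_lt _) i

/-- The mirror image of a state of the walk. -/
def mirror (S : ℤ × List Bool) : ℤ × List Bool := (-S.1, S.2.map (!·))

theorem mirror_mirror (S : ℤ × List Bool) : mirror (mirror S) = S := by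
  simp [mirror, Function.comp_def]

theorem mirror_injective : Function.Injective mirror :=
  Function.LeftInverse.injective mirror_mirror

/-- Reflection turns upward moves into downward ones, so that only upward moves need an argument. -/
theorem walkStep_mirror (S : ℤ × List Bool) (z : ℝ) :
    walkStep (mirror S) (-z) = mirror (walkStep S z) := by
  unfold walkStep mirror
  simp only [Int.cast_neg, Int.floor_neg, Int.ceil_neg]
  by_cases h1 : (S.1 : ℝ) + 1 ≤ z
  · rw [if_neg (by linarith), if_pos (by linarith), if_pos h1]
    simp only [List.map_append, List.map_replicate, Bool.not_true, Prod.mk.injEq, true_and]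
    congr 3; ring
  · rw [if_neg h1]
    by_cases h2 : z ≤ (S.1 : ℝ) - 1
    · rw [if_pos (by linarith), if_pos h2]
      simp only [List.map_append, List.map_replicate, Bool.not_false, Prod.mk.injEq, true_and]
      congr 3; ring
    · rw [if_neg (by linarith), if_neg (by linarith), if_neg h2]

theorem walkFrom_mirror (S : ℤ × List Bool) (z : ℕ → ℝ) (i : ℕ) :
    walkFrom (mirror S) (fun j => -z j) i = mirror (walkFrom S z i) := by
  induction i with
  | zero => rfl
  | succ i ih => rw [walkFrom, walkFrom, ih, walkStep_mirror]

theorem walkStep_walkStep_up {S : ℤ × List Bool} {a x y : ℝ} (h : |a - S.1| < 1) (hax : a ≤ x)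
    (hxy : x ≤ y) : walkStep (walkStep S x) y = walkStep S y := by
  rw [abs_lt] at h
  by_cases h1 : (S.1 : ℝ) + 1 ≤ x
  · have hS : S.1 + 1 ≤ ⌊x⌋ := by rw [Int.le_floor]; exact_mod_cast h1
    have hm : ⌊x⌋ ≤ ⌊y⌋ := Int.floor_le_floor hxy
    have hfx := Int.floor_le x
    rw [walkStep.eq_def S x, if_pos h1, walkStep.eq_def S y, if_pos (h1.trans hxy), walkStep]
    dsimp only
    by_cases h2 : (⌊x⌋ : ℝ) + 1 ≤ y
    · rw [if_pos h2, List.append_assoc, List.replicate_append_replicate]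
      congr 4; omega
    · have : ⌊y⌋ = ⌊x⌋ := by
        refine le_antisymm ?_ hm
        have : ⌊y⌋ < ⌊x⌋ + 1 := by rw [Int.floor_lt]; push_cast; linarith
        omega
      rw [if_neg h2, if_neg (by linarith), this]
  · rw [walkStep_of_abs_lt (z := x)]
    rw [abs_lt]; constructor <;> linarith

/-- A point on the way from `a` to `y` does not influence the walk. -/
theorem walkStep_walkStep {S : ℤ × List Bool} {a x y : ℝ} (h : |a - S.1| < 1)
    (hx : a ≤ x ∧ x ≤ y ∨ y ≤ x ∧ x ≤ a) : walkStep (walkStep S x) y = walkStep S y := by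
  rcases hx with hx | hx
  · exact walkStep_walkStep_up h hx.1 hx.2
  · apply mirror_injective
    rw [← walkStep_mirror, ← walkStep_mirror, ← walkStep_mirror]
    apply walkStep_walkStep_up (a := -a) _ (by linarith) (by linarith)
    simp only [mirror, Int.cast_neg]
    rw [← abs_neg]; convert h using 2; ring

/-! ### Coding the walk by natural numbers -/

/-- The displacement of a unit step. -/
def stepSign (σ : Bool) : ℤ := if σ then 1 else -1

/-- One step in the Calkin-Wilf tree. -/
def treeStep (a : ℕ × ℕ) (σ : Bool) : ℕ × ℕ :=
  if σ then (a.1, a.2 + a.1) else (a.1 + a.2, a.2)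

/-- The node of the Calkin-Wilf tree that is reached from the root `(1, 1)` along a word. -/
def treeNode (l : List Bool) : ℕ × ℕ := l.foldl treeStep (1, 1)

theorem treeNode_append_singleton (l : List Bool) (σ : Bool) :
    treeNode (l ++ [σ]) = treeStep (treeNode l) σ := by
  simp [treeNode]

theorem treeNode_pos (l : List Bool) : 0 < (treeNode l).1 ∧ 0 < (treeNode l).2 := by
  induction l using List.reverseRecOn with
  | nil => simp [treeNode]
  | append_singleton l σ ih =>
    rw [treeNode_append_singleton]
    cases σ <;> simp [treeStep] <;> omega

/-- Each node of the Calkin-Wilf tree determines its path: the last step is read off from which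
entry is larger. -/
theorem treeNode_injective : Function.Injective treeNode := by
  intro l
  induction l using List.reverseRecOn with
  | nil =>
    intro l' h
    rcases List.eq_nil_or_concat l' with rfl | ⟨l', σ, rfl⟩
    · rfl
    · have := treeNode_pos l'
      rw [List.concat_eq_append, treeNode_append_singleton] at h
      cases σ <;> simp [treeNode, treeStep, Prod.ext_iff] at h <;> simp [treeNode] at this <;> omega
  | append_singleton l σ ih =>
    intro l' h
    have hl := treeNode_pos l
    rcases List.eq_nil_or_concat l' with rfl | ⟨l', σ', rfl⟩
    · rw [treeNode_append_singleton] at h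
      cases σ <;> simp [treeNode, treeStep, Prod.ext_iff] at h <;> simp [treeNode] at hl <;> omega
    · have hl' := treeNode_pos l'
      rw [List.concat_eq_append, treeNode_append_singleton, treeNode_append_singleton] at h
      have key : σ = σ' ∧ treeNode l = treeNode l' := by
        rw [Prod.ext_iff]
        cases σ <;> cases σ' <;> simp [treeStep, Prod.ext_iff] at h ⊢ <;> omega
      rw [List.concat_eq_append, key.1, ih key.2]

theorem treeNode_append_replicate_true (l : List Bool) (d : ℕ) :
    treeNode (l ++ List.replicate d true) =
      ((treeNode l).1, (treeNode l).2 + d * (treeNode l).1) := by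
  induction d with
  | zero => simp
  | succ d ih =>
    rw [List.replicate_succ', ← List.append_assoc, treeNode_append_singleton, ih]
    simp [treeStep]; ring

theorem treeNode_append_replicate_false (l : List Bool) (d : ℕ) :
    treeNode (l ++ List.replicate d false) =
      ((treeNode l).1 + d * (treeNode l).2, (treeNode l).2) := by
  induction d with
  | zero => simp
  | succ d ih =>
    rw [List.replicate_succ', ← List.append_assoc, treeNode_append_singleton, ih]
    simp [treeStep]; ring

/-- A polynomial pairing function: it is injective because `a ≤ a + b`. -/
def pairCode (a b : ℕ) : ℕ := (a + b) ^ 2 + a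

theorem pairCode_inj {a b a' b' : ℕ} (h : pairCode a b = pairCode a' b') : a = a' ∧ b = b' := by
  unfold pairCode at h
  have : a + b = a' + b' := by
    rcases lt_trichotomy (a + b) (a' + b') with h1 | h1 | h1
    · nlinarith
    · exact h1
    · nlinarith
  rw [this] at h
  omega

/-- An injective polynomial map from the integers to the natural numbers. -/
def intCode (b : ℤ) : ℕ := (b * (2 * b + 1)).toNat

theorem intCode_cast (b : ℤ) : (intCode b : ℤ) = b * (2 * b + 1) := by
  apply Int.toNat_of_nonneg
  rcases le_or_gt 0 b with h | h
  · positivity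
  · nlinarith

theorem intCode_inj {b b' : ℤ} (h : intCode b = intCode b') : b = b' := by
  have h1 : (b - b') * (2 * (b + b') + 1) = 0 := by
    have := intCode_cast b
    rw [h, intCode_cast] at this
    linarith
  rcases mul_eq_zero.1 h1 with h2 | h2 <;> omega

/-- The code of the walk of the sequence `z 0, …, z i`. -/
noncomputable def walkCode (z : ℕ → ℝ) (i : ℕ) : ℕ :=
  pairCode (intCode ⌊z 0⌋) (pairCode (treeNode (walk z i).2).1 (treeNode (walk z i).2).2)

theorem walkCode_eq_iff {z z' : ℕ → ℝ} {i i' : ℕ} :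
    walkCode z i = walkCode z' i' ↔ ⌊z 0⌋ = ⌊z' 0⌋ ∧ (walk z i).2 = (walk z' i').2 := by
  constructor
  · intro h
    have h1 := pairCode_inj h
    have h2 := pairCode_inj h1.2
    exact ⟨intCode_inj h1.1, treeNode_injective (Prod.ext h2.1 h2.2)⟩
  · rintro ⟨h1, h2⟩
    rw [walkCode, walkCode, h1, h2]

/-! ### The curve of a word -/

/-- The piecewise linear curve that makes the unit steps of a word, starting from `0` at time `0`,
one per unit of time. It is constant before and after. -/
noncomputable def wordCurve : List Bool → ℝ → ℝ
  | [], _ => 0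
  | σ :: l, u => stepSign σ * max 0 (min 1 u) + wordCurve l (u - 1)

theorem wordCurve_of_nonpos (l : List Bool) {u : ℝ} (hu : u ≤ 0) : wordCurve l u = 0 := by
  induction l generalizing u with
  | nil => rfl
  | cons σ l ih =>
    rw [wordCurve, ih (by linarith), max_eq_left (min_le_of_right_le hu)]; ring

theorem wordCurve_append (l l' : List Bool) (u : ℝ) :
    wordCurve (l ++ l') u = wordCurve l u + wordCurve l' (u - l.length) := by
  induction l generalizing u with
  | nil => simp [wordCurve]
  | cons σ l ih =>
    rw [List.cons_append, wordCurve, wordCurve, ih, List.length_cons]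
    push_cast
    rw [show u - 1 - (l.length : ℝ) = u - (l.length + 1) by ring]; ring

theorem wordCurve_of_length_le (l : List Bool) {u : ℝ} (hu : (l.length : ℝ) ≤ u) :
    wordCurve l u = wordCurve l l.length := by
  induction l generalizing u with
  | nil => rfl
  | cons σ l ih =>
    rw [List.length_cons] at hu ⊢
    push_cast at hu ⊢
    have hl : (0 : ℝ) ≤ l.length := by positivity
    rw [wordCurve, wordCurve, ih (by linarith), min_eq_left (by linarith),
      min_eq_left (by linarith)]
    ring_nf

theorem wordCurve_replicate (d : ℕ) (σ : Bool) {u : ℝ} (h0 : 0 ≤ u) (h1 : u ≤ d) :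
    wordCurve (List.replicate d σ) u = stepSign σ * u := by
  induction d generalizing u with
  | zero =>
    have : u = 0 := le_antisymm (by simpa using h1) h0
    simp [this, wordCurve]
  | succ d ih =>
    push_cast at h1
    rw [List.replicate_succ, wordCurve]
    rcases le_or_gt u 1 with hu | hu
    · rw [wordCurve_of_nonpos _ (by linarith), min_eq_right hu, max_eq_right h0]; ring
    · rw [ih (by linarith) (by linarith), min_eq_left hu.le, max_eq_right zero_le_one]; ring

theorem abs_clamp_sub_le (u v : ℝ) : |max 0 (min 1 u) - max 0 (min 1 v)| ≤ |u - v| := by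
  refine (abs_max_sub_max_le_max _ _ _ _).trans ?_
  refine max_le (by simp) ?_
  exact (abs_min_sub_min_le_max _ _ _ _).trans (max_le (by simp) le_rfl)

theorem abs_wordCurve_sub_le (l : List Bool) (u v : ℝ) :
    |wordCurve l u - wordCurve l v| ≤ l.length * |u - v| := by
  induction l generalizing u v with
  | nil => simp [wordCurve]
  | cons σ l ih =>
    rw [wordCurve, wordCurve, List.length_cons]
    have h1 := ih (u - 1) (v - 1)
    rw [show u - 1 - (v - 1) = u - v by ring] at h1
    have h2 : |(stepSign σ : ℝ) * max 0 (min 1 u) - stepSign σ * max 0 (min 1 v)| ≤ |u - v| := by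
      rw [← mul_sub, abs_mul]
      have : |(stepSign σ : ℝ)| = 1 := by cases σ <;> simp [stepSign]
      rw [this, one_mul]
      exact abs_clamp_sub_le u v
    push_cast
    calc _ = |((stepSign σ : ℝ) * max 0 (min 1 u) - stepSign σ * max 0 (min 1 v)) +
          (wordCurve l (u - 1) - wordCurve l (v - 1))| := by congr 1; ring
      _ ≤ |u - v| + l.length * |u - v| := (abs_add_le _ _).trans (add_le_add h2 h1)
      _ = _ := by ring

/-! ### Curves with the same walk are close -/

theorem walkFrom_succ_eq (S : ℤ × List Bool) (z : ℕ → ℝ) (i : ℕ) :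
    ∃ (d : ℕ) (σ : Bool),
      (walkFrom S z (i + 1)).2 = (walkFrom S z i).2 ++ List.replicate d σ ∧
      (walkFrom S z (i + 1)).1 = (walkFrom S z i).1 + stepSign σ * d := by
  rw [walkFrom]
  generalize walkFrom S z i = S'
  generalize z (i + 1) = y
  unfold walkStep
  split_ifs with h1 h2
  · refine ⟨_, _, rfl, ?_⟩
    have : S'.1 + 1 ≤ ⌊y⌋ := by rw [Int.le_floor]; exact_mod_cast h1
    simp only [stepSign, if_true]; omega
  · refine ⟨_, _, rfl, ?_⟩
    have : ⌈y⌉ ≤ S'.1 - 1 := by rw [Int.ceil_le]; exact_mod_cast h2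
    simp only [stepSign, Bool.false_eq_true, if_false]; omega
  · exact ⟨0, true, by simp, by simp⟩

theorem walk_prefix (z : ℕ → ℝ) {i j : ℕ} (h : i ≤ j) :
    ∃ l, (walk z j).2 = (walk z i).2 ++ l := by
  induction j, h using Nat.le_induction with
  | base => exact ⟨[], by simp⟩
  | succ j _ ih =>
    obtain ⟨l, hl⟩ := ih
    obtain ⟨d, σ, h1, -⟩ := walkFrom_succ_eq (⌊z 0⌋, []) z j
    exact ⟨l ++ List.replicate d σ, by
      rw [← List.append_assoc, ← hl]; exact h1⟩

/-- The end of the curve of the word is the position of the walk. -/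
theorem walk_fst_eq (z : ℕ → ℝ) (i : ℕ) :
    ((walk z i).1 : ℝ) = ⌊z 0⌋ + wordCurve (walk z i).2 (walk z i).2.length := by
  induction i with
  | zero => simp [walk, walkFrom, wordCurve]
  | succ i ih =>
    obtain ⟨d, σ, h1, h2⟩ := walkFrom_succ_eq (⌊z 0⌋, []) z i
    change (walk z (i + 1)).2 = (walk z i).2 ++ _ at h1
    change (walk z (i + 1)).1 = (walk z i).1 + _ at h2
    rw [h1, h2, wordCurve_append, List.length_append, List.length_replicate]
    push_cast
    rw [wordCurve_of_length_le _ (by linarith [(Nat.cast_nonneg d : (0 : ℝ) ≤ d)]),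
      add_sub_cancel_left, wordCurve_replicate d σ (by positivity) le_rfl, ih]
    ring

/-- Between the times at which the walk has processed `z i` and `z (i + 1)`, the curve of its word
is the segment between the two positions. -/
theorem wordCurve_between (z : ℕ → ℝ) {i n : ℕ} (h : i + 1 ≤ n) {θ : ℝ} (h0 : 0 ≤ θ)
    (h1 : θ ≤ 1) :
    ⌊z 0⌋ + wordCurve (walk z n).2 ((walk z i).2.length +
        θ * ((walk z (i + 1)).2.length - (walk z i).2.length)) =
      (walk z i).1 + θ * ((walk z (i + 1)).1 - (walk z i).1) := by
  obtain ⟨l, hl⟩ := walk_prefix z h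
  obtain ⟨d, σ, e1, e2⟩ := walkFrom_succ_eq (⌊z 0⌋, []) z i
  change (walk z (i + 1)).2 = (walk z i).2 ++ _ at e1
  change (walk z (i + 1)).1 = (walk z i).1 + _ at e2
  have hd : (0 : ℝ) ≤ d := Nat.cast_nonneg d
  have hle : θ * d ≤ d := mul_le_of_le_one_left hd h1
  rw [hl, e1, e2, wordCurve_append, wordCurve_append, List.length_append, List.length_replicate]
  push_cast
  have hE := walk_fst_eq z i
  rw [wordCurve_of_length_le _ (by nlinarith), wordCurve_of_nonpos l (by linarith),
    show ((walk z i).2.length : ℝ) + θ * ((walk z i).2.length + d - (walk z i).2.length)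
      - (walk z i).2.length = θ * d by ring,
    wordCurve_replicate d σ (by positivity) hle, hE]
  ring

theorem frechetDist_le {p q : C(unitInterval, ℝ)} {c : ℝ} (φ : Matching)
    (h : ∀ a, |p (φ.f a) - q (φ.g a)| ≤ c) : frechetDist p q ≤ c := by
  unfold frechetDist
  refine (ciInf_le ⟨0, ?_⟩ φ).trans (ciSup_le h)
  rintro _ ⟨ψ, rfl⟩
  exact Real.iSup_nonneg fun a => abs_nonneg _

theorem exists_matching_of_frechetDist_lt {p q : C(unitInterval, ℝ)} {c : ℝ}
    (h : frechetDist p q < c) : ∃ φ : Matching, ∀ a, |p (φ.f a) - q (φ.g a)| < c := by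
  have : Nonempty Matching :=
    ⟨⟨id, id, continuous_id, continuous_id, monotone_id, monotone_id, rfl, rfl, rfl, rfl⟩⟩
  obtain ⟨φ, hφ⟩ := exists_lt_of_ciInf_lt h
  refine ⟨φ, fun a => lt_of_le_of_lt ?_ hφ⟩
  refine le_ciSup (f := fun a => |p (φ.f a) - q (φ.g a)|) ?_ a
  have hc : Continuous fun a => |p (φ.f a) - q (φ.g a)| :=
    ((p.continuous.comp φ.continuous_f).sub (q.continuous.comp φ.continuous_g)).abs
  exact (isCompact_range hc).bddAbove

/-- A monotone function on `[0,1]` becomes linear after an almost inverse reparametrization. -/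
theorem exists_reparametrization {φ : unitInterval → ℝ} (hc : Continuous φ) (hm : Monotone φ)
    {N ε : ℝ} (h0 : φ 0 = 0) (h1 : φ 1 = N) (hε : 0 < ε) :
    ∃ f : unitInterval → unitInterval, Continuous f ∧ Monotone f ∧ f 0 = 0 ∧ f 1 = 1 ∧
      ∀ a, φ (f a) + ε * (f a : ℝ) = (N + ε) * (a : ℝ) := by
  have hN : 0 ≤ N := by rw [← h0, ← h1]; exact hm zero_le_one
  have hpos : 0 < N + ε := by linarith
  let h : unitInterval → unitInterval := fun t =>
    ⟨(φ t + ε * (t : ℝ)) / (N + ε), by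
      have h2 := hm (unitInterval.nonneg' : 0 ≤ t)
      have h3 := hm (unitInterval.le_one' : t ≤ 1)
      have h4 := t.2.1
      have h5 := t.2.2
      constructor
      · apply div_nonneg _ hpos.le
        nlinarith
      · rw [div_le_one hpos]
        nlinarith⟩
  have hh : StrictMono h := by
    intro s t hst
    have h2 := hm hst.le
    have h3 : (s : ℝ) < t := hst
    refine Subtype.mk_lt_mk.2 ?_
    rw [div_lt_div_iff_of_pos_right hpos]
    nlinarith
  have hcont : Continuous h := by
    refine Continuous.subtype_mk ?_ _
    fun_prop
  have e0 : h 0 = 0 := Subtype.ext (by simp [h, h0])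
  have e1 : h 1 = 1 := Subtype.ext (by simp [h, h1, div_self hpos.ne'])
  have hsurj : Function.Surjective h := by
    intro y
    have := intermediate_value_univ (0 : unitInterval) 1 hcont
    rw [e0, e1] at this
    exact this ⟨unitInterval.nonneg', unitInterval.le_one'⟩
  let e := hh.orderIsoOfSurjective h hsurj
  have he : ∀ a, h (e.symm a) = a := fun a => hh.orderIsoOfSurjective_self_symm_apply h hsurj a
  refine ⟨e.symm, e.symm.continuous, e.symm.monotone, ?_, ?_, fun a => ?_⟩
  · apply hh.injective; rw [he, e0]
  · apply hh.injective; rw [he, e1]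
  · have := congrArg (Subtype.val) (he a)
    simp only [h] at this
    rw [div_eq_iff hpos.ne'] at this
    linarith

/-- Two curves have Fréchet distance at most `2 * c` if both stay within distance `c` of the same
Lipschitz curve `W` along monotone parametrizations `φ` and `ψ` with the same range. These need not
be injective, so both are made linear up to a small `ε`; this costs at most `ε` times a Lipschitz
constant. -/
theorem frechetDist_le_of_factor {p q : C(unitInterval, ℝ)} {W : ℝ → ℝ} {K N c : ℝ}
    (hW : ∀ u v, |W u - W v| ≤ K * |u - v|) {φ ψ : unitInterval → ℝ} (hφ : Continuous φ)
    (hφm : Monotone φ) (hφ0 : φ 0 = 0) (hφ1 : φ 1 = N) (hψ : Continuous ψ) (hψm : Monotone ψ)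
    (hψ0 : ψ 0 = 0) (hψ1 : ψ 1 = N) (hp : ∀ t, |p t - W (φ t)| ≤ c)
    (hq : ∀ t, |q t - W (ψ t)| ≤ c) : frechetDist p q ≤ 2 * c := by
  have hK : 0 ≤ K := by
    have h1 := hW 1 0
    have h2 := abs_nonneg (W 1 - W 0)
    rw [sub_zero, abs_one, mul_one] at h1
    linarith
  refine le_of_forall_pos_le_add fun ε hε => ?_
  have hε' : 0 < ε / (K + 1) := by positivity
  obtain ⟨f, fc, fm, f0, f1, hf⟩ := exists_reparametrization hφ hφm hφ0 hφ1 hε'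
  obtain ⟨g, gc, gm, g0, g1, hg⟩ := exists_reparametrization hψ hψm hψ0 hψ1 hε'
  refine frechetDist_le ⟨f, g, fc, gc, fm, gm, f0, g0, f1, g1⟩ fun a => ?_
  have hd : |φ (f a) - ψ (g a)| ≤ ε / (K + 1) := by
    have e : φ (f a) - ψ (g a) = ε / (K + 1) * ((g a : ℝ) - f a) := by
      linarith [hf a, hg a]
    rw [e, abs_mul, abs_of_pos hε']
    refine mul_le_of_le_one_right hε'.le ?_
    rw [abs_le]
    constructor <;> linarith [(f a).2.1, (f a).2.2, (g a).2.1, (g a).2.2]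
  have hWd : |W (φ (f a)) - W (ψ (g a))| ≤ ε := by
    refine (hW _ _).trans ((mul_le_mul_of_nonneg_left hd hK).trans ?_)
    rw [mul_div_assoc', div_le_iff₀ (by linarith)]
    nlinarith
  calc |p (f a) - q (g a)|
      = |(p (f a) - W (φ (f a))) + (W (φ (f a)) - W (ψ (g a))) - (q (g a) - W (ψ (g a)))| := by
        congr 1; ring
    _ ≤ |p (f a) - W (φ (f a))| + |W (φ (f a)) - W (ψ (g a))| + |q (g a) - W (ψ (g a))| :=
        (abs_sub _ _).trans (add_le_add_left (abs_add_le _ _) _)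
    _ ≤ 2 * c + ε := by linarith [hp (f a), hq (g a)]

/-- The vertices of a time series in the grid of width `w` shifted by `s`, where the grid points
become the integers. -/
noncomputable def scaled {m : ℕ} (x : Fin m → ℝ) (w s : ℝ) (i : ℕ) : ℝ := vertexAt x i / w + s

theorem timeSeries_monotone_of_monotone {m : ℕ} {x : Fin m → ℝ}
    (h : ∀ i, i < m - 1 → vertexAt x i ≤ vertexAt x (i + 1)) : Monotone (timeSeries x) := by
  intro s t hst
  change vertexAt x 0 + _ ≤ vertexAt x 0 + _
  gcongr with i hi
  exact sub_nonneg.2 (h i (Finset.mem_range.1 hi))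

theorem timeSeries_zero {m : ℕ} (x : Fin m → ℝ) : timeSeries x 0 = vertexAt x 0 := by
  change vertexAt x 0 + ∑ i ∈ Finset.range (m - 1), (vertexAt x (i + 1) - vertexAt x i) *
    max 0 (min 1 (((m - 1 : ℕ) : ℝ) * ((0 : unitInterval) : ℝ) - (i : ℝ))) = _
  rw [Finset.sum_eq_zero, add_zero]
  intro i _
  rw [Set.Icc.coe_zero, mul_zero, zero_sub, max_eq_left, mul_zero]
  exact min_le_of_right_le (neg_nonpos.2 (Nat.cast_nonneg i))

theorem timeSeries_of_sub_one_eq_zero {m : ℕ} (x : Fin m → ℝ) (h : m - 1 = 0)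
    (t : unitInterval) : timeSeries x t = vertexAt x 0 := by
  change vertexAt x 0 + ∑ i ∈ Finset.range (m - 1), _ = _
  rw [h, Finset.sum_range_zero, add_zero]

theorem timeSeries_vertex {m : ℕ} (x : Fin m → ℝ) (t : unitInterval) {j : ℕ} (hj : j ≤ m - 1)
    (h : ((m - 1 : ℕ) : ℝ) * (t : ℝ) = j) : timeSeries x t = vertexAt x j := by
  rcases hj.lt_or_eq with hj | rfl
  · rw [timeSeries_apply x t j hj h.ge (by linarith), h]; ring
  · rcases Nat.eq_zero_or_pos (m - 1) with h0 | h0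
    · rw [timeSeries_of_sub_one_eq_zero x h0, h0]
    · obtain ⟨j, hj⟩ := Nat.exists_eq_add_of_lt h0
      have e : m - 1 = j + 1 := by omega
      rw [timeSeries_apply x t j (by omega), h, e]
      · push_cast; ring
      · rw [h, e]; push_cast; linarith
      · rw [h, e]; push_cast; linarith

theorem timeSeries_one {m : ℕ} (x : Fin m → ℝ) : timeSeries x 1 = vertexAt x (m - 1) :=
  timeSeries_vertex x 1 le_rfl (by simp)

theorem exists_edge {m : ℕ} (h : 0 < m - 1) (t : unitInterval) : ∃ j : ℕ, j < m - 1 ∧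
    (j : ℝ) ≤ ((m - 1 : ℕ) : ℝ) * (t : ℝ) ∧ ((m - 1 : ℕ) : ℝ) * (t : ℝ) ≤ (j : ℝ) + 1 := by
  have hm : (0 : ℝ) < ((m - 1 : ℕ) : ℝ) := by exact_mod_cast h
  have hu0 : 0 ≤ ((m - 1 : ℕ) : ℝ) * (t : ℝ) := mul_nonneg hm.le t.2.1
  rcases lt_or_ge ⌊((m - 1 : ℕ) : ℝ) * (t : ℝ)⌋₊ (m - 1) with h1 | h1
  · exact ⟨_, h1, Nat.floor_le hu0, (Nat.lt_floor_add_one _).le⟩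
  · have h2 : ((m - 1 : ℕ) : ℝ) ≤ ((m - 1 : ℕ) : ℝ) * (t : ℝ) := by
      refine le_trans ?_ (Nat.floor_le hu0)
      exact_mod_cast h1
    have h3 : ((m - 1 : ℕ) : ℝ) * (t : ℝ) ≤ ((m - 1 : ℕ) : ℝ) := mul_le_of_le_one_right hm.le t.2.2
    have h4 : ((m - 1 - 1 : ℕ) : ℝ) + 1 = ((m - 1 : ℕ) : ℝ) := by
      rw [Nat.cast_sub h]; push_cast; ring
    exact ⟨m - 1 - 1, by omega, by linarith, by linarith⟩

theorem vertexAt_mk {m : ℕ} (u : ℕ → ℝ) {i : ℕ} (h : i < m) :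
    vertexAt (fun j : Fin m => u j) i = u i := by
  simp [vertexAt, h]

/-- A time series stays within distance `w` of the curve of its word, suitably parametrized. -/
theorem exists_factor {m : ℕ} (hm : 1 ≤ m) (x : Fin m → ℝ) {w : ℝ} (hw : 0 < w) (s : ℝ) :
    ∃ φ : unitInterval → ℝ, Continuous φ ∧ Monotone φ ∧ φ 0 = 0 ∧
      φ 1 = (walk (scaled x w s) (m - 1)).2.length ∧
      ∀ t, |timeSeries x t - w * (⌊scaled x w s 0⌋ +
        wordCurve (walk (scaled x w s) (m - 1)).2 (φ t) - s)| ≤ w := by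
  set z := scaled x w s with hz
  let N : ℕ → ℝ := fun i => (walk z i).2.length
  have hx : ∀ i, vertexAt x i = w * (z i - s) := fun i => by
    rw [hz, scaled]; field_simp; ring
  have hv : ∀ i, i ≤ m - 1 → vertexAt (fun j : Fin m => N j) i = N i := fun i hi =>
    vertexAt_mk N (by omega)
  refine ⟨timeSeries (fun j : Fin m => N j), (timeSeries _).continuous, ?_, ?_, ?_, fun t => ?_⟩
  · refine timeSeries_monotone_of_monotone fun i hi => ?_
    rw [hv i hi.le, hv (i + 1) hi]
    obtain ⟨l, hl⟩ := walk_prefix z (Nat.le_succ i)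
    simp [N, hl]
  · rw [timeSeries_zero, hv 0 (Nat.zero_le _)]
    simp [N, walk, walkFrom]
  · rw [timeSeries_one, hv _ le_rfl]
  · have hb : ∀ i, |w * (z i - (walk z i).1)| ≤ w := fun i => by
      rw [abs_mul, abs_of_pos hw]
      exact mul_le_of_le_one_right hw.le (abs_sub_walk_lt z i).le
    rcases Nat.eq_zero_or_pos (m - 1) with h0 | h0
    · rw [timeSeries_of_sub_one_eq_zero _ h0, timeSeries_of_sub_one_eq_zero _ h0,
        hv 0 (Nat.zero_le _), h0, hx 0]
      convert hb 0 using 2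
      simp only [walk, walkFrom, wordCurve]
      ring
    · obtain ⟨j, hj, h1, h2⟩ := exists_edge h0 t
      rw [timeSeries_apply x t j hj h1 h2, timeSeries_apply _ t j hj h1 h2, hv j hj.le,
        hv (j + 1) hj]
      generalize ((m - 1 : ℕ) : ℝ) * (t : ℝ) = u at *
      have hθ0 : 0 ≤ u - j := by linarith
      have hθ1 : u - j ≤ 1 := by linarith
      simp only [N]
      rw [wordCurve_between z hj hθ0 hθ1, hx, hx]
      have a1 := abs_le.1 (hb j)
      have a2 := abs_le.1 (hb (j + 1))
      rw [abs_le]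
      constructor <;> nlinarith

/-- Two time series with the same walk have Fréchet distance at most twice the grid width. -/
theorem frechetDist_le_of_walkCode_eq {m k : ℕ} (hm : 1 ≤ m) (hk : 1 ≤ k) (x : Fin m → ℝ)
    (y : Fin k → ℝ) {w : ℝ} (hw : 0 < w) (s : ℝ)
    (h : walkCode (scaled x w s) (m - 1) = walkCode (scaled y w s) (k - 1)) :
    frechetDist (timeSeries x) (timeSeries y) ≤ 2 * w := by
  obtain ⟨φ, hφ, hφm, hφ0, hφ1, hp⟩ := exists_factor hm x hw s
  obtain ⟨ψ, hψ, hψm, hψ0, hψ1, hq⟩ := exists_factor hk y hw s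
  obtain ⟨h1, h2⟩ := walkCode_eq_iff.1 h
  rw [← h1, ← h2] at hq
  rw [← h2] at hψ1
  refine frechetDist_le_of_factor
    (W := fun u => w * (⌊scaled x w s 0⌋ + wordCurve (walk (scaled x w s) (m - 1)).2 u - s))
    (K := w * (walk (scaled x w s) (m - 1)).2.length) ?_ hφ hφm hφ0 hφ1 hψ hψm hψ0 hψ1 hp hq
  intro u v
  rw [← mul_sub, abs_mul, abs_of_pos hw, mul_assoc]
  refine mul_le_mul_of_nonneg_left ?_ hw.le
  refine le_of_eq_of_le ?_ (abs_wordCurve_sub_le _ u v)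
  congr 1
  ring

/-! ### Nearby curves have the same walk -/

/-- `P` interpolates the values `z 0, …, z M` linearly, with `z j` attained at `j / M`. -/
def IsInterpolation (M : ℕ) (z : ℕ → ℝ) (P : unitInterval → ℝ) : Prop :=
  (∀ (t : unitInterval) (j : ℕ), j < M → (j : ℝ) ≤ M * t → (M : ℝ) * t ≤ j + 1 →
    P t = z j + (M * t - j) * (z (j + 1) - z j)) ∧ (M = 0 → ∀ t, P t = z 0)

theorem isInterpolation_timeSeries {m : ℕ} (x : Fin m → ℝ) (w s : ℝ) :
    IsInterpolation (m - 1) (scaled x w s) (fun t => timeSeries x t / w + s) := by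
  refine ⟨fun t j hj h1 h2 => ?_, fun h t => ?_⟩
  · simp only [timeSeries_apply x t j hj h1 h2, scaled]; ring
  · simp only [timeSeries_of_sub_one_eq_zero x h, scaled]

namespace IsInterpolation

variable {M : ℕ} {z : ℕ → ℝ} {P : unitInterval → ℝ}

theorem neg (h : IsInterpolation M z P) :
    IsInterpolation M (fun i => -z i) (fun t => -P t) :=
  ⟨fun t j hj h1 h2 => by simp only [h.1 t j hj h1 h2]; ring, fun h0 t => by simp only [h.2 h0 t]⟩

theorem vertex (h : IsInterpolation M z P) {t : unitInterval} {j : ℕ} (hj : j ≤ M)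
    (ht : (M : ℝ) * t = j) : P t = z j := by
  rcases hj.lt_or_eq with hj | rfl
  · rw [h.1 t j hj ht.ge (by linarith), ht]; ring
  · cases j with
    | zero => exact h.2 rfl t
    | succ j =>
      rw [h.1 t j (Nat.lt_succ_self _) (by rw [ht]; push_cast; linarith)
        (by rw [ht]; push_cast; linarith), ht]
      push_cast; ring

end IsInterpolation

/-- The state of the walk along an interpolation `P` of `z 0, …, z M` up to the parameter `t`:
the vertices before `t` are visited, and then `P t`. -/
noncomputable def curveWalk (S : ℤ × List Bool) (M : ℕ) (z : ℕ → ℝ) (P : unitInterval → ℝ)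
    (t : unitInterval) : ℤ × List Bool :=
  walkStep (walkFrom S z ⌊(M : ℝ) * t⌋₊) (P t)

theorem curveWalk_mirror (S : ℤ × List Bool) (M : ℕ) (z : ℕ → ℝ) (P : unitInterval → ℝ)
    (t : unitInterval) :
    curveWalk (mirror S) M (fun i => -z i) (fun t => -P t) t = mirror (curveWalk S M z P t) := by
  rw [curveWalk, walkFrom_mirror, walkStep_mirror, curveWalk]

section

variable {M : ℕ} {z : ℕ → ℝ} {P : unitInterval → ℝ} {S : ℤ × List Bool}

theorem curveWalk_vertex (h : IsInterpolation M z P) (hS : |z 0 - S.1| < 1) {t : unitInterval}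
    {j : ℕ} (hj : j ≤ M) (ht : (M : ℝ) * t = j) : curveWalk S M z P t = walkFrom S z j := by
  rw [curveWalk, h.vertex hj ht, ht, Nat.floor_natCast]
  exact walkStep_of_abs_lt (abs_sub_walkFrom_lt hS j)

/-- The walk along a curve can be continued from `t₁` to any `t₂` up to the next vertex: by
`walkStep_walkStep`, a stop at `P t₁` in the middle of an edge changes nothing. -/
theorem curveWalk_step (h : IsInterpolation M z P) (hS : |z 0 - S.1| < 1) {t₁ t₂ : unitInterval}
    (h12 : t₁ ≤ t₂) (h2 : (M : ℝ) * t₂ ≤ ⌊(M : ℝ) * t₁⌋₊ + 1) :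
    curveWalk S M z P t₂ = walkStep (curveWalk S M z P t₁) (P t₂) := by
  have hM : (0 : ℝ) ≤ M := Nat.cast_nonneg M
  have h12' : (M : ℝ) * t₁ ≤ M * t₂ := mul_le_mul_of_nonneg_left h12 hM
  have hf : (⌊(M : ℝ) * t₁⌋₊ : ℝ) ≤ M * t₁ := Nat.floor_le (mul_nonneg hM t₁.2.1)
  have hM2 : (M : ℝ) * t₂ ≤ M := mul_le_of_le_one_right hM t₂.2.2
  set i := ⌊(M : ℝ) * t₁⌋₊ with hi
  have hlt : (M : ℝ) * t₁ < i + 1 := Nat.lt_floor_add_one _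
  have hiM : i ≤ M := by exact_mod_cast hf.trans (h12'.trans hM2)
  rcases hiM.lt_or_eq with hiM | hiM
  · -- both parameters lie on the edge from `z i` to `z (i + 1)`
    have e1 := h.1 t₁ i hiM hf hlt.le
    have e2 := h.1 t₂ i hiM (hf.trans h12') h2
    have hb : z i ≤ P t₁ ∧ P t₁ ≤ P t₂ ∨ P t₂ ≤ P t₁ ∧ P t₁ ≤ z i := by
      rw [e1, e2]
      rcases le_total (z i) (z (i + 1)) with hz | hz
      · left; constructor <;> nlinarith
      · right; constructor <;> nlinarith
    have hc := walkStep_walkStep (abs_sub_walkFrom_lt hS i) hb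
    rw [curveWalk.eq_def S M z P t₁, ← hi, hc, curveWalk]
    rcases h2.lt_or_eq with h3 | h3
    · rw [(Nat.floor_eq_iff (mul_nonneg hM t₂.2.1)).2 ⟨hf.trans h12', h3⟩]
    · have h3' : (M : ℝ) * t₂ = (i + 1 : ℕ) := by rw [h3]; push_cast; rfl
      rw [h3', Nat.floor_natCast, h.vertex hiM h3', walkFrom]
      exact walkStep_of_abs_lt (abs_sub_walkStep_lt _ _)
  · have e : (M : ℝ) * t₁ = M * t₂ := by
      rw [hiM] at hf; linarith
    have hP : P t₁ = P t₂ := by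
      rw [hiM] at hf
      rw [h.vertex le_rfl (t := t₁) (by linarith), h.vertex le_rfl (t := t₂) (by linarith)]
    rw [curveWalk, ← e, ← hP]
    exact (walkStep_of_abs_lt (abs_sub_walkStep_lt _ _)).symm

/-- A property that is preserved by the steps of `curveWalk_step` propagates along an interval of
parameters. -/
theorem curve_induction {f : unitInterval → unitInterval} (hf : Continuous f) (M : ℕ)
    {a a' : unitInterval} (C : unitInterval → Prop)
    (h0 : C a) (hs : ∀ α₁ α₂, a ≤ α₁ → α₁ ≤ α₂ → α₂ ≤ a' →
      (M : ℝ) * f α₂ ≤ ⌊(M : ℝ) * f α₁⌋₊ + 1 → C α₁ → C α₂) :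
    ∀ α, a ≤ α → α ≤ a' → C α := by
  have hM : (0 : ℝ) ≤ M := Nat.cast_nonneg M
  suffices H : ∀ (n : ℕ) α, a ≤ α → α ≤ a' → (M : ℝ) * f α ≤ ⌊(M : ℝ) * f a⌋₊ + 1 + n → C α by
    intro α h1 h2
    refine H M α h1 h2 ?_
    have := mul_le_of_le_one_right hM (f α).2.2
    have h3 : (0 : ℝ) ≤ ⌊(M : ℝ) * f a⌋₊ := Nat.cast_nonneg _
    linarith
  intro n
  induction n with
  | zero =>
    intro α h1 h2 h3
    exact hs a α le_rfl h1 h2 (by simpa using h3) h0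
  | succ n ih =>
    intro α h1 h2 h3
    rcases le_or_gt ((M : ℝ) * f α) (⌊(M : ℝ) * f a⌋₊ + 1 + n) with h4 | h4
    · exact ih α h1 h2 h4
    · have hcont : ContinuousOn (fun β => (M : ℝ) * (f β : ℝ)) (Set.Icc a α) :=
        Continuous.continuousOn (by fun_prop)
      have hlt := Nat.lt_floor_add_one ((M : ℝ) * f a)
      have hn : (0 : ℝ) ≤ n := Nat.cast_nonneg n
      obtain ⟨β, hβ, hβe⟩ := intermediate_value_Icc h1 hcont ⟨by linarith, h4.le⟩
      simp only at hβe
      refine hs β α hβ.1 hβ.2 h2 ?_ (ih β hβ.1 (hβ.2.trans h2) hβe.le)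
      have e : (M : ℝ) * f β = (⌊(M : ℝ) * f a⌋₊ + 1 + n : ℕ) := by rw [hβe]; push_cast; rfl
      rw [e, Nat.floor_natCast]
      push_cast at h3 ⊢
      linarith

/-- While a monotone function `H` stays close to a curve, and its end values are clear of the
integers, the walk along the curve makes the same net step as one step to the end value of `H`.
The position never moves down: at first because `H` starts clear of the integer below, and after a
move up to an integer because `H`, and with it the curve, cannot fall far below that integer again.
At the end, clearness makes `H` and the curve agree on the last integer that is reached. -/
theorem curveWalk_edge_up (h : IsInterpolation M z P) (hS : |z 0 - S.1| < 1)
    {f : unitInterval → unitInterval} (hf : Continuous f) (hm : Monotone f)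
    {a a' : unitInterval} (haa : a ≤ a') {H : unitInterval → ℝ} (hH : MonotoneOn H (Set.Icc a a'))
    {δ : ℝ} (hδ : δ ≤ 1 / 2) (hd : ∀ α ∈ Set.Icc a a', |P (f α) - H α| < δ)
    (ha : ∀ n : ℤ, δ ≤ |H a - n|) (ha' : ∀ n : ℤ, δ ≤ |H a' - n|) :
    curveWalk S M z P (f a') = walkStep (curveWalk S M z P (f a)) (H a') := by
  set S₀ := curveWalk S M z P (f a) with hS₀
  have hb₀ : |P (f a) - S₀.1| < 1 := abs_sub_walkStep_lt _ _
  have hda := abs_lt.1 (hd a ⟨le_rfl, haa⟩)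
  -- the position is adjacent to `H a` as well
  have hlow : (S₀.1 : ℝ) - 1 + δ ≤ H a := by
    have h1 := ha (S₀.1 - 1)
    push_cast at h1
    rw [abs_lt] at hb₀
    rcases le_abs.1 h1 with h2 | h2 <;> linarith
  -- the walk has made `d` steps up, and the last one, if any, was due to a value of the curve
  have key : ∀ α, a ≤ α → α ≤ a' → ∃ d : ℕ,
      curveWalk S M z P (f α) = (S₀.1 + d, S₀.2 ++ List.replicate d true) ∧
      (d = 0 ∨ ∃ β, a ≤ β ∧ β ≤ α ∧ (S₀.1 : ℝ) + d ≤ P (f β)) := by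
    refine curve_induction hf M _ ⟨0, by simp [← hS₀], Or.inl rfl⟩ ?_
    rintro α₁ α₂ h1 h12 h2 h3 ⟨d, e, hd'⟩
    have hstep := curveWalk_step h hS (hm h12) h3
    have h02 := h1.trans h12
    have hd2 := abs_lt.1 (hd α₂ ⟨h02, h2⟩)
    rw [e] at hstep
    -- the walk does not move down
    have hno : (S₀.1 : ℝ) + d - 1 < P (f α₂) := by
      rcases hd' with rfl | ⟨β, hβ1, hβ2, hβ3⟩
      · have := hH ⟨le_rfl, haa⟩ ⟨h02, h2⟩ h02
        push_cast; linarith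
      · have h4 := hH ⟨hβ1, (hβ2.trans h12).trans h2⟩ ⟨h02, h2⟩ (hβ2.trans h12)
        have h5 := abs_lt.1 (hd β ⟨hβ1, (hβ2.trans h12).trans h2⟩)
        linarith
    by_cases hup : (S₀.1 : ℝ) + d + 1 ≤ P (f α₂)
    · have hfl : S₀.1 + d + 1 ≤ ⌊P (f α₂)⌋ := by rw [Int.le_floor]; push_cast; exact hup
      obtain ⟨e', he'⟩ := Int.le.dest (show S₀.1 + d ≤ ⌊P (f α₂)⌋ by omega)
      refine ⟨d + e', ?_, Or.inr ⟨α₂, h02, le_rfl, ?_⟩⟩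
      · rw [hstep, walkStep, if_pos (by push_cast; exact hup), List.append_assoc,
          List.replicate_append_replicate]
        simp only
        congr 4
        · push_cast; omega
        · omega
      · have := Int.floor_le (P (f α₂))
        rw [← he'] at this
        push_cast at this ⊢
        linarith
    · refine ⟨d, ?_, ?_⟩
      · rw [hstep, walkStep_of_abs_lt]
        rw [abs_lt]; push_cast; constructor <;> linarith
      · rcases hd' with rfl | ⟨β, hβ1, hβ2, hβ3⟩
        · exact Or.inl rfl
        · exact Or.inr ⟨β, hβ1, hβ2.trans h12, hβ3⟩
  obtain ⟨d, e, hd'⟩ := key a' haa le_rfl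
  have hb₁ : |P (f a') - (curveWalk S M z P (f a')).1| < 1 := abs_sub_walkStep_lt _ _
  rw [e] at hb₁ ⊢
  push_cast at hb₁
  rw [abs_lt] at hb₁
  have hda' := abs_lt.1 (hd a' ⟨haa, le_rfl⟩)
  have hup : H a' ≤ (S₀.1 : ℝ) + d + 1 - δ := by
    have h1 := ha' (S₀.1 + d + 1)
    push_cast at h1
    rcases le_abs.1 h1 with h2 | h2 <;> linarith
  have hdn : (S₀.1 : ℝ) + d - 1 + δ ≤ H a' := by
    have h1 := ha' (S₀.1 + d - 1)
    push_cast at h1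
    rcases le_abs.1 h1 with h2 | h2 <;> linarith
  have hδ0 : 0 < δ := (abs_nonneg _).trans_lt (hd a' ⟨haa, le_rfl⟩)
  rcases hd' with rfl | ⟨β, hβ1, hβ2, hβ3⟩
  · rw [walkStep_of_abs_lt]
    · simp
    · rw [abs_lt]; push_cast at hup hdn; constructor <;> linarith
  · rcases Nat.eq_zero_or_pos d with rfl | hpos
    · rw [walkStep_of_abs_lt]
      · simp
      · rw [abs_lt]; push_cast at hup hdn; constructor <;> linarith
    have h4 := hH ⟨hβ1, hβ2⟩ ⟨haa, le_rfl⟩ hβ2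
    have h5 := abs_lt.1 (hd β ⟨hβ1, hβ2⟩)
    have h6 : (S₀.1 : ℝ) + d ≤ H a' := by
      have h1 := ha' (S₀.1 + d)
      push_cast at h1
      rcases le_abs.1 h1 with h2 | h2 <;> linarith
    have hfl : ⌊H a'⌋ = S₀.1 + d := by
      rw [Int.floor_eq_iff]; push_cast; constructor <;> linarith
    have hd1 : (1 : ℝ) ≤ d := by exact_mod_cast hpos
    rw [walkStep, if_pos (by linarith), hfl]
    congr 3
    omega

theorem curveWalk_edge (h : IsInterpolation M z P) (hS : |z 0 - S.1| < 1)
    {f : unitInterval → unitInterval} (hf : Continuous f) (hm : Monotone f)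
    {a a' : unitInterval} (haa : a ≤ a') {H : unitInterval → ℝ}
    (hH : MonotoneOn H (Set.Icc a a') ∨ AntitoneOn H (Set.Icc a a'))
    {δ : ℝ} (hδ : δ ≤ 1 / 2) (hd : ∀ α ∈ Set.Icc a a', |P (f α) - H α| < δ)
    (ha : ∀ n : ℤ, δ ≤ |H a - n|) (ha' : ∀ n : ℤ, δ ≤ |H a' - n|) :
    curveWalk S M z P (f a') = walkStep (curveWalk S M z P (f a)) (H a') := by
  rcases hH with hH | hH
  · exact curveWalk_edge_up h hS hf hm haa hH hδ hd ha ha'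
  · apply mirror_injective
    rw [← walkStep_mirror, ← curveWalk_mirror, ← curveWalk_mirror]
    refine curveWalk_edge_up h.neg ?_ hf hm haa (H := fun α => -H α) hH.neg hδ ?_ ?_ ?_
    · simp only [mirror, Int.cast_neg]
      rw [← abs_neg]; convert hS using 2; ring
    · intro α hα
      rw [← abs_neg]; convert hd α hα using 2; ring
    · intro n
      rw [← abs_neg]; convert ha (-n) using 2; push_cast; ring
    · intro n
      rw [← abs_neg]; convert ha' (-n) using 2; push_cast; ring

end

/-- If two interpolations stay close along a matching, and the vertices of the second keep clear of
the grid points, then their walks agree: an extremum of the second curve is not close enough to a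
grid point for the two curves to disagree on whether it is reached, and along an edge of the second
curve the walk of the first one only moves in the direction of the edge. -/
theorem walk_eq_of_matching {M K : ℕ} {z y : ℕ → ℝ} {P Q : unitInterval → ℝ}
    (hP : IsInterpolation M z P) (hQ : IsInterpolation K y Q)
    {f g : unitInterval → unitInterval} (hf : Continuous f) (hg : Continuous g)
    (hfm : Monotone f) (hgm : Monotone g) (hf0 : f 0 = 0) (hg0 : g 0 = 0) (hf1 : f 1 = 1)
    (hg1 : g 1 = 1) {δ : ℝ} (hδ : δ ≤ 1 / 2) (hd : ∀ a, |P (f a) - Q (g a)| < δ)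
    (hy : ∀ i, i ≤ K → ∀ n : ℤ, δ ≤ |y i - n|) :
    ⌊z 0⌋ = ⌊y 0⌋ ∧ (walk z M).2 = (walk y K).2 := by
  have hK : (0 : ℝ) ≤ K := Nat.cast_nonneg K
  have hP0 : P 0 = z 0 := hP.vertex (Nat.zero_le _) (by simp)
  have hQ0 : Q 0 = y 0 := hQ.vertex (Nat.zero_le _) (by simp)
  have hfl : ⌊z 0⌋ = ⌊y 0⌋ := by
    have h0 := hd 0
    rw [hf0, hg0, hP0, hQ0, abs_lt] at h0
    have h1 := hy 0 (Nat.zero_le _) ⌊y 0⌋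
    have h2 := hy 0 (Nat.zero_le _) (⌊y 0⌋ + 1)
    push_cast at h2
    have h3 := Int.floor_le (y 0)
    have h4 := Int.lt_floor_add_one (y 0)
    rw [abs_of_nonneg (by linarith)] at h1
    rw [abs_of_neg (by linarith)] at h2
    rw [Int.floor_eq_iff]
    constructor <;> linarith
  refine ⟨hfl, ?_⟩
  have hS : |z 0 - (((⌊z 0⌋, []) : ℤ × List Bool)).1| < 1 := abs_sub_floor_lt _
  -- an edge of `Q`, or a part of one
  have edge : ∀ (a a' : unitInterval) (j : ℕ), a ≤ a' → j ≤ K → (K : ℝ) * g a = j →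
      ((K : ℝ) * g a' = j ∨ j < K ∧ (K : ℝ) * g a' = (j + 1 : ℕ)) →
      curveWalk (⌊z 0⌋, []) M z P (f a') =
        walkStep (curveWalk (⌊z 0⌋, []) M z P (f a)) (Q (g a')) := by
    intro a a' j haa hj h1 h2
    refine curveWalk_edge hP hS hf hfm haa (H := fun α => Q (g α)) ?_ hδ (fun α _ => hd α) ?_ ?_
    · have hmono : ∀ α ∈ Set.Icc a a', (j : ℝ) ≤ K * g α ∧ (K : ℝ) * g α ≤ K * g a' := by
        intro α hα
        rw [← h1]
        exact ⟨mul_le_mul_of_nonneg_left (hgm hα.1) hK, mul_le_mul_of_nonneg_left (hgm hα.2) hK⟩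
      rcases h2 with h2 | ⟨hjK, h2⟩
      · left
        intro α hα β hβ _
        rw [h2] at hmono
        simp only
        rw [hQ.vertex hj (le_antisymm (hmono α hα).2 (hmono α hα).1),
          hQ.vertex hj (le_antisymm (hmono β hβ).2 (hmono β hβ).1)]
      · rw [h2] at hmono
        push_cast at hmono
        have hlin : ∀ α ∈ Set.Icc a a', Q (g α) = y j + (K * g α - j) * (y (j + 1) - y j) :=
          fun α hα => hQ.1 _ j hjK (hmono α hα).1 (hmono α hα).2
        have hgK : ∀ α β : unitInterval, α ≤ β → (K : ℝ) * g α ≤ K * g β := fun α β hαβ =>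
          mul_le_mul_of_nonneg_left (hgm hαβ) hK
        rcases le_total (y j) (y (j + 1)) with hle | hle
        · left
          intro α hα β hβ hαβ
          simp only
          rw [hlin α hα, hlin β hβ]
          nlinarith [hgK α β hαβ]
        · right
          intro α hα β hβ hαβ
          simp only
          rw [hlin α hα, hlin β hβ]
          nlinarith [hgK α β hαβ]
    · intro n
      rw [hQ.vertex hj h1]; exact hy j hj n
    · intro n
      rcases h2 with h2 | ⟨hjK, h2⟩
      · rw [hQ.vertex hj h2]; exact hy j hj n
      · rw [hQ.vertex hjK h2]; exact hy _ hjK n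
  -- the walks agree when the second curve is at its vertex of index `j`
  have main : ∀ j, j ≤ K → ∃ a, (K : ℝ) * g a = j ∧
      curveWalk (⌊z 0⌋, []) M z P (f a) = walk y j := by
    intro j
    induction j with
    | zero =>
      intro _
      refine ⟨0, by rw [hg0]; simp, ?_⟩
      rw [hf0, curveWalk_vertex hP hS (Nat.zero_le _) (by simp)]
      simp [walk, walkFrom, hfl]
    | succ j ih =>
      intro hj
      obtain ⟨a, ha, hw⟩ := ih (by omega)
      have hc : ContinuousOn (fun α => (K : ℝ) * (g α : ℝ)) (Set.Icc a 1) :=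
        Continuous.continuousOn (by fun_prop)
      have hjK : ((j + 1 : ℕ) : ℝ) ≤ K := by exact_mod_cast hj
      have hj1 : (j : ℝ) ≤ ((j + 1 : ℕ) : ℝ) := by push_cast; linarith
      obtain ⟨a', ha', he⟩ := intermediate_value_Icc (unitInterval.le_one' : a ≤ 1) hc
        (show ((j + 1 : ℕ) : ℝ) ∈ _ by
          simp only [hg1, Set.Icc.coe_one, mul_one, ha]
          exact ⟨hj1, hjK⟩)
      refine ⟨a', he, ?_⟩
      rw [edge a a' j ha'.1 (by omega) ha (Or.inr ⟨hj, he⟩), hw, hQ.vertex hj he]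
      rfl
  obtain ⟨a, ha, hw⟩ := main K le_rfl
  have hlast := edge a 1 K unitInterval.le_one' le_rfl ha (Or.inl (by rw [hg1]; simp))
  have hQ1 : Q (g 1) = y K := hQ.vertex le_rfl (by rw [hg1]; simp)
  rw [hf1, curveWalk_vertex hP hS le_rfl (by simp), hw, hQ1,
    walkStep_of_abs_lt (abs_sub_walk_lt y K)] at hlast
  exact congrArg Prod.snd hlast

/-- A small Fréchet distance gives equal codes as soon as the vertices of one of the two series
are clear of the grid points. The notion of a matching is symmetric, so it does not matter which. -/
theorem walkCode_eq_of_frechetDist_lt {m k : ℕ} {x : Fin m → ℝ} {y : Fin k → ℝ} {w δ : ℝ}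
    (hw : 0 < w) (hδ : δ ≤ 1 / 2) (s : ℝ)
    (h : frechetDist (timeSeries x) (timeSeries y) < δ * w)
    (hclear : (∀ i, i ≤ m - 1 → ∀ n : ℤ, δ ≤ |scaled x w s i - n|) ∨
      ∀ i, i ≤ k - 1 → ∀ n : ℤ, δ ≤ |scaled y w s i - n|) :
    walkCode (scaled x w s) (m - 1) = walkCode (scaled y w s) (k - 1) := by
  obtain ⟨φ, hφ⟩ := exists_matching_of_frechetDist_lt h
  have hd : ∀ a, |(timeSeries x (φ.f a) / w + s) - (timeSeries y (φ.g a) / w + s)| < δ := by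
    intro a
    rw [show (timeSeries x (φ.f a) / w + s) - (timeSeries y (φ.g a) / w + s) =
      (timeSeries x (φ.f a) - timeSeries y (φ.g a)) / w by ring, abs_div, abs_of_pos hw,
      div_lt_iff₀ hw]
    exact hφ a
  have hx := isInterpolation_timeSeries x w s
  have hy := isInterpolation_timeSeries y w s
  rw [walkCode_eq_iff]
  rcases hclear with hc | hc
  · have := walk_eq_of_matching hy hx φ.continuous_g φ.continuous_f φ.monotone_g φ.monotone_f
      φ.g_zero φ.f_zero φ.g_one φ.f_one hδ (fun a => by rw [abs_sub_comm]; exact hd a) hc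
    exact ⟨this.1.symm, this.2.symm⟩
  · exact walk_eq_of_matching hx hy φ.continuous_f φ.continuous_g φ.monotone_f φ.monotone_g
      φ.f_zero φ.g_zero φ.f_one φ.g_one hδ hd hc

/-! ### Shifts that keep the vertices clear of the grid points -/

theorem volume_near_le (a δ : ℝ) :
    volume {u : unitInterval | |(u : ℝ) - a| < δ} ≤ ENNReal.ofReal (2 * δ) := by
  rw [← volume_image_subtype_coe measurableSet_Icc]
  refine (measure_mono (t := Set.Ioo (a - δ) (a + δ)) ?_).trans ?_
  · rintro _ ⟨u, hu, rfl⟩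
    have := abs_lt.1 (show |(u : ℝ) - a| < δ from hu)
    constructor <;> linarith
  · rw [Real.volume_Ioo]
    apply le_of_eq; congr 1; ring

/-- A superset of the shifts that bring a point of `y 0, …, y (k - 1)` close to an integer. For a
single point there are at most two integers to consider, as the shifts fill a unit interval. -/
def badShifts (y : ℕ → ℝ) (k : ℕ) (δ : ℝ) : Set unitInterval :=
  ⋃ i ∈ Finset.range k, ({u : unitInterval | |(u : ℝ) - (⌊y i - δ⌋ + 1 - y i)| < δ} ∪
    {u : unitInterval | |(u : ℝ) - (⌊y i - δ⌋ + 2 - y i)| < δ})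

theorem measurableSet_badShifts (y : ℕ → ℝ) (k : ℕ) (δ : ℝ) :
    MeasurableSet (badShifts y k δ) := by
  refine Finset.measurableSet_biUnion _ fun i _ => MeasurableSet.union ?_ ?_ <;>
  · apply IsOpen.measurableSet
    apply isOpen_lt <;> fun_prop

theorem volume_badShifts_le (y : ℕ → ℝ) (k : ℕ) {δ : ℝ} (hδ : 0 ≤ δ) :
    volume (badShifts y k δ) ≤ ENNReal.ofReal (k * (4 * δ)) := by
  refine (measure_biUnion_finset_le _ _).trans ?_
  refine (Finset.sum_le_sum fun i _ => (measure_union_le _ _).trans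
    (add_le_add (volume_near_le _ _) (volume_near_le _ _))).trans ?_
  rw [Finset.sum_const, Finset.card_range, nsmul_eq_mul, ← ENNReal.ofReal_add (by positivity)
    (by positivity), ENNReal.ofReal_mul (by positivity), ENNReal.ofReal_natCast]
  apply le_of_eq; congr 2; ring

theorem clear_of_notMem_badShifts {y : ℕ → ℝ} {k : ℕ} {δ : ℝ} (hδ : δ ≤ 1 / 2)
    {u : unitInterval} (hu : u ∉ badShifts y k δ) {i : ℕ} (hi : i < k) (n : ℤ) :
    δ ≤ |y i + u - n| := by
  by_contra! hlt
  apply hu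
  refine Set.mem_biUnion (Finset.mem_coe.2 (Finset.mem_range.2 hi)) ?_
  have h1 := abs_lt.1 hlt
  have h2 := Int.floor_le (y i - δ)
  have h3 := Int.lt_floor_add_one (y i - δ)
  have h4 := u.2.1
  have h5 := u.2.2
  have h6 : ⌊y i - δ⌋ < n := by
    have : (⌊y i - δ⌋ : ℝ) < n := by linarith
    exact_mod_cast this
  have h7 : n < ⌊y i - δ⌋ + 3 := by
    have : (n : ℝ) < ⌊y i - δ⌋ + 3 := by linarith
    exact_mod_cast this
  have h8 : n = ⌊y i - δ⌋ + 1 ∨ n = ⌊y i - δ⌋ + 2 := by omega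
  rcases h8 with h8 | h8
  · left
    rw [Set.mem_ofPred_eq]
    refine lt_of_eq_of_lt ?_ hlt
    rw [h8]; push_cast; ring_nf
  · right
    rw [Set.mem_ofPred_eq]
    refine lt_of_eq_of_lt ?_ hlt
    rw [h8]; push_cast; ring_nf

/-- With probability at least `1 - 2⁻ᴿ` one of `R` random shifts is clear of all `k` points: each
point spoils two intervals of total length at most `4δ`, so by the choice `δ = 1 / (8 k)` a single
shift fails with probability at most `1 / 2`, and the shifts are independent. -/
theorem one_sub_le_randomStream {y : ℕ → ℝ} {k : ℕ} (hk : 1 ≤ k) (R : ℕ)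
    {S : Set (ℕ → unitInterval)}
    (hS : ∀ ω : ℕ → unitInterval, (∃ j < R, ∀ i < k, ∀ n : ℤ,
      1 / (8 * (k : ℝ)) ≤ |y i + ω j - n|) → ω ∈ S) :
    1 - (1 / 2 : ℝ) ^ R ≤ randomStream.real S := by
  have hk' : (1 : ℝ) ≤ k := by exact_mod_cast hk
  set δ : ℝ := 1 / (8 * (k : ℝ)) with hδ
  have hδ0 : 0 ≤ δ := by positivity
  have hδ1 : δ ≤ 1 / 2 := by
    rw [hδ]; apply one_div_le_one_div_of_le <;> linarith
  let A : Set (ℕ → unitInterval) :=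
    (Finset.range R : Set ℕ).pi fun _ => badShifts y k δ
  have : IsProbabilityMeasure randomStream := by
    unfold randomStream; infer_instance
  have hA : MeasurableSet A :=
    MeasurableSet.pi (Set.to_countable _) fun _ _ => measurableSet_badShifts y k δ
  have hAm : randomStream.real A ≤ (1 / 2 : ℝ) ^ R := by
    have h1 : randomStream A = ∏ i ∈ Finset.range R, volume (badShifts y k δ) :=
      Measure.infinitePi_pi _ fun _ _ => measurableSet_badShifts y k δ
    have h2 : volume (badShifts y k δ) ≤ ENNReal.ofReal (1 / 2) := by
      refine (volume_badShifts_le y k hδ0).trans (le_of_eq ?_)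
      congr 1
      rw [hδ]; field_simp; norm_num
    rw [Measure.real, h1, Finset.prod_const, Finset.card_range]
    refine ENNReal.toReal_le_of_le_ofReal (by positivity) ?_
    rw [ENNReal.ofReal_pow (by norm_num)]
    exact pow_le_pow_left' h2 R
  have hsub : Aᶜ ⊆ S := by
    intro ω hω
    apply hS
    simp only [A, Set.mem_compl_iff, Set.mem_pi, not_forall] at hω
    obtain ⟨j, hj, hωj⟩ := hω
    exact ⟨j, Finset.mem_range.1 (Finset.mem_coe.1 hj), fun i hi n =>
      clear_of_notMem_badShifts hδ1 hωj hi n⟩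
  calc 1 - (1 / 2 : ℝ) ^ R ≤ 1 - randomStream.real A := by linarith
    _ = randomStream.real Aᶜ := (probReal_compl_eq_one_sub hA).symm
    _ ≤ randomStream.real S := measureReal_mono hsub

/-- Among `R` equally spaced shifts, one is clear of fewer than `R` points: each point spoils at
most one shift. -/
theorem exists_clear_shift (y : ℕ → ℝ) {v R : ℕ} (hv : v < R) {δ : ℝ} (hδ : 2 * δ * R ≤ 1) :
    ∃ j < R, ∀ i < v, ∀ n : ℤ, δ ≤ |y i + (j : ℝ) / R - n| := by
  by_contra! hcon
  choose! b hb hbad using hcon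
  choose! N hN using hbad
  have hR : (0 : ℝ) < R := by exact_mod_cast (Nat.zero_le v).trans_lt hv
  obtain ⟨j, hj, j', hj', hne, he⟩ := Finset.exists_ne_map_eq_of_card_lt_of_maps_to
    (s := Finset.range R) (t := Finset.range v) (by simpa using hv) (f := b)
    (fun j hj => by simpa using hb j (by simpa using hj))
  rw [Finset.mem_range] at hj hj'
  have h1 := abs_lt.1 (hN j hj)
  have h2 := abs_lt.1 (hN j' hj')
  rw [← he] at h2
  generalize N j = A at *
  generalize N j' = A' at *
  -- the integer `j - j' - (A - A') R` would have absolute value less than `1`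
  have h3 : |((j : ℝ) - j') - (A - A') * R| < 1 := by
    have e1 : ((j : ℝ) - j') - (A - A') * R =
        ((y (b j) + (j : ℝ) / R - A) - (y (b j) + (j' : ℝ) / R - A')) * R := by
      field_simp; ring
    rw [e1, abs_mul, abs_of_pos hR]
    refine lt_of_lt_of_le (mul_lt_mul_of_pos_right ?_ hR) hδ
    rw [abs_lt]; constructor <;> linarith
  have h4 : ((j : ℤ) - j') - (A - A') * R = 0 := by
    rw [← Int.abs_lt_one_iff]; exact_mod_cast h3
  apply hne
  have h5 : (R : ℤ) ∣ (j : ℤ) - j' := ⟨A - A', by linarith⟩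
  have h6 := Int.eq_zero_of_abs_lt_dvd h5 (by rw [abs_lt]; constructor <;> omega)
  omega

/-! ### A program logic for the real RAM -/

namespace RealRAM

instance : Add RExpr := ⟨RExpr.add⟩
instance : Sub RExpr := ⟨RExpr.sub⟩
instance : Mul RExpr := ⟨RExpr.mul⟩
instance : Div RExpr := ⟨RExpr.div⟩
instance (n : ℕ) : OfNat RExpr n := ⟨RExpr.lit n⟩

namespace RExpr

variable (s : State) (a b : RExpr)

@[simp] theorem eval_add : (a + b).eval s = a.eval s + b.eval s := rfl
@[simp] theorem eval_sub : (a - b).eval s = a.eval s - b.eval s := rfl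
@[simp] theorem eval_mul : (a * b).eval s = a.eval s * b.eval s := rfl
@[simp] theorem eval_div : (a / b).eval s = a.eval s / b.eval s := rfl
@[simp] theorem eval_ofNat (n : ℕ) [n.AtLeastTwo] :
    (ofNat(n) : RExpr).eval s = (ofNat(n) : ℝ) := by
  change (((n : ℕ) : ℤ) : ℝ) = _
  rw [Int.cast_natCast]; rfl
@[simp] theorem eval_zero : (0 : RExpr).eval s = 0 := by
  change (((0 : ℕ) : ℤ) : ℝ) = _
  simp
@[simp] theorem eval_one : (1 : RExpr).eval s = 1 := by
  change (((1 : ℕ) : ℤ) : ℝ) = _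
  simp
@[simp] theorem eval_lit (z : ℤ) : (lit z).eval s = z := rfl
@[simp] theorem eval_reg (i : ℕ) : (reg i).eval s = s.reg i := rfl
@[simp] theorem eval_floor : (floor a).eval s = ⌊a.eval s⌋ := rfl
@[simp] theorem eval_mem : (mem a).eval s = s.mem ⌊a.eval s⌋₊ := rfl
@[simp] theorem eval_inp : (inp a).eval s = s.inp ⌊a.eval s⌋₊ := rfl

@[simp] theorem cost_add : (a + b).cost = a.cost + b.cost + 1 := rfl
@[simp] theorem cost_sub : (a - b).cost = a.cost + b.cost + 1 := rfl
@[simp] theorem cost_mul : (a * b).cost = a.cost + b.cost + 1 := rfl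
@[simp] theorem cost_div : (a / b).cost = a.cost + b.cost + 1 := rfl
@[simp] theorem cost_ofNat (n : ℕ) [n.AtLeastTwo] : (ofNat(n) : RExpr).cost = 1 := rfl
@[simp] theorem cost_zero : (0 : RExpr).cost = 1 := rfl
@[simp] theorem cost_one : (1 : RExpr).cost = 1 := rfl
@[simp] theorem cost_lit (z : ℤ) : (lit z).cost = 1 := rfl
@[simp] theorem cost_reg (i : ℕ) : (reg i).cost = 1 := rfl
@[simp] theorem cost_floor : (floor a).cost = a.cost + 1 := rfl
@[simp] theorem cost_mem : (mem a).cost = a.cost + 1 := rfl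
@[simp] theorem cost_inp : (inp a).cost = a.cost + 1 := rfl

end RExpr

/-- The condition `a < b`. -/
def RCond.lt (a b : RExpr) : RCond := .not (.le b a)

@[simp] theorem RCond.holds_le (s : State) (a b : RExpr) :
    (RCond.le a b).Holds s ↔ a.eval s ≤ b.eval s := Iff.rfl
@[simp] theorem RCond.holds_lt (s : State) (a b : RExpr) :
    (RCond.lt a b).Holds s ↔ a.eval s < b.eval s := by simp [RCond.lt, RCond.Holds]
@[simp] theorem RCond.holds_not (s : State) (b : RCond) :
    (RCond.not b).Holds s ↔ ¬ b.Holds s := Iff.rfl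
@[simp] theorem RCond.holds_and (s : State) (b c : RCond) :
    (RCond.and b c).Holds s ↔ b.Holds s ∧ c.Holds s := Iff.rfl
@[simp] theorem RCond.cost_le (a b : RExpr) : (RCond.le a b).cost = a.cost + b.cost + 1 := rfl
@[simp] theorem RCond.cost_lt (a b : RExpr) : (RCond.lt a b).cost = b.cost + a.cost + 2 := rfl
@[simp] theorem RCond.cost_not (b : RCond) : (RCond.not b).cost = b.cost + 1 := rfl
@[simp] theorem RCond.cost_and (b c : RCond) : (RCond.and b c).cost = b.cost + c.cost + 1 := rfl

/-- Sequential composition of a list of programs. -/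
def block : List Prog → Prog
  | [] => .skip
  | p :: ps => .seq p (block ps)

/-- Total correctness with a clock: started in `s` at time `τ`, the program `p` halts, and the
final state and time satisfy `Q`. -/
def WP (p : Prog) (Q : State → ℕ → Prop) (s : State) (τ : ℕ) : Prop :=
  ∃ t s', Exec p s t s' ∧ Q s' (τ + t)

section

variable {p q : Prog} {Q Q' : State → ℕ → Prop} {s : State} {τ : ℕ}

theorem WP.mono (h : WP p Q s τ) (hQ : ∀ s τ, Q s τ → Q' s τ) : WP p Q' s τ := by
  obtain ⟨t, s', he, hq⟩ := h
  exact ⟨t, s', he, hQ _ _ hq⟩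

@[simp] theorem wp_skip : WP .skip Q s τ ↔ Q s (τ + 1) := by
  constructor
  · rintro ⟨_, _, h, hq⟩; cases h; exact hq
  · intro h; exact ⟨_, _, .skip s, h⟩

@[simp] theorem wp_assign {i : ℕ} {a : RExpr} :
    WP (.assign i a) Q s τ ↔ Q (s.setReg i (a.eval s)) (τ + (a.cost + 1)) := by
  constructor
  · rintro ⟨_, _, h, hq⟩; cases h; exact hq
  · intro h; exact ⟨_, _, .assign i a s, h⟩

@[simp] theorem wp_store {a b : RExpr} :
    WP (.store a b) Q s τ ↔ Q (s.setMem ⌊a.eval s⌋₊ (b.eval s)) (τ + (a.cost + b.cost + 1)) := by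
  constructor
  · rintro ⟨_, _, h, hq⟩; cases h; exact hq
  · intro h; exact ⟨_, _, .store a b s, h⟩

@[simp] theorem wp_rand {i : ℕ} : WP (.rand i) Q s τ ↔ Q (s.draw i) (τ + 1) := by
  constructor
  · rintro ⟨_, _, h, hq⟩; cases h; exact hq
  · intro h; exact ⟨_, _, .rand i s, h⟩

@[simp] theorem wp_seq : WP (.seq p q) Q s τ ↔ WP p (WP q Q) s τ := by
  constructor
  · rintro ⟨_, _, h, hq⟩
    cases h with
    | seq h₁ h₂ => exact ⟨_, _, h₁, _, _, h₂, by rwa [add_assoc]⟩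
  · rintro ⟨t₁, s₁, h₁, t₂, s₂, h₂, hq⟩
    exact ⟨_, _, .seq h₁ h₂, by rwa [← add_assoc]⟩

@[simp] theorem wp_block_nil : WP (block []) Q s τ ↔ Q s (τ + 1) := wp_skip

@[simp] theorem wp_block_cons {ps : List Prog} :
    WP (block (p :: ps)) Q s τ ↔ WP p (WP (block ps) Q) s τ := wp_seq

@[simp] theorem wp_ite {b : RCond} : WP (.ite b p q) Q s τ ↔
    (b.Holds s → WP p Q s (τ + (b.cost + 1))) ∧ (¬ b.Holds s → WP q Q s (τ + (b.cost + 1))) := by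
  constructor
  · rintro ⟨_, _, h, hq⟩
    cases h with
    | ite_true hb h =>
      exact ⟨fun _ => ⟨_, _, h, by rwa [add_assoc]⟩, fun hb' => absurd hb hb'⟩
    | ite_false hb h =>
      exact ⟨fun hb' => absurd hb' hb, fun _ => ⟨_, _, h, by rwa [add_assoc]⟩⟩
  · rintro ⟨h1, h2⟩
    by_cases hb : b.Holds s
    · obtain ⟨t, s', h, hq⟩ := h1 hb
      exact ⟨_, _, .ite_true hb h, by rwa [← add_assoc]⟩
    · obtain ⟨t, s', h, hq⟩ := h2 hb
      exact ⟨_, _, .ite_false hb h, by rwa [← add_assoc]⟩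

end

/-- The registers that a program may write. -/
def Prog.writes : Prog → List ℕ
  | .skip => []
  | .assign i _ => [i]
  | .store _ _ => []
  | .rand i => [i]
  | .seq p q => p.writes ++ q.writes
  | .ite _ p q => p.writes ++ q.writes
  | .loop _ p => p.writes

/-- Whether a program has an instruction that writes to memory. -/
def Prog.stores : Prog → Bool
  | .store _ _ => true
  | .seq p q => p.stores || q.stores
  | .ite _ p q => p.stores || q.stores
  | .loop _ p => p.stores
  | _ => false

/-- Whether a program has an instruction that draws a random number. -/
def Prog.draws : Prog → Bool
  | .rand _ => true
  | .seq p q => p.draws || q.draws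
  | .ite _ p q => p.draws || q.draws
  | .loop _ p => p.draws
  | _ => false

/-- What a run of `p` from `s` to `s'` leaves unchanged, by the syntax of `p`. -/
structure Frame (p : Prog) (s s' : State) : Prop where
  reg : ∀ i, i ∉ p.writes → s'.reg i = s.reg i
  inp : s'.inp = s.inp
  mem : p.stores = false → s'.mem = s.mem
  used : p.stores = false → s'.used = s.used
  rnd : p.draws = false → s'.rnd = s.rnd

theorem Frame.refl (p : Prog) (s : State) : Frame p s s :=
  ⟨fun _ _ => rfl, rfl, fun _ => rfl, fun _ => rfl, fun _ => rfl⟩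

theorem Frame.trans {p : Prog} {s s' s'' : State} (h : Frame p s s') (h' : Frame p s' s'') :
    Frame p s s'' :=
  ⟨fun i hi => (h'.reg i hi).trans (h.reg i hi), h'.inp.trans h.inp,
    fun hp => (h'.mem hp).trans (h.mem hp), fun hp => (h'.used hp).trans (h.used hp),
    fun hp => (h'.rnd hp).trans (h.rnd hp)⟩

theorem Exec.frame {p : Prog} {s s' : State} {t : ℕ} (h : Exec p s t s') : Frame p s s' := by
  induction h with
  | skip s => exact Frame.refl _ _
  | assign i a s =>
    refine ⟨fun j hj => ?_, rfl, fun _ => rfl, fun _ => rfl, fun _ => rfl⟩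
    simp only [Prog.writes, List.mem_singleton] at hj
    simp [State.setReg, hj]
  | store a b s =>
    exact ⟨fun j hj => rfl, rfl, by simp [Prog.stores], by simp [Prog.stores], fun _ => rfl⟩
  | rand i s =>
    refine ⟨fun j hj => ?_, rfl, fun _ => rfl, fun _ => rfl, by simp [Prog.draws]⟩
    simp only [Prog.writes, List.mem_singleton] at hj
    simp [State.draw, hj]
  | seq _ _ ih₁ ih₂ =>
    refine ⟨fun j hj => ?_, ih₂.inp.trans ih₁.inp, fun hp => ?_, fun hp => ?_, fun hp => ?_⟩
    · simp only [Prog.writes, List.mem_append, not_or] at hj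
      exact (ih₂.reg j hj.2).trans (ih₁.reg j hj.1)
    · simp only [Prog.stores, Bool.or_eq_false_iff] at hp
      exact (ih₂.mem hp.2).trans (ih₁.mem hp.1)
    · simp only [Prog.stores, Bool.or_eq_false_iff] at hp
      exact (ih₂.used hp.2).trans (ih₁.used hp.1)
    · simp only [Prog.draws, Bool.or_eq_false_iff] at hp
      exact (ih₂.rnd hp.2).trans (ih₁.rnd hp.1)
  | ite_true _ _ ih =>
    refine ⟨fun j hj => ?_, ih.inp, fun hp => ?_, fun hp => ?_, fun hp => ?_⟩
    · simp only [Prog.writes, List.mem_append, not_or] at hj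
      exact ih.reg j hj.1
    all_goals simp only [Prog.stores, Prog.draws, Bool.or_eq_false_iff] at hp
    exacts [ih.mem hp.1, ih.used hp.1, ih.rnd hp.1]
  | ite_false _ _ ih =>
    refine ⟨fun j hj => ?_, ih.inp, fun hp => ?_, fun hp => ?_, fun hp => ?_⟩
    · simp only [Prog.writes, List.mem_append, not_or] at hj
      exact ih.reg j hj.2
    all_goals simp only [Prog.stores, Prog.draws, Bool.or_eq_false_iff] at hp
    exacts [ih.mem hp.2, ih.used hp.2, ih.rnd hp.2]
  | loop_true _ _ _ ih₁ ih₂ =>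
    exact ⟨fun j hj => (ih₂.reg j hj).trans (ih₁.reg j hj), ih₂.inp.trans ih₁.inp,
      fun hp => (ih₂.mem hp).trans (ih₁.mem hp), fun hp => (ih₂.used hp).trans (ih₁.used hp),
      fun hp => (ih₂.rnd hp).trans (ih₁.rnd hp)⟩
  | loop_false _ => exact Frame.refl _ _

/-- Adds to a postcondition what the syntax of the program says about unchanged parts of the
state. -/
theorem WP.frame {p : Prog} {Q : State → ℕ → Prop} {s : State} {τ : ℕ} (h : WP p Q s τ) :
    WP p (fun s' τ' => Q s' τ' ∧ Frame p s s') s τ := by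
  obtain ⟨t, s', he, hq⟩ := h
  exact ⟨t, s', he, hq, he.frame⟩

/-- The rule for a loop that is run through exactly `N` times, with invariant `I i` before the
round of index `i`. -/
theorem WP.loop {b : RCond} {p : Prog} {Q : State → ℕ → Prop} {s₀ : State} {τ₀ : ℕ}
    (N : ℕ) (I : ℕ → State → ℕ → Prop) (h0 : I 0 s₀ τ₀)
    (hstep : ∀ i, i < N → ∀ s τ, Frame p s₀ s → I i s τ →
      b.Holds s ∧ WP p (I (i + 1)) s (τ + (b.cost + 1)))
    (hend : ∀ s τ, Frame p s₀ s → I N s τ → ¬ b.Holds s ∧ Q s (τ + (b.cost + 1))) :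
    WP (.loop b p) Q s₀ τ₀ := by
  suffices H : ∀ d i, i + d = N → ∀ s τ, Frame p s₀ s → I i s τ → WP (.loop b p) Q s τ from
    H N 0 (Nat.zero_add N) s₀ τ₀ (Frame.refl _ _) h0
  intro d
  induction d with
  | zero =>
    rintro i rfl s τ hf hi
    obtain ⟨hb, hq⟩ := hend s τ hf hi
    exact ⟨_, _, .loop_false hb, hq⟩
  | succ d ih =>
    intro i hi s τ hf hI
    obtain ⟨hb, t₁, s₁, h₁, hI₁⟩ := hstep i (by omega) s τ hf hI
    obtain ⟨t₂, s₂, h₂, hq⟩ := ih (i + 1) (by omega) s₁ _ (hf.trans h₁.frame) hI₁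
    exact ⟨_, _, .loop_true hb h₁ h₂, by rwa [← add_assoc, ← add_assoc]⟩

namespace State

variable (s : State) (i j : ℕ) (v : ℝ)

@[simp] theorem reg_setReg : (s.setReg i v).reg j = if j = i then v else s.reg j := by
  simp [setReg, Function.update_apply]
@[simp] theorem mem_setReg : (s.setReg i v).mem = s.mem := rfl
@[simp] theorem inp_setReg : (s.setReg i v).inp = s.inp := rfl
@[simp] theorem used_setReg : (s.setReg i v).used = s.used := rfl
@[simp] theorem rnd_setReg : (s.setReg i v).rnd = s.rnd := rfl
@[simp] theorem reg_setMem : (s.setMem i v).reg = s.reg := rfl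
@[simp] theorem mem_setMem : (s.setMem i v).mem = Function.update s.mem i v := rfl
@[simp] theorem inp_setMem : (s.setMem i v).inp = s.inp := rfl
@[simp] theorem used_setMem : (s.setMem i v).used = max s.used (i + 1) := rfl
@[simp] theorem rnd_setMem : (s.setMem i v).rnd = s.rnd := rfl
@[simp] theorem reg_draw : (s.draw i).reg j = if j = i then (s.rnd 0 : ℝ) else s.reg j := by
  simp [draw, Function.update_apply]
@[simp] theorem mem_draw : (s.draw i).mem = s.mem := rfl
@[simp] theorem inp_draw : (s.draw i).inp = s.inp := rfl
@[simp] theorem used_draw : (s.draw i).used = s.used := rfl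
@[simp] theorem rnd_draw : (s.draw i).rnd = fun j => s.rnd (j + 1) := rfl

end State

end RealRAM

/-! ### The program for the code of a walk -/

/-!
The subprograms share one set of registers: `1`, `2` are the address and the length of the sequence
to be coded, `3` and `4` the width and the shift of the grid, `5` to `10` are auxiliary, and `11` is
the code. The lookup uses `12` to `15` and `20`, and the sorting program `20` to `29`. The parameters
`m`, `k`, `n` are in `16`, `17`, `23`, the number of shifts in `30`, a power of two in `31`; `32`
and `33` hold the index of the current shift and the address of its dictionary, `34` the index
of the current curve, and `0` the answer. The registers `18` and `19` only serve to choose the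
number of shifts.
-/

namespace RealRAM
open RExpr

/-- Computes into register `11` the code of the walk of the sequence that is stored in the input
from address `reg 1` on, has length `reg 2`, and is scaled by `1 / reg 3` and shifted by `reg 4`.
The registers `6`, `7` and `8` hold the position of the walk and the node of the Calkin-Wilf
tree. -/
def codeProg : Prog := block
  [.assign 5 (inp (reg 1) / reg 3 + reg 4),
   .assign 10 (floor (reg 5)),
   .assign 6 (reg 10),
   .assign 7 1,
   .assign 8 1,
   .assign 9 1,
   .loop (.lt (reg 9) (reg 2)) (block
    [.assign 5 (inp (reg 1 + reg 9) / reg 3 + reg 4),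
     .ite (.le (reg 6 + 1) (reg 5))
      (block
        [.assign 8 (reg 8 + (floor (reg 5) - reg 6) * reg 7),
         .assign 6 (floor (reg 5))])
      (.ite (.le (reg 5) (reg 6 - 1))
        (block
          [.assign 5 (0 - floor (0 - reg 5)),
           .assign 7 (reg 7 + (reg 6 - reg 5) * reg 8),
           .assign 6 (reg 5)])
        .skip),
     .assign 9 (reg 9 + 1)]),
   .assign 5 (reg 10 * (2 * reg 10 + 1)),
   .assign 6 ((reg 7 + reg 8) * (reg 7 + reg 8) + reg 7),
   .assign 11 ((reg 5 + reg 6) * (reg 5 + reg 6) + reg 5)]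

theorem treeNode_walkStep (S : ℤ × List Bool) (z : ℝ) :
    treeNode (walkStep S z).2 =
      if (S.1 : ℝ) + 1 ≤ z then
        ((treeNode S.2).1, (treeNode S.2).2 + (⌊z⌋ - S.1).toNat * (treeNode S.2).1)
      else if z ≤ (S.1 : ℝ) - 1 then
        ((treeNode S.2).1 + (S.1 - ⌈z⌉).toNat * (treeNode S.2).2, (treeNode S.2).2)
      else treeNode S.2 := by
  unfold walkStep
  split_ifs <;> simp only [treeNode_append_replicate_true, treeNode_append_replicate_false]

theorem cast_toNat {x y : ℤ} (h : y ≤ x) : (((x - y).toNat : ℕ) : ℝ) = (x : ℝ) - y := by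
  have : (((x - y).toNat : ℤ)) = x - y := Int.toNat_of_nonneg (by omega)
  have h2 := congrArg (fun t : ℤ => (t : ℝ)) this
  push_cast at h2
  exact h2

theorem walkCode_cast (z : ℕ → ℝ) (i : ℕ) :
    (walkCode z i : ℝ) =
      ((⌊z 0⌋ : ℝ) * (2 * ⌊z 0⌋ + 1) +
        ((((treeNode (walk z i).2).1 : ℝ) + (treeNode (walk z i).2).2) *
          ((treeNode (walk z i).2).1 + (treeNode (walk z i).2).2) + (treeNode (walk z i).2).1)) *
      ((⌊z 0⌋ : ℝ) * (2 * ⌊z 0⌋ + 1) +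
        ((((treeNode (walk z i).2).1 : ℝ) + (treeNode (walk z i).2).2) *
          ((treeNode (walk z i).2).1 + (treeNode (walk z i).2).2) + (treeNode (walk z i).2).1)) +
      (⌊z 0⌋ : ℝ) * (2 * ⌊z 0⌋ + 1) := by
  have h := congrArg (fun t : ℤ => (t : ℝ)) (intCode_cast ⌊z 0⌋)
  push_cast at h
  rw [walkCode, pairCode, pairCode]
  push_cast
  rw [h]
  ring

theorem wp_codeProg {s : State} {τ : ℕ} {a len : ℕ} {w : ℝ} {z : ℕ → ℝ} (hlen : 1 ≤ len)
    (h1 : s.reg 1 = a) (h2 : s.reg 2 = len) (h3 : s.reg 3 = w)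
    (hz : ∀ j < len, s.inp (a + j) / w + s.reg 4 = z j) :
    WP codeProg (fun s' τ' => s'.reg 11 = walkCode z (len - 1) ∧ τ' ≤ τ + 100 * len) s τ := by
  have hz0 := hz 0 hlen
  rw [add_zero] at hz0
  simp only [codeProg, wp_block_cons, wp_assign]
  simp [State.reg_setReg, h1, h3, hz0, -Int.floor_natCast]
  refine WP.loop (len - 1) (fun i s' τ' => s'.reg 9 = i + 1 ∧ s'.reg 6 = (walk z i).1 ∧
    s'.reg 7 = (treeNode (walk z i).2).1 ∧ s'.reg 8 = (treeNode (walk z i).2).2 ∧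
    τ' ≤ τ + 30 + 60 * i) ?_ ?_ ?_
  · simp [State.reg_setReg, walk, walkFrom, treeNode]
  · rintro i hi s' τ' hf ⟨e9, e6, e7, e8, hτ⟩
    have e1 := hf.reg 1 (by decide)
    have e2 := hf.reg 2 (by decide)
    have e3 := hf.reg 3 (by decide)
    have e4 := hf.reg 4 (by decide)
    have hin := hf.inp
    simp [State.reg_setReg, h1, h2, h3] at e1 e2 e3 e4 hin
    have hzi := hz (i + 1) (by omega)
    have hfl : ⌊(a : ℝ) + (i + 1)⌋₊ = a + (i + 1) := by
      rw [← Nat.cast_add_one, ← Nat.cast_add, Nat.floor_natCast]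
    have hlt : (i : ℝ) + 1 < len := by
      have : i + 1 < len := by omega
      exact_mod_cast this
    have hw : walk z (i + 1) = walkStep (walk z i) (z (i + 1)) := rfl
    have ht := treeNode_walkStep (walk z i) (z (i + 1))
    rw [← hw] at ht
    refine ⟨by simpa [e9, e2] using hlt, ?_⟩
    simp [State.reg_setReg, e1, e3, e4, e9, e6, e7, e8, hin, hfl, hzi, -not_le]
    refine ⟨fun hup => ?_, fun hup => ⟨fun hdn => ?_, fun hdn => ?_⟩⟩
    · have hc := cast_toNat (x := ⌊z (i + 1)⌋) (y := (walk z i).1)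
        (by rw [Int.le_floor]; linarith)
      rw [if_pos hup] at ht
      have hw1 : (walk z (i + 1)).1 = ⌊z (i + 1)⌋ := by rw [hw, walkStep, if_pos hup]
      rw [ht, hw1]
      push_cast
      rw [hc]
      exact ⟨rfl, rfl, rfl, by omega⟩
    · have hc := cast_toNat (x := (walk z i).1) (y := ⌈z (i + 1)⌉)
        (by rw [Int.ceil_le]; linarith)
      rw [if_neg hup, if_pos hdn] at ht
      have hw1 : (walk z (i + 1)).1 = ⌈z (i + 1)⌉ := by
        rw [hw, walkStep, if_neg hup, if_pos hdn]
      have hn : (⌊-z (i + 1)⌋ : ℝ) = -⌈z (i + 1)⌉ := by rw [Int.floor_neg]; push_cast; rfl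
      rw [ht, hw1, hn]
      push_cast
      rw [hc]
      exact ⟨neg_neg _, by ring, rfl, by omega⟩
    · rw [if_neg hup, if_neg hdn] at ht
      have hw1 : (walk z (i + 1)).1 = (walk z i).1 := by rw [hw, walkStep, if_neg hup, if_neg hdn]
      rw [ht, hw1]
      exact ⟨rfl, rfl, rfl, by omega⟩
  · rintro s' τ' hf ⟨e9, e6, e7, e8, hτ⟩
    have e10 := hf.reg 10 (by decide)
    have e2 := hf.reg 2 (by decide)
    simp [State.reg_setReg, h2] at e10 e2
    have hl : ((len - 1 : ℕ) : ℝ) + 1 = len := by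
      rw [Nat.cast_sub hlen]; push_cast; ring
    simp [State.reg_setReg, e9, e2, e10, e7, e8, hl]
    refine ⟨by rw [walkCode_cast], ?_⟩
    omega

end RealRAM

/-! ### Merging -/

/-- The array `A 0, …, A (n - 1)` is sorted within each of its blocks of length `h`. -/
def BlockSorted (A : ℕ → ℝ) (h n : ℕ) : Prop :=
  ∀ a b, a ≤ b → b < n → a / h = b / h → A a ≤ A b

/-- The state of a merging pass from `A` to `B`. The first `t` entries of `B` are written; the
current block of length `2 * h` starts at `lo`, its halves `[lo, mid)` and `[mid, hi)` are used up
to `i` and `j`. -/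
structure MergeInv (A B : ℕ → ℝ) (h n t i mid j hi : ℕ) : Prop where
  sorted : BlockSorted B (2 * h) t
  range : ∀ v, (∃ a, a < t ∧ B a = v) ↔ ∃ a, (a < i ∨ mid ≤ a ∧ a < j) ∧ A a = v
  hi_le : hi ≤ n
  hi_eq : 2 * h ∣ hi ∨ hi = n
  mid_le : mid ≤ j
  count : t + mid = i + j
  le_mid : i ≤ mid
  le_hi : j ≤ hi
  current : ∃ lo, 2 * h ∣ lo ∧ lo ≤ i ∧ mid ≤ lo + h ∧ hi ≤ lo + 2 * h ∧
    (mid = lo + h ∨ mid = hi) ∧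
    ∀ a, lo ≤ a → a < t → ∀ b, (i ≤ b ∧ b < mid ∨ j ≤ b ∧ b < hi) → B a ≤ A b

namespace MergeInv

variable {A B : ℕ → ℝ} {h n t i mid j hi : ℕ}

theorem init : MergeInv A B h n 0 0 0 0 0 where
  sorted := fun a b _ hb => absurd hb (by omega)
  range := by simp
  hi_le := by omega
  hi_eq := Or.inl (dvd_zero _)
  mid_le := le_rfl
  count := rfl
  le_mid := le_rfl
  le_hi := le_rfl
  current := ⟨0, dvd_zero _, by omega, by omega, by omega, by omega,
    fun a _ ha => absurd ha (by omega)⟩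

theorem next_block (H : MergeInv A B h n t i mid j hi) (h1 : hi ≤ t) (h2 : t < n) :
    MergeInv A B h n t t (min (t + h) n) (min (t + h) n) (min (t + h + h) n) := by
  have := H.mid_le
  have := H.count
  have := H.le_mid
  have := H.le_hi
  have hj : j = t := by omega
  have hi' : i = mid := by omega
  have hd : 2 * h ∣ t := by
    rcases H.hi_eq with h3 | h3
    · rwa [show t = hi by omega]
    · omega
  have hsum : t + h + h = t + 2 * h := by ring
  refine ⟨H.sorted, fun v => ?_, by omega, ?_, le_rfl, by omega, by omega, by omega,
    t, hd, le_rfl, by omega, by omega, by omega, fun a h3 h4 => absurd h3 (by omega)⟩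
  · rw [H.range]
    refine exists_congr fun a => ?_
    have : (a < i ∨ mid ≤ a ∧ a < j) ↔ (a < t ∨ min (t + h) n ≤ a ∧ a < min (t + h) n) := by omega
    rw [this]
  · rcases le_total (t + h + h) n with h3 | h3
    · left; rw [min_eq_left h3, hsum]; exact (Nat.dvd_add_right hd).2 dvd_rfl
    · right; omega

/-- Writing an entry `A c` that is not larger than the remaining ones of the block. -/
theorem step_aux (H : MergeInv A B h n t i mid j hi) {i' j' c : ℕ} (h1 : t < hi)
    (hi' : i' ≤ mid) (hj' : j' ≤ hi)
    (hc : c = i ∧ i' = i + 1 ∧ j' = j ∨ c = j ∧ i' = i ∧ j' = j + 1)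
    (hmin : ∀ b, (i' ≤ b ∧ b < mid ∨ j' ≤ b ∧ b < hi) → A c ≤ A b) :
    MergeInv A (Function.update B t (A c)) h n (t + 1) i' mid j' hi := by
  obtain ⟨lo, hlo, h2, h3, h4, h5, h6⟩ := H.current
  have c1 := H.mid_le
  have c2 := H.count
  have c3 := H.le_mid
  have c4 := H.le_hi
  have hup : ∀ a, a < t → Function.update B t (A c) a = B a := fun a ha =>
    Function.update_of_ne (by omega) _ _
  have hcb : i ≤ c ∧ c < mid ∨ j ≤ c ∧ c < hi := by omega
  refine ⟨?_, fun v => ?_, H.hi_le, H.hi_eq, by omega, by omega, by omega, by omega,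
    lo, hlo, by omega, h3, h4, h5, ?_⟩
  · intro a b hab hb hdiv
    rcases Nat.lt_succ_iff_lt_or_eq.1 hb with hb | rfl
    · rw [hup a (by omega), hup b hb]
      exact H.sorted a b hab hb hdiv
    · rcases hab.lt_or_eq with hab | rfl
      · rw [hup a hab, Function.update_self]
        refine h6 a ?_ hab c hcb
        by_contra hlt
        have hh : 0 < 2 * h := by omega
        obtain ⟨q, rfl⟩ := hlo
        have e1 : a / (2 * h) < q := by
          rw [Nat.div_lt_iff_lt_mul hh]; rw [mul_comm]; omega
        have e2 : q ≤ b / (2 * h) := by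
          rw [Nat.le_div_iff_mul_le hh, mul_comm]; omega
        omega
      · exact le_rfl
  · constructor
    · rintro ⟨a, ha, rfl⟩
      rcases Nat.lt_succ_iff_lt_or_eq.1 ha with ha | rfl
      · rw [hup a ha]
        obtain ⟨a', h7, h8⟩ := (H.range (B a)).1 ⟨a, ha, rfl⟩
        exact ⟨a', by omega, h8⟩
      · exact ⟨c, by omega, by rw [Function.update_self]⟩
    · rintro ⟨a, ha, rfl⟩
      by_cases hac : a = c
      · exact ⟨t, by omega, by rw [Function.update_self, hac]⟩
      · obtain ⟨a', h7, h8⟩ := (H.range (A a)).2 ⟨a, by omega, rfl⟩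
        exact ⟨a', by omega, by rw [hup a' h7, h8]⟩
  · intro a ha hat b hb
    rcases Nat.lt_succ_iff_lt_or_eq.1 hat with hat | rfl
    · rw [hup a hat]
      exact h6 a ha hat b (by omega)
    · rw [Function.update_self]
      exact hmin b hb

theorem halves_sorted (H : MergeInv A B h n t i mid j hi) (hA : BlockSorted A h n)
    (hh : 0 < h) {a b : ℕ} (hab : a ≤ b)
    (hb : i ≤ a ∧ b < mid ∨ j ≤ a ∧ b < hi) : A a ≤ A b := by
  obtain ⟨lo, ⟨q, rfl⟩, h2, h3, h4, h5, -⟩ := H.current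
  have c1 := H.mid_le
  have c4 := H.le_hi
  have c5 := H.hi_le
  refine hA a b hab (by omega) ?_
  have e : ∀ x p : ℕ, p * h ≤ x → x < p * h + h → x / h = p := fun x p hx hx' => by
    rw [Nat.div_eq_iff hh]; omega
  have e2 : 2 * h * q = (2 * q) * h := by ring
  rcases hb with hb | hb
  · rw [e a (2 * q) (by omega) (by omega), e b (2 * q) (by omega) (by omega)]
  · have e3 : (2 * q + 1) * h = 2 * h * q + h := by ring
    rw [e a (2 * q + 1) (by omega) (by omega), e b (2 * q + 1) (by omega) (by omega)]

theorem step_left (H : MergeInv A B h n t i mid j hi) (hA : BlockSorted A h n) (hh : 0 < h)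
    (h1 : t < hi) (h2 : i < mid) (h3 : j < hi → A i ≤ A j) :
    MergeInv A (Function.update B t (A i)) h n (t + 1) (i + 1) mid j hi := by
  refine H.step_aux h1 (by omega) H.le_hi (Or.inl ⟨rfl, rfl, rfl⟩) ?_
  rintro b (hb | hb)
  · exact H.halves_sorted hA hh (by omega) (Or.inl ⟨le_rfl, hb.2⟩)
  · exact (h3 (by omega)).trans (H.halves_sorted hA hh hb.1 (Or.inr ⟨le_rfl, hb.2⟩))

theorem step_right (H : MergeInv A B h n t i mid j hi) (hA : BlockSorted A h n) (hh : 0 < h)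
    (h1 : t < hi) (h3 : i < mid → j < hi ∧ A j ≤ A i) :
    MergeInv A (Function.update B t (A j)) h n (t + 1) i mid (j + 1) hi := by
  have hj : j < hi := by
    have := H.count
    have := H.le_mid
    by_cases hi' : i < mid
    · exact (h3 hi').1
    · omega
  refine H.step_aux h1 H.le_mid (by omega) (Or.inr ⟨rfl, rfl, rfl⟩) ?_
  rintro b (hb | hb)
  · exact (h3 (by omega)).2.trans (H.halves_sorted hA hh hb.1 (Or.inl ⟨le_rfl, hb.2⟩))
  · exact H.halves_sorted hA hh (by omega) (Or.inr ⟨le_rfl, hb.2⟩)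

theorem final_range (H : MergeInv A B h n n i mid j hi) (v : ℝ) :
    (∃ a, a < n ∧ B a = v) ↔ ∃ a, a < n ∧ A a = v := by
  rw [H.range]
  refine exists_congr fun a => ?_
  have := H.mid_le
  have := H.count
  have := H.le_mid
  have := H.le_hi
  have := H.hi_le
  have : (a < i ∨ mid ≤ a ∧ a < j) ↔ a < n := by omega
  rw [this]

end MergeInv

/-! ### The sorting program -/

namespace RealRAM
open RExpr

/-- Sets up the next block of a merging pass if the current one is exhausted. The registers
`24, …, 28` hold the variables `t`, `i`, `mid`, `j` and `hi` of `MergeInv`, and the registers `22`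
and `23` the variables `h` and `n`. -/
def nextBlockProg : Prog :=
  .ite (.le (reg 28) (reg 24))
    (block
      [.assign 25 (reg 24),
       .assign 26 (reg 24 + reg 22),
       .assign 28 (reg 26 + reg 22),
       .ite (.lt (reg 23) (reg 26)) (.assign 26 (reg 23)) .skip,
       .ite (.lt (reg 23) (reg 28)) (.assign 28 (reg 23)) .skip,
       .assign 27 (reg 26)])
    .skip

/-- One merging pass from the array at address `reg 20` to the array at address `reg 21`, both of
length `reg 23`, with blocks of length `reg 22`. -/
def passProg : Prog := block
  [.assign 24 0,
   .assign 25 0,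
   .assign 26 0,
   .assign 27 0,
   .assign 28 0,
   .loop (.lt (reg 24) (reg 23)) (block
    [nextBlockProg,
     .ite (.and (.lt (reg 25) (reg 26))
        (.not (.and (.lt (reg 27) (reg 28))
          (.lt (mem (reg 20 + reg 27)) (mem (reg 20 + reg 25))))))
      (block
        [.store (reg 21 + reg 24) (mem (reg 20 + reg 25)),
         .assign 25 (reg 25 + 1)])
      (block
        [.store (reg 21 + reg 24) (mem (reg 20 + reg 27)),
         .assign 27 (reg 27 + 1)]),
     .assign 24 (reg 24 + 1)])]

/-- Bottom-up merge sort of the array of length `reg 23` at address `reg 20`, with the array at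
address `reg 21` as second buffer. The result is at the final address `reg 20`. -/
def sortProg : Prog := block
  [.assign 22 1,
   .loop (.lt (reg 22) (reg 23)) (block
    [passProg,
     .assign 29 (reg 20),
     .assign 20 (reg 21),
     .assign 21 (reg 29),
     .assign 22 (reg 22 + reg 22)])]

/-- The registers hold the variables of `MergeInv`, for the target array at `dst`. -/
def MergeState (A : ℕ → ℝ) (dst h n t : ℕ) (busy : Prop) (s : State) : Prop :=
  ∃ i mid j hi : ℕ, (busy → t < hi) ∧ s.reg 24 = t ∧ s.reg 25 = i ∧ s.reg 26 = mid ∧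
    s.reg 27 = j ∧ s.reg 28 = hi ∧ MergeInv A (fun a => s.mem (dst + a)) h n t i mid j hi

theorem wp_nextBlockProg {s : State} {τ : ℕ} {A : ℕ → ℝ} {dst h n t : ℕ} (hh : 0 < h)
    (ht : t < n) (h22 : s.reg 22 = h) (h23 : s.reg 23 = n)
    (H : MergeState A dst h n t False s) :
    WP nextBlockProg (fun s' τ' => MergeState A dst h n t True s' ∧ τ' ≤ τ + 50) s τ := by
  obtain ⟨i, mid, j, hi, -, e24, e25, e26, e27, e28, H⟩ := H
  rw [nextBlockProg, wp_ite]
  refine ⟨fun hb => ?_, fun hb => ?_⟩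
  · simp [e28, e24] at hb
    have hH := H.next_block hb ht
    have done : ∀ (s' : State) (mid hi : ℕ), min (t + h) n = mid → min (t + h + h) n = hi →
        s'.mem = s.mem → s'.reg 24 = t → s'.reg 25 = t → s'.reg 26 = mid → s'.reg 27 = mid →
        s'.reg 28 = hi → MergeState A dst h n t True s' := by
      rintro s' _ _ rfl rfl hm a1 a2 a3 a4 a5
      exact ⟨t, _, _, _, fun _ => by omega, a1, a2, a3, a4, a5, by rw [hm]; exact hH⟩
    rcases lt_or_ge n (t + h) with hc1 | hc1 <;> rcases lt_or_ge n (t + h + h) with hc2 | hc2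
    · have r1 : (n : ℝ) < t + h := by exact_mod_cast hc1
      have r2 : (n : ℝ) < t + h + h := by exact_mod_cast hc2
      simp [State.reg_setReg, e24, h22, h23, r1, r2]
      exact done _ n n (by omega) (by omega) rfl (by simp [State.reg_setReg, e24])
        (by simp [State.reg_setReg]) (by simp [State.reg_setReg])
        (by simp [State.reg_setReg]) (by simp [State.reg_setReg])
    · omega
    · have r1 : (t : ℝ) + h ≤ n := by exact_mod_cast hc1
      have r2 : (n : ℝ) < t + h + h := by exact_mod_cast hc2
      simp [State.reg_setReg, e24, h22, h23, r2, r1.not_gt]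
      exact done _ (t + h) n (by omega) (by omega) rfl (by simp [State.reg_setReg, e24])
        (by simp [State.reg_setReg]) (by simp [State.reg_setReg])
        (by simp [State.reg_setReg]) (by simp [State.reg_setReg])
    · have r1 : (t : ℝ) + h ≤ n := by exact_mod_cast hc1
      have r2 : (t : ℝ) + h + h ≤ n := by exact_mod_cast hc2
      simp [State.reg_setReg, e24, h22, h23, r1.not_gt, r2.not_gt]
      exact done _ (t + h) (t + h + h) (by omega) (by omega) rfl
        (by simp [State.reg_setReg, e24])
        (by simp [State.reg_setReg]) (by simp [State.reg_setReg])
        (by simp [State.reg_setReg]) (by simp [State.reg_setReg])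
  · simp [e28, e24] at hb
    simp
    exact ⟨i, mid, j, hi, fun _ => hb, e24, e25, e26, e27, e28, H⟩

theorem wp_passProg {s : State} {τ : ℕ} {src dst h n : ℕ} (hh : 0 < h)
    (hdisj : src + n ≤ dst ∨ dst + n ≤ src)
    (h20 : s.reg 20 = src) (h21 : s.reg 21 = dst) (h22 : s.reg 22 = h) (h23 : s.reg 23 = n)
    (hA : BlockSorted (fun a => s.mem (src + a)) h n) :
    WP passProg (fun s' τ' => BlockSorted (fun a => s'.mem (dst + a)) (2 * h) n ∧
      (∀ v, (∃ a, a < n ∧ s'.mem (dst + a) = v) ↔ ∃ a, a < n ∧ s.mem (src + a) = v) ∧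
      (∀ x, (x < dst ∨ dst + n ≤ x) → s'.mem x = s.mem x) ∧
      s'.used ≤ max s.used (dst + n) ∧ τ' ≤ τ + (40 + 110 * n)) s τ := by
  set A : ℕ → ℝ := fun a => s.mem (src + a) with hAdef
  simp only [passProg, wp_block_cons, wp_assign]
  refine WP.loop n (fun t s' τ' => MergeState A dst h n t False s' ∧
    (∀ x, (x < dst ∨ dst + n ≤ x) → s'.mem x = s.mem x) ∧
    s'.used ≤ max s.used (dst + n) ∧ τ' ≤ τ + 15 + 110 * t) ?_ ?_ ?_
  · refine ⟨⟨0, 0, 0, 0, False.elim, ?_⟩, fun x _ => rfl, le_max_left _ _, by simp⟩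
    simp [State.reg_setReg, MergeInv.init]
  · rintro t ht s' τ' hf ⟨H, hmem, hused, hτ⟩
    have e20 := hf.reg 20 (by decide)
    have e21 := hf.reg 21 (by decide)
    have e22 := hf.reg 22 (by decide)
    have e23 := hf.reg 23 (by decide)
    simp [State.reg_setReg, h20, h21, h22, h23] at e20 e21 e22 e23
    have htn : (t : ℝ) < n := by exact_mod_cast ht
    have e24 : s'.reg 24 = t := by
      obtain ⟨_, _, _, _, _, e24, _⟩ := H
      exact e24
    refine ⟨by simpa [e24, e23] using htn, ?_⟩
    rw [wp_block_cons]
    refine (wp_nextBlockProg hh ht e22 e23 H).frame.mono ?_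
    clear H
    rintro s₁ τ₁ ⟨⟨⟨i, mid, j, hi, hlt, g24, e25, e26, e27, e28, H⟩, hτ₁⟩, hf₁⟩
    replace hlt := hlt trivial
    have g20 := (hf₁.reg 20 (by decide)).trans e20
    have g21 := (hf₁.reg 21 (by decide)).trans e21
    rw [← hf₁.mem (by decide)] at hmem
    rw [← hf₁.used (by decide)] at hused
    have f1 : ⌊(src : ℝ) + i⌋₊ = src + i := by rw [← Nat.cast_add, Nat.floor_natCast]
    have f2 : ⌊(src : ℝ) + j⌋₊ = src + j := by rw [← Nat.cast_add, Nat.floor_natCast]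
    have f3 : ⌊(dst : ℝ) + t⌋₊ = dst + t := by rw [← Nat.cast_add, Nat.floor_natCast]
    have c1 := H.mid_le
    have c2 := H.count
    have c3 := H.le_mid
    have c4 := H.le_hi
    have c5 := H.hi_le
    have hsrc : ∀ a, a < n → s₁.mem (src + a) = A a := fun a ha => hmem _ (by omega)
    have hupd : ∀ v, (fun a => Function.update s₁.mem (dst + t) v (dst + a)) =
        Function.update (fun a => s₁.mem (dst + a)) t v := fun v => by
      funext a
      simp [Function.update_apply]
    have hout : ∀ v x, (x < dst ∨ dst + n ≤ x) →
        Function.update s₁.mem (dst + t) v x = s.mem x := fun v x hx => by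
      rw [Function.update_of_ne (by omega)]; exact hmem x hx
    simp at hτ₁
    rw [wp_block_cons, wp_ite]
    refine ⟨fun hb => ?_, fun hb => ?_⟩
    · simp [g20, e25, e26, e27, e28, f1, f2] at hb
      simp [State.reg_setReg, g20, g21, g24, e25, f1, f3, -sup_le_iff, -le_sup_iff]
      refine ⟨⟨i + 1, mid, j, hi, False.elim, ?_⟩, hout _, by omega, by omega⟩
      simp [State.reg_setReg, e26, e27, e28]
      rw [hupd, hsrc i (by omega)]
      refine H.step_left hA hh hlt hb.1 fun hj => ?_
      rw [← hsrc i (by omega), ← hsrc j (by omega)]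
      exact hb.2 hj
    · simp [g20, e25, e26, e27, e28, f1, f2] at hb
      simp [State.reg_setReg, g20, g21, g24, e27, f2, f3, -sup_le_iff, -le_sup_iff]
      have hj : j < n := by
        by_cases hi' : i < mid
        · have := (hb hi').1; omega
        · omega
      refine ⟨⟨i, mid, j + 1, hi, False.elim, ?_⟩, hout _, by omega, by omega⟩
      simp [State.reg_setReg, e25, e26, e28]
      rw [hupd, hsrc j hj]
      refine H.step_right hA hh hlt fun hi' => ?_
      rw [← hsrc i (by omega), ← hsrc j hj]
      exact ⟨(hb hi').1, (hb hi').2.le⟩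
  · rintro s' τ' hf ⟨⟨i, mid, j, hi, -, e24, e25, e26, e27, e28, H⟩, hmem, hused, hτ⟩
    have e23 := hf.reg 23 (by decide)
    simp [State.reg_setReg, h23] at e23
    simp [e24, e23, -sup_le_iff, -le_sup_iff]
    exact ⟨H.sorted, H.final_range, hmem, hused, by omega⟩

/-- The memory holds the entries of `M` at `base`, sorted within blocks of length `h` and stored in
one of the two buffers behind `base`. -/
def SortState (M : ℕ → ℝ) (base n h : ℕ) (s : State) : Prop :=
  ∃ src dst : ℕ, s.reg 20 = src ∧ s.reg 21 = dst ∧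
    (src = base ∧ dst = base + n ∨ src = base + n ∧ dst = base) ∧
    s.reg 22 = h ∧ BlockSorted (fun a => s.mem (src + a)) h n ∧
    (∀ v, (∃ a, a < n ∧ s.mem (src + a) = v) ↔ ∃ a, a < n ∧ M (base + a) = v) ∧
    ∀ x, (x < base ∨ base + 2 * n ≤ x) → s.mem x = M x

theorem wp_sortProg {s : State} {τ : ℕ} {base n : ℕ} (hn : 1 ≤ n)
    (h20 : s.reg 20 = base) (h21 : s.reg 21 = (base + n : ℕ)) (h23 : s.reg 23 = n) :
    WP sortProg (fun s' τ' => ∃ src : ℕ, s'.reg 20 = src ∧ (src = base ∨ src = base + n) ∧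
      (∀ a b, a ≤ b → b < n → s'.mem (src + a) ≤ s'.mem (src + b)) ∧
      (∀ v, (∃ a, a < n ∧ s'.mem (src + a) = v) ↔ ∃ a, a < n ∧ s.mem (base + a) = v) ∧
      (∀ x, (x < base ∨ base + 2 * n ≤ x) → s'.mem x = s.mem x) ∧
      s'.used ≤ max s.used (base + 2 * n) ∧
      τ' ≤ τ + (20 + (80 + 110 * n) * Nat.clog 2 n)) s τ := by
  simp only [sortProg, wp_block_cons, wp_assign]
  refine WP.loop (Nat.clog 2 n) (fun i s' τ' => SortState s.mem base n (2 ^ i) s' ∧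
    s'.used ≤ max s.used (base + 2 * n) ∧ τ' ≤ τ + 10 + (80 + 110 * n) * i) ?_ ?_ ?_
  · refine ⟨⟨base, base + n, by simpa [State.reg_setReg] using h20,
      by simpa [State.reg_setReg] using h21, Or.inl ⟨rfl, rfl⟩, by simp [State.reg_setReg],
      ?_, fun v => Iff.rfl, fun x _ => rfl⟩, le_max_left _ _, by simp⟩
    intro a b _ _ hdiv
    simp only [pow_zero, Nat.div_one] at hdiv
    rw [hdiv]
  · rintro i hi s' τ' hf ⟨⟨src, dst, e20, e21, hsd, e22, hsort, hset, hmem⟩, hused, hτ⟩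
    have e23 := hf.reg 23 (by decide)
    simp [State.reg_setReg, h23] at e23
    have hlt : 2 ^ i < n := Nat.pow_lt_of_lt_clog hi
    refine ⟨by simp [e22, e23]; exact_mod_cast hlt, ?_⟩
    rw [wp_block_cons]
    refine (wp_passProg (by positivity) (by omega) e20 e21 e22 e23 hsort).frame.mono ?_
    rintro s₁ τ₁ ⟨⟨p1, p2, p3, p4, p5⟩, hf₁⟩
    have g20 := (hf₁.reg 20 (by decide)).trans e20
    have g21 := (hf₁.reg 21 (by decide)).trans e21
    have g22 := (hf₁.reg 22 (by decide)).trans e22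
    simp [State.reg_setReg, g20, g21, g22, -sup_le_iff, -le_sup_iff]
    refine ⟨⟨dst, src, ?_, ?_, by omega, ?_, ?_, fun v => (p2 v).trans (hset v),
      fun x hx => (p3 x (by omega)).trans (hmem x hx)⟩, by omega, ?_⟩
    · simp [State.reg_setReg]
    · simp [State.reg_setReg]
    · simp [State.reg_setReg]; ring
    · rw [pow_succ, mul_comm]; exact p1
    · simp at p5
      have : (80 + 110 * n) * (i + 1) = (80 + 110 * n) * i + 80 + 110 * n := by ring
      omega
  · rintro s' τ' hf ⟨⟨src, dst, e20, e21, hsd, e22, hsort, hset, hmem⟩, hused, hτ⟩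
    have e23 := hf.reg 23 (by decide)
    simp [State.reg_setReg, h23] at e23
    have hle : n ≤ 2 ^ Nat.clog 2 n := Nat.le_pow_clog (by norm_num) n
    refine ⟨by simp [e22, e23]; exact_mod_cast hle, ?_⟩
    rw [wp_block_nil]
    refine ⟨src, e20, by omega, fun a b hab hb => hsort a b hab hb ?_, hset, hmem, by omega, ?_⟩
    · rw [Nat.div_eq_of_lt (by omega), Nat.div_eq_of_lt (by omega)]
    · simp; omega

end RealRAM

/-! ### The data structure and the query program -/

/-- The memory `M` holds, at the address `base`, the dictionary of one shift `σ`: the shift itself,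
the address of a sorted array, and two buffers of length `n`, one of which is that array. Its
entries encode the pairs of a key `K i` and its index `i < n`. -/
def IsTable (M : ℕ → ℝ) (n base : ℕ) (σ : ℝ) (K : ℕ → ℕ) : Prop :=
  ∃ src : ℕ, M base = σ ∧ M (base + 1) = src ∧ (src = base + 2 ∨ src = base + 2 + n) ∧
    (∀ a b, a ≤ b → b < n → M (src + a) ≤ M (src + b)) ∧
    ∀ v, (∃ a, a < n ∧ M (src + a) = v) ↔ ∃ i, i < n ∧ ((K i * n + i : ℕ) : ℝ) = v

/-- The address of the dictionary of index `j`. -/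
def tableBase (n j : ℕ) : ℕ := 5 + j * (2 * n + 2)

/-- The memory `M` holds a header and `R` dictionaries, with shifts `σ j` and keys `K j i`. -/
structure IsDataStructure (M : ℕ → ℝ) (n k R : ℕ) (w : ℝ) (σ : ℕ → ℝ) (K : ℕ → ℕ → ℕ) :
    Prop where
  size : M 0 = n
  length : M 1 = k
  width : M 2 = w
  rounds : M 3 = R
  power : M 4 = (2 ^ Nat.clog 2 n : ℕ)
  table : ∀ j < R, IsTable M n (tableBase n j) (σ j) (K j)

theorem IsTable.congr {M M' : ℕ → ℝ} {n base : ℕ} {σ : ℝ} {K : ℕ → ℕ} (h : IsTable M n base σ K)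
    (hM : ∀ x, base ≤ x → x < base + (2 * n + 2) → M' x = M x) : IsTable M' n base σ K := by
  obtain ⟨src, h1, h2, h3, h4, h5⟩ := h
  have e : ∀ a, a < n → M' (src + a) = M (src + a) := fun a ha => hM _ (by omega) (by omega)
  refine ⟨src, by rw [hM _ (by omega) (by omega), h1], by rw [hM _ (by omega) (by omega), h2], h3,
    fun a b hab hb => ?_, fun v => ?_⟩
  · rw [e a (by omega), e b hb]; exact h4 a b hab hb
  · rw [← h5]
    exact exists_congr fun a => and_congr_right fun ha => by rw [e a ha]

namespace RealRAM
open RExpr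

/-- One step of the binary search: tries to advance the position `reg 13` by `reg 14`. -/
def searchStepProg : Prog := block
  [.assign 14 (reg 14 / 2),
   .ite (.lt (reg 13 + reg 14) (reg 23))
    (.ite (.le (mem (reg 20 + (reg 13 + reg 14))) (reg 12)) (.assign 13 (reg 13 + reg 14)) .skip)
    .skip]

/-- Looks up the key `reg 11` in the dictionary at address `reg 33`: binary search for the last
entry that is at most the largest possible entry with that key. If the key is found, then one more
than the index of an entry is stored in register `0`. -/
def lookupProg : Prog := block
  [.assign 12 (reg 11 * reg 23 + (reg 23 - 1)),
   .assign 20 (mem (reg 33 + 1)),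
   .assign 13 0,
   .assign 14 (reg 31),
   .loop (.lt 1 (reg 14)) searchStepProg,
   .assign 15 (mem (reg 20 + reg 13)),
   .ite (.and (.le (reg 11 * reg 23) (reg 15)) (.le (reg 15) (reg 12)))
    (.assign 0 (reg 15 - reg 11 * reg 23 + 1)) .skip]

/-- The query program: computes the code of the query for every shift and looks it up. -/
def queryProg : Prog := block
  [.assign 23 (mem 0),
   .assign 2 (mem 1),
   .assign 3 (mem 2),
   .assign 30 (mem 3),
   .assign 31 (mem 4),
   .assign 33 5,
   .loop (.lt (reg 32) (reg 30)) (block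
    [.assign 4 (mem (reg 33)),
     codeProg,
     lookupProg,
     .assign 32 (reg 32 + 1),
     .assign 33 (reg 33 + (2 * reg 23 + 2))])]

/-- State of the binary search in the array at `src` for the last entry at most `Y`. -/
def SearchState (M : ℕ → ℝ) (src n : ℕ) (Y : ℝ) (step : ℕ) (s : State) : Prop :=
  ∃ pos : ℕ, s.reg 13 = pos ∧ s.reg 14 = step ∧ pos < n ∧ (pos = 0 ∨ M (src + pos) ≤ Y) ∧
    ∀ b, pos + step ≤ b → b < n → Y < M (src + b)

theorem wp_searchStepProg {s : State} {τ : ℕ} {src n step : ℕ} {Y : ℝ}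
    (h12 : s.reg 12 = Y) (h20 : s.reg 20 = src) (h23 : s.reg 23 = n)
    (hsort : ∀ a b, a ≤ b → b < n → s.mem (src + a) ≤ s.mem (src + b))
    (H : SearchState s.mem src n Y (2 * step) s) :
    WP searchStepProg (fun s' τ' => SearchState s.mem src n Y step s' ∧ τ' ≤ τ + 40) s τ := by
  obtain ⟨pos, e13, e14, hpos, hle, hgt⟩ := H
  have hhalf : ((2 * step : ℕ) : ℝ) / 2 = step := by push_cast; ring
  have hfl : ⌊(src : ℝ) + (pos + step)⌋₊ = src + (pos + step) := by
    rw [← Nat.cast_add, ← Nat.cast_add, Nat.floor_natCast]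
  rw [searchStepProg, wp_block_cons, wp_assign, wp_block_cons, wp_ite]
  refine ⟨fun hb => ?_, fun hb => ?_⟩
  · simp [State.reg_setReg, e13, e14, h23, -Nat.cast_mul, -Nat.cast_ofNat] at hb
    rw [hhalf] at hb
    have hb' : pos + step < n := by exact_mod_cast hb
    rw [wp_ite]
    refine ⟨fun hb2 => ?_, fun hb2 => ?_⟩
    · simp [State.reg_setReg, e13, e14, h20, h12, -Nat.cast_mul] at hb2
      rw [hhalf, hfl] at hb2
      simp
      refine ⟨pos + step, ?_, ?_, hb', Or.inr hb2, fun b h1 h2 => hgt b (by omega) h2⟩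
      · simp [State.reg_setReg, e13, e14]
      · simp [State.reg_setReg, e14]
    · simp [State.reg_setReg, e13, e14, h20, h12, -Nat.cast_mul] at hb2
      rw [hhalf, hfl] at hb2
      simp
      refine ⟨pos, ?_, ?_, hpos, hle, fun b h1 h2 => ?_⟩
      · simp [State.reg_setReg, e13]
      · simp [State.reg_setReg, e14]
      · exact hb2.trans_le (hsort _ _ h1 h2)
  · simp [State.reg_setReg, e13, e14, h23, -Nat.cast_mul] at hb
    rw [hhalf] at hb
    have hb' : n ≤ pos + step := by exact_mod_cast hb
    simp
    refine ⟨pos, ?_, ?_, hpos, hle, fun b h1 h2 => absurd h2 (by omega)⟩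
    · simp [State.reg_setReg, e13]
    · simp [State.reg_setReg, e14]

theorem wp_lookupProg {s : State} {τ : ℕ} {n base key : ℕ} {σ : ℝ} {K : ℕ → ℕ} (hn : 1 ≤ n)
    (h11 : s.reg 11 = key) (h23 : s.reg 23 = n) (h31 : s.reg 31 = (2 ^ Nat.clog 2 n : ℕ))
    (h33 : s.reg 33 = base) (hT : IsTable s.mem n base σ K) :
    WP lookupProg (fun s' τ' => ((∃ i, i < n ∧ K i = key ∧ s'.reg 0 = i + 1) ∨
      (∀ i, i < n → K i ≠ key) ∧ s'.reg 0 = s.reg 0) ∧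
      τ' ≤ τ + (80 + 50 * Nat.clog 2 n)) s τ := by
  obtain ⟨src, t1, t2, t3, hsort, hrange⟩ := hT
  set Y : ℝ := key * n + (n - 1) with hY
  have hb1 : ⌊(base : ℝ) + 1⌋₊ = base + 1 := by rw [← Nat.cast_add_one, Nat.floor_natCast]
  set T := Nat.clog 2 n with hTdef
  have hnT : n ≤ 2 ^ T := Nat.le_pow_clog (by norm_num) n
  simp only [lookupProg, wp_block_cons, wp_assign]
  refine WP.loop T (fun i s' τ' => SearchState s.mem src n Y (2 ^ (T - i)) s' ∧
    τ' ≤ τ + 30 + 50 * i) ?_ ?_ ?_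
  · refine ⟨⟨0, ?_, ?_, hn, Or.inl rfl, fun b h1 h2 => absurd h2 ?_⟩, by simp⟩
    · simp [State.reg_setReg]
    · simp [State.reg_setReg, h31]
    · rw [Nat.sub_zero] at h1; omega
  · rintro i hi s' τ' hf ⟨H, hτ⟩
    have e12 := hf.reg 12 (by decide)
    have e20 := hf.reg 20 (by decide)
    have e23 := hf.reg 23 (by decide)
    have em := hf.mem (by decide)
    simp [State.reg_setReg, h11, h23, h33, hb1, t2] at e12 e20 e23 em
    have hstep : 2 ^ (T - i) = 2 * 2 ^ (T - (i + 1)) := by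
      rw [← pow_succ']; congr 1; omega
    have e14 : s'.reg 14 = ((2 ^ (T - i) : ℕ) : ℝ) := by
      obtain ⟨_, _, e14, _⟩ := H
      exact e14
    have h1 : 1 < 2 ^ (T - i) := Nat.one_lt_pow (by omega) (by norm_num)
    refine ⟨by simp [e14]; exact_mod_cast h1, ?_⟩
    rw [hstep, ← em] at H
    rw [← em] at hsort ⊢
    refine (wp_searchStepProg e12 e20 e23 hsort H).mono ?_
    rintro s₁ τ₁ ⟨H₁, hτ₁⟩
    refine ⟨H₁, ?_⟩
    simp at hτ₁
    omega
  · rintro s' τ' hf ⟨⟨pos, e13, e14, hpos, hle, hgt⟩, hτ⟩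
    rw [Nat.sub_self, pow_zero] at e14 hgt
    refine ⟨by simp [e14], ?_⟩
    have e0 := hf.reg 0 (by decide)
    have e11 := hf.reg 11 (by decide)
    have e12 := hf.reg 12 (by decide)
    have e20 := hf.reg 20 (by decide)
    have e23 := hf.reg 23 (by decide)
    have em := hf.mem (by decide)
    simp [State.reg_setReg, h11, h23, h33, hb1, t2] at e0 e11 e12 e20 e23 em
    rw [← hY] at e12
    have hfl : ⌊(src : ℝ) + pos⌋₊ = src + pos := by rw [← Nat.cast_add, Nat.floor_natCast]
    obtain ⟨i, hi, hiv⟩ := (hrange _).1 ⟨pos, hpos, rfl⟩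
    have hY' : Y = ((key * n + (n - 1) : ℕ) : ℝ) := by
      rw [hY]; push_cast [Nat.cast_sub hn]; ring
    have hkn : (key : ℝ) * n = ((key * n : ℕ) : ℝ) := by push_cast; ring
    rw [wp_block_cons, wp_assign, wp_block_cons, wp_ite]
    refine ⟨fun hb => ?_, fun hb => ?_⟩
    · simp [State.reg_setReg, e11, e12, e20, e23, e13, em, hfl, -Nat.cast_add, -Nat.cast_mul] at hb
      rw [← hiv, hY', hkn, Nat.cast_le, Nat.cast_le] at hb
      have hK : K i = key := by
        have h1 : K i < key + 1 := by
          by_contra hc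
          have := Nat.mul_le_mul_right n (not_lt.1 hc)
          rw [add_mul] at this
          omega
        have h2 : key < K i + 1 := by
          by_contra hc
          have := Nat.mul_le_mul_right n (not_lt.1 hc)
          rw [add_mul] at this
          omega
        omega
      simp [-Nat.cast_add, -Nat.cast_mul]
      refine ⟨Or.inl ⟨i, hi, hK, ?_⟩, by omega⟩
      simp [e11, e20, e23, e13, em, hfl, -Nat.cast_add, -Nat.cast_mul]
      rw [← hiv, hK]
      push_cast
      ring
    · simp [State.reg_setReg, e11, e12, e20, e23, e13, em, hfl, -Nat.cast_add, -Nat.cast_mul] at hb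
      simp [State.reg_setReg, e0]
      refine ⟨Or.inr fun i' hi' hK => ?_, by omega⟩
      obtain ⟨a, ha, hav⟩ := (hrange _).2 ⟨i', hi', rfl⟩
      rw [hK] at hav
      have h1 : s.mem (src + a) ≤ Y := by
        rw [hav, hY', Nat.cast_le]; omega
      have hap : a ≤ pos := by
        by_contra hc
        have := hgt a (by omega) ha
        linarith
      have h2 : s.mem (src + pos) ≤ Y := by
        rcases hle with rfl | hle
        · rwa [show a = 0 by omega] at h1
        · exact hle
      have h3 : (key : ℝ) * n ≤ s.mem (src + pos) := by
        refine le_trans ?_ (hsort a pos hap hpos)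
        rw [hav, hkn, Nat.cast_le]; omega
      exact absurd h2 (not_le.2 (hb h3))

/-- Register `0` holds an answer that is justified by the first `j` dictionaries: an index with the
key of the query in one of them, if there is one. -/
def AnswerState (n : ℕ) (K : ℕ → ℕ → ℕ) (q : ℕ → ℕ) (j : ℕ) (s : State) : Prop :=
  ∃ a : Option (Fin n), s.reg 0 = encodeAnswer a ∧
    (∀ i, a = some i → ∃ j' < j, K j' i = q j') ∧
    ∀ j' < j, ∀ i < n, K j' i = q j' → a ≠ none

theorem wp_queryProg {n k R : ℕ} {w : ℝ} {σ : ℕ → ℝ} {K : ℕ → ℕ → ℕ} {D : ℕ → ℝ} (hn : 1 ≤ n)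
    (hk : 1 ≤ k) (hD : IsDataStructure D n k R w σ K) (y : Fin k → ℝ) :
    WP queryProg (fun s τ =>
      AnswerState n K (fun j => walkCode (scaled y w (σ j)) (k - 1)) R s ∧
      τ ≤ 50 + (150 + 100 * k + 50 * Nat.clog 2 n) * R) (queryStart D y) 0 := by
  set T := Nat.clog 2 n with hT
  simp only [queryProg, wp_block_cons, wp_assign]
  refine WP.loop R (fun j s τ => s.reg 32 = j ∧ s.reg 33 = tableBase n j ∧
    AnswerState n K (fun j => walkCode (scaled y w (σ j)) (k - 1)) j s ∧
    τ ≤ 30 + (150 + 100 * k + 50 * T) * j) ?_ ?_ ?_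
  · refine ⟨by simp [State.reg_setReg, queryStart], by simp [State.reg_setReg, tableBase],
      ⟨none, by simp [State.reg_setReg, queryStart, encodeAnswer], by simp, by simp⟩, by simp⟩
  · rintro j hj s τ hf ⟨e32, e33, H, hτ⟩
    have e1 := hf.reg 1 (by decide)
    have e2 := hf.reg 2 (by decide)
    have e3 := hf.reg 3 (by decide)
    have e23 := hf.reg 23 (by decide)
    have e30 := hf.reg 30 (by decide)
    have e31 := hf.reg 31 (by decide)
    have em := hf.mem (by decide)
    have ei := hf.inp
    simp [State.reg_setReg, queryStart, hD.size, hD.length, hD.width, hD.rounds, hD.power]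
      at e1 e2 e3 e23 e30 e31 em ei
    have hjR : (j : ℝ) < R := by exact_mod_cast hj
    refine ⟨by simpa [e32, e30] using hjR, ?_⟩
    have hsh : D (tableBase n j) = σ j := by
      obtain ⟨_, h, _⟩ := hD.table j hj
      exact h
    rw [wp_block_cons, wp_assign, wp_block_cons]
    refine (wp_codeProg (a := 0) (len := k) (w := w) (z := scaled y w (σ j)) hk
      (by simp [State.reg_setReg, e1]) (by simp [State.reg_setReg, e2])
      (by simp [State.reg_setReg, e3]) ?_).frame.mono ?_
    · intro i hi
      simp [State.reg_setReg, ei, em, e33, hsh, scaled]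
    rintro s₁ τ₁ ⟨⟨g11, hτ₁⟩, hf₁⟩
    have g0 := hf₁.reg 0 (by decide)
    have g23 := hf₁.reg 23 (by decide)
    have g31 := hf₁.reg 31 (by decide)
    have g32 := hf₁.reg 32 (by decide)
    have g33 := hf₁.reg 33 (by decide)
    have gm := hf₁.mem (by decide)
    simp [State.reg_setReg, e23, e31, e32, e33, em] at g0 g23 g31 g32 g33 gm
    rw [wp_block_cons]
    have ht := hD.table j hj
    rw [← gm] at ht
    refine (wp_lookupProg hn g11 g23 (by rw [g31]; push_cast; rfl) g33 ht).frame.mono ?_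
    rintro s₂ τ₂ ⟨⟨hans, hτ₂⟩, hf₂⟩
    have f23 := (hf₂.reg 23 (by decide)).trans g23
    have f32 := (hf₂.reg 32 (by decide)).trans g32
    have f33 := (hf₂.reg 33 (by decide)).trans g33
    rw [← hT] at hτ₂
    simp [State.reg_setReg, f23, f32, f33]
    refine ⟨by simp [tableBase]; ring, ?_, ?_⟩
    · obtain ⟨a, ha, hsome, hnone⟩ := H
      rcases hans with ⟨i, hi, hK, hr⟩ | ⟨hno, hr⟩
      · refine ⟨some ⟨i, hi⟩, by simp [State.reg_setReg, hr, encodeAnswer], ?_, by simp⟩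
        intro i' hi'
        obtain rfl := Option.some.inj hi'
        exact ⟨j, Nat.lt_succ_self j, hK⟩
      · refine ⟨a, by simp [State.reg_setReg, hr, g0, ha], fun i hi => ?_, ?_⟩
        · obtain ⟨j', hj', h⟩ := hsome i hi
          exact ⟨j', by omega, h⟩
        · intro j' hj' i hi h
          rcases Nat.lt_succ_iff_lt_or_eq.1 hj' with h' | rfl
          · exact hnone j' h' i hi h
          · exact absurd h (hno i hi)
    · simp at hτ₁
      have : (150 + 100 * k + 50 * T) * (j + 1) =
        (150 + 100 * k + 50 * T) * j + 150 + 100 * k + 50 * T := by ring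
      omega
  · rintro s τ hf ⟨e32, e33, H, hτ⟩
    have e30 := hf.reg 30 (by decide)
    simp [State.reg_setReg, queryStart, hD.rounds] at e30
    refine ⟨by simp [e32, e30], ?_⟩
    rw [wp_block_nil]
    exact ⟨H, by simp; omega⟩

end RealRAM

/-! ### The preprocessing program -/

/-- The key of the input curve of index `i` for the grid of width `w` with shift `σ`. -/
noncomputable def inputKey {n m : ℕ} (X : Fin n → Fin m → ℝ) (w σ : ℝ) (i : ℕ) : ℕ :=
  if h : i < n then walkCode (scaled (X ⟨i, h⟩) w σ) (m - 1) else 0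

/-- The number of shifts: `min m k + 1` equally spaced shifts if these are few enough, and
otherwise `c ⌈log₂ n⌉` random ones. -/
def roundCount (c n m k : ℕ) : ℕ := min (min m k + 1) (c * Nat.clog 2 n)

/-- The shift of index `j`, for the random numbers `ω`. -/
noncomputable def shiftOf (c n m k : ℕ) (ω : ℕ → unitInterval) (j : ℕ) : ℝ :=
  if min m k + 1 ≤ c * Nat.clog 2 n then (j : ℝ) / roundCount c n m k else ω j

theorem preprocessStart_inp_vertex {n m k : ℕ} {r : ℝ} {X : Fin n → Fin m → ℝ}
    {ω : ℕ → unitInterval} {i j : ℕ} (hi : i < n) (hj : j < m) :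
    (preprocessStart k r X ω).inp (4 + i * m + j) = vertexAt (X ⟨i, hi⟩) j := by
  have h1 : (i * m + j) / m = i := by
    rw [Nat.div_eq_iff (by omega)]; omega
  have h2 : (i * m + j) % m = j := by
    rw [mul_comm, Nat.mul_add_mod, Nat.mod_eq_of_lt hj]
  rw [show 4 + i * m + j = (i * m + j) + 4 by ring]
  change (if h : (i * m + j) / m < n then vertexAt (X ⟨(i * m + j) / m, h⟩) ((i * m + j) % m)
    else 0) = _
  simp only [h1, h2, hi, dite_true]

namespace RealRAM
open RExpr

/-- Writes the entries of all input curves, for the shift `reg 4`, to the array at address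
`reg 33 + 2`. -/
def fillProg : Prog := block
  [.assign 34 0,
   .assign 1 4,
   .loop (.lt (reg 34) (reg 23)) (block
    [codeProg,
     .store (reg 33 + 2 + reg 34) (reg 11 * reg 23 + reg 34),
     .assign 34 (reg 34 + 1),
     .assign 1 (reg 1 + reg 16)])]

/-- Builds the dictionary of one shift at address `reg 33`. The shift is random unless
`reg 19 ≤ reg 18`. -/
def roundProg : Prog := block
  [.rand 4,
   .ite (.le (reg 19) (reg 18)) (.assign 4 (reg 32 / reg 30)) .skip,
   .store (reg 33) (reg 4),
   fillProg,
   .assign 20 (reg 33 + 2),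
   .assign 21 (reg 20 + reg 23),
   sortProg,
   .store (reg 33 + 1) (reg 20),
   .assign 32 (reg 32 + 1),
   .assign 33 (reg 33 + (2 * reg 23 + 2))]

/-- Reads the parameters, and computes the grid width in register `3`, the least power of two
that is at least `n` in register `31`, the two candidates for the number of shifts in the registers
`18` and `19` and their minimum in register `30`. -/
def setupProg (c : ℕ) : Prog := block
  [.assign 23 (inp 0),
   .assign 16 (inp 1),
   .assign 17 (inp 2),
   .assign 3 (12 * reg 17 * inp 3),
   .assign 31 1,
   .loop (.lt (reg 31) (reg 23)) (block
    [.assign 31 (2 * reg 31),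
     .assign 18 (reg 18 + 1)]),
   .assign 18 (lit c * reg 18),
   .assign 19 (reg 16 + 1),
   .ite (.lt (reg 17) (reg 16)) (.assign 19 (reg 17 + 1)) .skip,
   .assign 30 (reg 18),
   .ite (.le (reg 19) (reg 18)) (.assign 30 (reg 19)) .skip]

/-- Writes the header of the data structure. -/
def headerProg : Prog := block
  [.store 0 (reg 23),
   .store 1 (reg 17),
   .store 2 (reg 3),
   .store 3 (reg 30),
   .store 4 (reg 31)]

/-- The preprocessing program. -/
def preprocessProg (c : ℕ) : Prog := block
  [setupProg c,
   headerProg,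
   .assign 33 5,
   .assign 2 (reg 16),
   .loop (.lt (reg 32) (reg 30)) roundProg]

theorem wp_fillProg {s : State} {τ : ℕ} {n m base : ℕ} {X : Fin n → Fin m → ℝ} {w σ : ℝ}
    (hm : 1 ≤ m) (h2 : s.reg 2 = m) (h3 : s.reg 3 = w) (h4 : s.reg 4 = σ) (h16 : s.reg 16 = m)
    (h23 : s.reg 23 = n) (h33 : s.reg 33 = base)
    (hinp : ∀ i j (hi : i < n), j < m → s.inp (4 + i * m + j) = vertexAt (X ⟨i, hi⟩) j) :
    WP fillProg (fun s' τ' =>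
      (∀ i, i < n → s'.mem (base + 2 + i) = ((inputKey X w σ i * n + i : ℕ) : ℝ)) ∧
      (∀ x, (x < base + 2 ∨ base + 2 + n ≤ x) → s'.mem x = s.mem x) ∧
      s'.used ≤ max s.used (base + 2 + n) ∧ τ' ≤ τ + (20 + (40 + 100 * m) * n)) s τ := by
  simp only [fillProg, wp_block_cons, wp_assign]
  refine WP.loop n (fun i s' τ' => s'.reg 34 = i ∧ s'.reg 1 = (4 + i * m : ℕ) ∧
    (∀ a, a < i → s'.mem (base + 2 + a) = ((inputKey X w σ a * n + a : ℕ) : ℝ)) ∧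
    (∀ x, (x < base + 2 ∨ base + 2 + n ≤ x) → s'.mem x = s.mem x) ∧
    s'.used ≤ max s.used (base + 2 + n) ∧ τ' ≤ τ + 10 + (40 + 100 * m) * i) ?_ ?_ ?_
  · exact ⟨by simp [State.reg_setReg], by simp [State.reg_setReg], fun a ha => absurd ha (by omega),
      fun x _ => rfl, le_max_left _ _, by simp⟩
  · rintro i hi s' τ' hf ⟨e34, e1, hent, hmem, hused, hτ⟩
    have e2 := hf.reg 2 (by decide)
    have e3 := hf.reg 3 (by decide)
    have e4 := hf.reg 4 (by decide)
    have e16 := hf.reg 16 (by decide)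
    have e23 := hf.reg 23 (by decide)
    have e33 := hf.reg 33 (by decide)
    have ei := hf.inp
    simp [State.reg_setReg, h2, h3, h4, h16, h23, h33] at e2 e3 e4 e16 e23 e33 ei
    have hin : (i : ℝ) < n := by exact_mod_cast hi
    refine ⟨by simpa [e34, e23] using hin, ?_⟩
    rw [wp_block_cons]
    refine (wp_codeProg (z := scaled (X ⟨i, hi⟩) w σ) hm e1 e2 e3 ?_).frame.mono ?_
    · intro j hj
      rw [ei, hinp i j hi hj, e4, scaled]
    rintro s₁ τ₁ ⟨⟨g11, hτ₁⟩, hf₁⟩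
    have g1 := (hf₁.reg 1 (by decide)).trans e1
    have g16 := (hf₁.reg 16 (by decide)).trans e16
    have g23 := (hf₁.reg 23 (by decide)).trans e23
    have g33 := (hf₁.reg 33 (by decide)).trans e33
    have g34 := (hf₁.reg 34 (by decide)).trans e34
    rw [← hf₁.mem (by decide)] at hmem hent
    rw [← hf₁.used (by decide)] at hused
    have hfl : ⌊(base : ℝ) + 2 + i⌋₊ = base + 2 + i := by
      rw [← Nat.cast_ofNat, ← Nat.cast_add, ← Nat.cast_add, Nat.floor_natCast]
    have hkey : inputKey X w σ i = walkCode (scaled (X ⟨i, hi⟩) w σ) (m - 1) := by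
      rw [inputKey, dif_pos hi]
    simp only [wp_block_cons, wp_store, wp_assign, wp_block_nil]
    refine ⟨by simp [State.reg_setReg, g34], ?_, fun a ha => ?_, fun x hx => ?_, ?_, ?_⟩
    · simp [State.reg_setReg, g1, g16]; ring
    · simp [State.reg_setReg, g11, g23, g33, g34, hfl, -Nat.cast_add, -Nat.cast_mul]
      rcases Nat.lt_succ_iff_lt_or_eq.1 ha with ha | rfl
      · rw [Function.update_of_ne (by omega)]
        exact hent a ha
      · rw [Function.update_self, hkey]; push_cast; ring
    · simp [State.reg_setReg, g33, g34, hfl, -Nat.cast_add]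
      rw [Function.update_of_ne (by omega)]
      exact hmem x hx
    · simp [State.reg_setReg, g33, g34, hfl, -Nat.cast_add, -sup_le_iff, -le_sup_iff]
      omega
    · simp at hτ₁ ⊢
      have : (40 + 100 * m) * (i + 1) = (40 + 100 * m) * i + 40 + 100 * m := by ring
      omega
  · rintro s' τ' hf ⟨e34, e1, hent, hmem, hused, hτ⟩
    have e23 := hf.reg 23 (by decide)
    simp [State.reg_setReg, h23] at e23
    refine ⟨by simp [e34, e23], ?_⟩
    rw [wp_block_nil]
    exact ⟨hent, hmem, hused, by simp; omega⟩

theorem wp_roundProg {s : State} {τ : ℕ} {n m j : ℕ} {X : Fin n → Fin m → ℝ} {w σ : ℝ}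
    (hn : 1 ≤ n) (hm : 1 ≤ m) (h2 : s.reg 2 = m) (h3 : s.reg 3 = w) (h16 : s.reg 16 = m)
    (h23 : s.reg 23 = n) (h32 : s.reg 32 = j) (h33 : s.reg 33 = tableBase n j)
    (hσ : σ = if s.reg 19 ≤ s.reg 18 then (j : ℝ) / s.reg 30 else s.rnd 0)
    (hinp : ∀ i j (hi : i < n), j < m → s.inp (4 + i * m + j) = vertexAt (X ⟨i, hi⟩) j) :
    WP roundProg (fun s' τ' => s'.reg 32 = (j + 1 : ℕ) ∧ s'.reg 33 = tableBase n (j + 1) ∧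
      (s'.rnd = fun i => s.rnd (i + 1)) ∧
      IsTable s'.mem n (tableBase n j) σ (inputKey X w σ) ∧
      (∀ x, x < tableBase n j → s'.mem x = s.mem x) ∧
      s'.used ≤ max s.used (tableBase n (j + 1)) ∧
      τ' ≤ τ + (150 + (40 + 100 * m) * n + (80 + 110 * n) * Nat.clog 2 n)) s τ := by
  set base := tableBase n j with hbase
  have hbase' : tableBase n (j + 1) = base + (2 * n + 2) := by
    rw [hbase, tableBase, tableBase]; ring
  -- a random number is drawn in any case, and then replaced by a multiple of `1 / R` if `R`
  -- is small
  rw [roundProg, wp_block_cons, wp_rand, wp_block_cons]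
  have hshift : WP (.ite (.le (reg 19) (reg 18)) (.assign 4 (reg 32 / reg 30)) .skip)
      (fun s' τ' => s'.reg 4 = σ ∧ τ' ≤ τ + 20) (s.draw 4) (τ + 1) := by
    rw [wp_ite]
    refine ⟨fun hb => ?_, fun hb => ?_⟩
    · simp [State.reg_draw] at hb
      rw [if_pos hb] at hσ
      simp [State.reg_setReg, State.reg_draw, h32, hσ]
    · simp [State.reg_draw] at hb
      rw [if_neg (not_le.2 hb)] at hσ
      simp [State.reg_draw, hσ]
  refine hshift.frame.mono ?_
  clear hσ hshift
  rintro s₁ τ₁ ⟨⟨e4, hτ₁⟩, hf₁⟩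
  have e2 := hf₁.reg 2 (by decide)
  have e3 := hf₁.reg 3 (by decide)
  have e16 := hf₁.reg 16 (by decide)
  have e23 := hf₁.reg 23 (by decide)
  have e32 := hf₁.reg 32 (by decide)
  have e33 := hf₁.reg 33 (by decide)
  have ei := hf₁.inp
  have em := hf₁.mem (by decide)
  have eu := hf₁.used (by decide)
  have er := hf₁.rnd (by decide)
  simp [State.reg_draw, h2, h3, h16, h23, h32, h33] at e2 e3 e16 e23 e32 e33 ei em eu er
  have hfl0 : ⌊(base : ℝ)⌋₊ = base := Nat.floor_natCast _
  have hfl1 : ⌊(base : ℝ) + 1⌋₊ = base + 1 := by rw [← Nat.cast_add_one, Nat.floor_natCast]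
  rw [wp_block_cons, wp_store, wp_block_cons]
  refine (wp_fillProg (X := X) hm (by simpa using e2) (by simpa using e3) (by simpa using e4)
    (by simpa using e16) (by simpa using e23) (by simpa using e33)
    (by simpa [ei] using hinp)).frame.mono ?_
  rintro s₂ τ₂ ⟨⟨hent, hmem₂, hused₂, hτ₂⟩, hf₂⟩
  have g23 := hf₂.reg 23 (by decide)
  have g32 := hf₂.reg 32 (by decide)
  have g33 := hf₂.reg 33 (by decide)
  have gr := hf₂.rnd (by decide)
  simp [e23, e32, e33, er] at g23 g32 g33 gr
  simp [e33, hfl0, e4, em, -Nat.cast_add] at hmem₂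
  simp [e33, hfl0, eu, -sup_le_iff, -le_sup_iff] at hused₂
  simp at hτ₂
  simp only [wp_block_cons, wp_assign]
  refine (wp_sortProg (base := base + 2) hn (by simp [State.reg_setReg, g33])
    (by simp [State.reg_setReg, g33, g23]) (by simp [State.reg_setReg, g23])).frame.mono ?_
  rintro s₃ τ₃ ⟨⟨src, f20, hsrc, hsort, hrange, hmem₃, hused₃, hτ₃⟩, hf₃⟩
  have f23 := hf₃.reg 23 (by decide)
  have f32 := hf₃.reg 32 (by decide)
  have f33 := hf₃.reg 33 (by decide)
  have fr := hf₃.rnd (by decide)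
  simp [State.reg_setReg, g23, g32, g33, gr] at f23 f32 f33 fr
  simp at hmem₃ hused₃ hτ₃ hrange
  simp only [wp_block_cons, wp_store, wp_assign, wp_block_nil]
  refine ⟨by simp [State.reg_setReg, f32], ?_, ?_, ⟨src, ?_, ?_, by omega, ?_, fun v => ?_⟩,
    fun x hx => ?_, ?_, ?_⟩
  · simp [State.reg_setReg, f33, f23, hbase']
  · simpa using fr
  · simp [f33, hfl1, f20]
    rw [hmem₃ _ (by omega), hmem₂ _ (by omega), Function.update_self]
  · simp [f33, hfl1, f20]
  · intro a b hab hb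
    simp [f33, hfl1, f20]
    rw [Function.update_of_ne (by omega), Function.update_of_ne (by omega)]
    exact hsort a b hab hb
  · simp [f33, hfl1, f20, -Nat.cast_add, -Nat.cast_mul]
    constructor
    · rintro ⟨a, ha, rfl⟩
      rw [Function.update_of_ne (by omega)]
      obtain ⟨i, hi, h⟩ := (hrange _).1 ⟨a, ha, rfl⟩
      exact ⟨i, hi, by rw [← h, hent i hi]⟩
    · rintro ⟨i, hi, rfl⟩
      obtain ⟨a, ha, h⟩ := (hrange _).2 ⟨i, hi, hent i hi⟩
      exact ⟨a, ha, by rw [Function.update_of_ne (by omega), h]⟩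
  · simp [f33, hfl1, f20]
    rw [Function.update_of_ne (by omega), hmem₃ _ (by omega), hmem₂ _ (by omega),
      Function.update_of_ne (by omega)]
  · simp [f33, hfl1, -sup_le_iff, -le_sup_iff]
    omega
  · simp
    omega

theorem wp_setupProg (c : ℕ) {n m k : ℕ} {r : ℝ} {X : Fin n → Fin m → ℝ}
    {ω : ℕ → unitInterval} :
    WP (setupProg c) (fun s τ => s.reg 23 = n ∧ s.reg 16 = m ∧ s.reg 17 = k ∧
      s.reg 3 = 12 * (k : ℝ) * r ∧ s.reg 31 = (2 ^ Nat.clog 2 n : ℕ) ∧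
      s.reg 18 = (c * Nat.clog 2 n : ℕ) ∧ s.reg 19 = (min m k + 1 : ℕ) ∧
      s.reg 30 = (roundCount c n m k : ℕ) ∧ τ ≤ 80 + 20 * Nat.clog 2 n)
      (preprocessStart k r X ω) 0 := by
  have i0 : (preprocessStart k r X ω).inp 0 = n := rfl
  have i1 : (preprocessStart k r X ω).inp 1 = m := rfl
  have i2 : (preprocessStart k r X ω).inp 2 = k := rfl
  have i3 : (preprocessStart k r X ω).inp 3 = r := rfl
  have r0 : ∀ i, (preprocessStart k r X ω).reg i = 0 := fun i => rfl
  generalize preprocessStart k r X ω = s₀ at *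
  simp only [setupProg, wp_block_cons, wp_assign]
  refine WP.loop (Nat.clog 2 n) (fun i s τ => s.reg 31 = (2 ^ i : ℕ) ∧ s.reg 18 = i ∧
    τ ≤ 30 + 20 * i) ?_ ?_ ?_
  · exact ⟨by simp [State.reg_setReg], by simp [State.reg_setReg, r0], by simp⟩
  · rintro i hi s τ hf ⟨e31, e18, hτ⟩
    have e23 := hf.reg 23 (by decide)
    simp [State.reg_setReg, i0] at e23
    have hlt : 2 ^ i < n := Nat.pow_lt_of_lt_clog hi
    refine ⟨by simp [e31, e23]; exact_mod_cast hlt, ?_⟩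
    simp [State.reg_setReg, e31, e18]
    exact ⟨by ring, by omega⟩
  · rintro s τ hf ⟨e31, e18, hτ⟩
    have e23 := hf.reg 23 (by decide)
    have e16 := hf.reg 16 (by decide)
    have e17 := hf.reg 17 (by decide)
    have e3 := hf.reg 3 (by decide)
    simp [State.reg_setReg, i0, i1, i2, i3] at e23 e16 e17 e3
    have hle : n ≤ 2 ^ Nat.clog 2 n := Nat.le_pow_clog (by norm_num) n
    refine ⟨by simp [e31, e23]; exact_mod_cast hle, ?_⟩
    have key : ∀ (s' : State) (τ' : ℕ), s'.reg 23 = n → s'.reg 16 = m → s'.reg 17 = k →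
        s'.reg 3 = 12 * (k : ℝ) * r → s'.reg 31 = (2 ^ Nat.clog 2 n : ℕ) →
        s'.reg 18 = (c * Nat.clog 2 n : ℕ) → s'.reg 19 = (min m k + 1 : ℕ) →
        τ' ≤ 60 + 20 * Nat.clog 2 n →
        WP (block [.assign 30 (reg 18), .ite (.le (reg 19) (reg 18)) (.assign 30 (reg 19)) .skip])
          (fun s τ => s.reg 23 = n ∧ s.reg 16 = m ∧ s.reg 17 = k ∧
            s.reg 3 = 12 * (k : ℝ) * r ∧ s.reg 31 = (2 ^ Nat.clog 2 n : ℕ) ∧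
            s.reg 18 = (c * Nat.clog 2 n : ℕ) ∧ s.reg 19 = (min m k + 1 : ℕ) ∧
            s.reg 30 = (roundCount c n m k : ℕ) ∧ τ ≤ 80 + 20 * Nat.clog 2 n) s' τ' := by
      intro s' τ' a1 a2 a3 a4 a5 a6 a7 hτ'
      simp only [wp_block_cons, wp_assign, wp_ite]
      refine ⟨fun hb => ?_, fun hb => ?_⟩
      · simp [State.reg_setReg, a6, a7, -Nat.cast_add, -Nat.cast_mul, -Nat.cast_min] at hb
        simp [State.reg_setReg, a1, a2, a3, a4, a5, a6, a7, -Nat.cast_add, -Nat.cast_mul,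
          -Nat.cast_min, -Nat.cast_pow]
        exact ⟨(min_eq_left (by omega)).symm, by omega⟩
      · simp [State.reg_setReg, a6, a7, -Nat.cast_add, -Nat.cast_mul, -Nat.cast_min] at hb
        simp [State.reg_setReg, a1, a2, a3, a4, a5, a6, a7, -Nat.cast_add, -Nat.cast_mul,
          -Nat.cast_min, -Nat.cast_pow]
        exact ⟨(min_eq_right (by omega)).symm, by omega⟩
    rw [wp_block_cons, wp_assign, wp_block_cons, wp_assign, wp_block_cons, wp_ite]
    refine ⟨fun hb => ?_, fun hb => ?_⟩
    · simp [State.reg_setReg, e16, e17] at hb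
      rw [wp_assign]
      refine key _ _ ?_ ?_ ?_ ?_ ?_ ?_ ?_ ?_ <;>
        simp [State.reg_setReg, e23, e16, e17, e3, e31, e18, hb.le]
      omega
    · simp [State.reg_setReg, e16, e17] at hb
      rw [wp_skip]
      refine key _ _ ?_ ?_ ?_ ?_ ?_ ?_ ?_ ?_ <;>
        simp [State.reg_setReg, e23, e16, e17, e3, e31, e18, hb]
      omega

theorem wp_headerProg {s : State} {τ : ℕ} :
    WP headerProg (fun s' τ' => s'.mem 0 = s.reg 23 ∧ s'.mem 1 = s.reg 17 ∧ s'.mem 2 = s.reg 3 ∧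
      s'.mem 3 = s.reg 30 ∧ s'.mem 4 = s.reg 31 ∧ s'.used ≤ max s.used 5 ∧ τ' ≤ τ + 20) s τ := by
  simp only [headerProg, wp_block_cons, wp_store, wp_block_nil]
  simp [-sup_le_iff, -le_sup_iff]

/-- The preprocessing halts within a bounded time and builds the data structure. -/
theorem wp_preprocessProg (c : ℕ) {n m k : ℕ} (hn : 1 ≤ n) (hm : 1 ≤ m) {r : ℝ}
    {X : Fin n → Fin m → ℝ} {ω : ℕ → unitInterval} :
    WP (preprocessProg c) (fun s τ =>
      IsDataStructure s.mem n k (roundCount c n m k) (12 * (k : ℝ) * r) (shiftOf c n m k ω)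
        (fun j => inputKey X (12 * (k : ℝ) * r) (shiftOf c n m k ω j)) ∧
      s.used ≤ tableBase n (roundCount c n m k) ∧
      τ ≤ 150 + 20 * Nat.clog 2 n + (170 + (40 + 100 * m) * n + (80 + 110 * n) * Nat.clog 2 n) *
        roundCount c n m k) (preprocessStart k r X ω) 0 := by
  set T := Nat.clog 2 n with hT
  set R := roundCount c n m k with hR
  set w := 12 * (k : ℝ) * r with hw
  rw [preprocessProg, wp_block_cons]
  refine (wp_setupProg c).frame.mono ?_
  rintro s τ ⟨⟨e23, e16, e17, e3, e31, e18, e19, e30, hτ⟩, hf⟩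
  have e32 := hf.reg 32 (by simp [setupProg, block, Prog.writes])
  have ei := hf.inp
  have er := hf.rnd (by simp [setupProg, block, Prog.draws])
  have eu := hf.used (by simp [setupProg, block, Prog.stores])
  rw [show (preprocessStart k r X ω).reg 32 = 0 from rfl] at e32
  rw [show (preprocessStart k r X ω).rnd = ω from rfl] at er
  rw [show (preprocessStart k r X ω).used = 0 from rfl] at eu
  have hinp : ∀ i j (hi : i < n), j < m → s.inp (4 + i * m + j) = vertexAt (X ⟨i, hi⟩) j := by
    intro i j hi hj
    rw [ei]; exact preprocessStart_inp_vertex hi hj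
  clear hf ei
  rw [wp_block_cons]
  refine wp_headerProg.frame.mono ?_
  rintro s₁ τ₁ ⟨⟨m0, m1, m2, m3, m4, hu, hτ₁⟩, hf⟩
  rw [← hf.reg 23 (by decide)] at e23 m0
  rw [← hf.reg 16 (by decide)] at e16
  rw [← hf.reg 17 (by decide)] at e17 m1
  rw [← hf.reg 3 (by decide)] at e3 m2
  rw [← hf.reg 31 (by decide)] at e31 m4
  rw [← hf.reg 18 (by decide)] at e18
  rw [← hf.reg 19 (by decide)] at e19
  rw [← hf.reg 30 (by decide)] at e30 m3
  rw [← hf.reg 32 (by decide)] at e32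
  rw [← hf.inp] at hinp
  rw [← hf.rnd (by decide)] at er
  rw [eu] at hu
  clear hf eu
  simp only [wp_block_cons, wp_assign]
  refine WP.loop R (fun j s τ => s.reg 32 = j ∧ s.reg 33 = tableBase n j ∧
    (s.rnd = fun i => ω (j + i)) ∧ (∀ x, x < 5 → s.mem x = s₁.mem x) ∧
    (∀ i < j, IsTable s.mem n (tableBase n i) (shiftOf c n m k ω i)
      (inputKey X w (shiftOf c n m k ω i))) ∧ s.used ≤ tableBase n j ∧
    τ ≤ 120 + 20 * T + (170 + (40 + 100 * m) * n + (80 + 110 * n) * T) * j) ?_ ?_ ?_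
  · refine ⟨by simp [State.reg_setReg, e32], by simp [State.reg_setReg, tableBase], by simp [er],
      fun x _ => rfl, fun i hi => absurd hi (by omega), ?_, by simp; omega⟩
    simp [tableBase]
    simpa using hu
  · rintro j hj s₂ τ₂ hf ⟨f32, f33, fr, fm, ft, fu, hτ₂⟩
    have f2 := hf.reg 2 (by decide)
    have f3 := hf.reg 3 (by decide)
    have f16 := hf.reg 16 (by decide)
    have f18 := hf.reg 18 (by decide)
    have f19 := hf.reg 19 (by decide)
    have f23 := hf.reg 23 (by decide)
    have f30 := hf.reg 30 (by decide)
    have fi := hf.inp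
    simp [State.reg_setReg, e3, e16, e18, e19, e23, e30, -Nat.cast_add, -Nat.cast_mul,
      -Nat.cast_min] at f2 f3 f16 f18 f19 f23 f30 fi
    have hjR : (j : ℝ) < R := by exact_mod_cast hj
    refine ⟨by simpa [f32, f30] using hjR, ?_⟩
    rw [← fi] at hinp
    have hσ : shiftOf c n m k ω j =
        if s₂.reg 19 ≤ s₂.reg 18 then (j : ℝ) / s₂.reg 30 else s₂.rnd 0 := by
      simp only [f18, f19, f30, fr, Nat.cast_le]
      rfl
    refine (wp_roundProg hn hm f2 f3 f16 f23 f32 f33 hσ hinp).mono ?_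
    rintro s₃ τ₃ ⟨g32, g33, gr, gt, gm, gu, hτ₃⟩
    have hbase : 5 ≤ tableBase n j := by simp [tableBase]
    have hmono : ∀ i, i < j → tableBase n i + (2 * n + 2) ≤ tableBase n j := by
      intro i hi
      have := Nat.mul_le_mul_right (2 * n + 2) (Nat.succ_le_of_lt hi)
      rw [Nat.succ_mul] at this
      simp only [tableBase]; omega
    have hnext : tableBase n j ≤ tableBase n (j + 1) := by
      simp only [tableBase, add_mul]; omega
    refine ⟨g32, g33, ?_, fun x hx => ?_, fun i hi => ?_, ?_, ?_⟩
    · rw [gr, fr]; funext i; rw [add_right_comm, add_assoc]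
    · rw [gm x (by omega), fm x hx]
    · rcases Nat.lt_succ_iff_lt_or_eq.1 hi with hi | rfl
      · refine (ft i hi).congr fun x h1 h2 => gm x ?_
        have := hmono i hi
        omega
      · exact gt
    · omega
    · simp at hτ₃
      rw [← hT] at hτ₃
      have : (170 + (40 + 100 * m) * n + (80 + 110 * n) * T) * (j + 1) =
        (170 + (40 + 100 * m) * n + (80 + 110 * n) * T) * j +
          (170 + (40 + 100 * m) * n + (80 + 110 * n) * T) := by ring
      omega
  · rintro s₂ τ₂ hf ⟨f32, f33, fr, fm, ft, fu, hτ₂⟩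
    have f30 := hf.reg 30 (by decide)
    simp [State.reg_setReg, e30] at f30
    refine ⟨by simp [f32, f30, ← hR], ?_⟩
    rw [wp_block_nil]
    refine ⟨⟨?_, ?_, ?_, ?_, ?_, ft⟩, fu, by simp; omega⟩
    · rw [fm 0 (by norm_num), m0, e23]
    · rw [fm 1 (by norm_num), m1, e17]
    · rw [fm 2 (by norm_num), m2, e3]
    · rw [fm 3 (by norm_num), m3, e30]
    · rw [fm 4 (by norm_num), m4, e31]

end RealRAM

/-! ### Correctness and running time -/

theorem frechetDist_le_of_inputKey_eq {n m k : ℕ} (hm : 1 ≤ m) (hk : 1 ≤ k) {X : Fin n → Fin m → ℝ}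
    {y : Fin k → ℝ} {w σ : ℝ} (hw : 0 < w) {i : Fin n}
    (h : inputKey X w σ i = walkCode (scaled y w σ) (k - 1)) :
    frechetDist (timeSeries (X i)) (timeSeries y) ≤ 2 * w := by
  rw [inputKey, dif_pos i.2] at h
  exact frechetDist_le_of_walkCode_eq hm hk _ _ hw σ h

/-- If for some shift the key of a near input curve is the key of the query, then the preprocessing
succeeds for this query. -/
theorem preprocessSucceeds_of_key_eq (c : ℕ) {n m k : ℕ} {r : ℝ} {X : Fin n → Fin m → ℝ}
    {y : Fin k → ℝ} {ω : ℕ → unitInterval} (hn : 1 ≤ n) (hm : 1 ≤ m) (hk : 1 ≤ k) (hr : 0 < r)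
    (h : ∀ i : Fin n, frechetDist (timeSeries (X i)) (timeSeries y) ≤ r →
      ∃ j < roundCount c n m k, inputKey X (12 * (k : ℝ) * r) (shiftOf c n m k ω j) i =
        walkCode (scaled y (12 * (k : ℝ) * r) (shiftOf c n m k ω j)) (k - 1)) :
    PreprocessSucceeds (preprocessProg c) queryProg (24 * (k : ℝ) + 1) r X y ω := by
  have hk' : (1 : ℝ) ≤ k := by exact_mod_cast hk
  have hw : 0 < 12 * (k : ℝ) * r := by positivity
  obtain ⟨t, s, hexec, hD, -, -⟩ := wp_preprocessProg c hn hm (k := k) (r := r) (X := X) (ω := ω)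
  obtain ⟨t', s', hexec', ⟨a, ha, hsome, hnone⟩, -⟩ := wp_queryProg hn hk hD y
  have hnear : ∀ i, a = some i →
      frechetDist (timeSeries (X i)) (timeSeries y) < (24 * (k : ℝ) + 1) * r := by
    intro i hi
    obtain ⟨j, -, hj⟩ := hsome i hi
    have := frechetDist_le_of_inputKey_eq hm hk hw hj
    linarith
  refine ⟨t, s, hexec, t', a, ⟨s', hexec', ha⟩, ?_, ?_, fun j hj => (hnear j hj).le⟩
  · rintro ⟨i, hi⟩
    obtain ⟨j, hj, hij⟩ := h i hi
    obtain ⟨i', hi'⟩ := Option.ne_none_iff_exists'.1 (hnone j hj i i.2 hij)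
    exact ⟨i', hi', (hnear i' hi').le⟩
  · intro hfar
    by_contra hne
    obtain ⟨i', hi'⟩ := Option.ne_none_iff_exists'.1 hne
    exact absurd (hfar i') (not_le.2 (hnear i' hi'))

/-- A near input curve has the key of the query for every shift that is clear of the vertices of
one of the two. The grid width is `12 k r` because then the clearance `1 / (8 k)`, measured in grid
cells, is the distance `3 r / 2`, which exceeds `r`. -/
theorem inputKey_eq_of_clear {n m k : ℕ} (hm : 1 ≤ m) (hk : 1 ≤ k) {X : Fin n → Fin m → ℝ}
    {y : Fin k → ℝ} {r σ : ℝ} (hr : 0 < r) {i : Fin n}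
    (h : frechetDist (timeSeries (X i)) (timeSeries y) ≤ r)
    (hclear : (∀ l < m, ∀ N : ℤ,
        1 / (8 * (k : ℝ)) ≤ |vertexAt (X i) l / (12 * (k : ℝ) * r) + σ - N|) ∨
      ∀ l < k, ∀ N : ℤ, 1 / (8 * (k : ℝ)) ≤ |vertexAt y l / (12 * (k : ℝ) * r) + σ - N|) :
    inputKey X (12 * (k : ℝ) * r) σ i = walkCode (scaled y (12 * (k : ℝ) * r) σ) (k - 1) := by
  have hk' : (1 : ℝ) ≤ k := by exact_mod_cast hk
  have hw : 0 < 12 * (k : ℝ) * r := by positivity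
  rw [inputKey, dif_pos i.2]
  refine walkCode_eq_of_frechetDist_lt hw (δ := 1 / (8 * (k : ℝ))) ?_ σ ?_ ?_
  · apply one_div_le_one_div_of_le <;> linarith
  · have e : 1 / (8 * (k : ℝ)) * (12 * (k : ℝ) * r) = 3 / 2 * r := by field_simp; norm_num
    rw [e]
    refine h.trans_lt ?_
    linarith
  · exact hclear.imp (fun H l hl => H l (by omega)) (fun H l hl => H l (by omega))

theorem clog_le_three_mul_log {n : ℕ} (hn : 2 ≤ n) : (Nat.clog 2 n : ℝ) ≤ 3 * Real.log n := by
  have h1 : 2 ^ (Nat.clog 2 n - 1) < n := Nat.pow_pred_clog_lt_self (by norm_num) (by omega)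
  have hT : 0 < Nat.clog 2 n := Nat.clog_pos (by norm_num) (by omega)
  generalize Nat.clog 2 n = T at *
  have hn' : (2 : ℝ) ≤ n := by exact_mod_cast hn
  have h2 : ((T : ℝ) - 1) * Real.log 2 ≤ Real.log n := by
    have h3 : (2 : ℝ) ^ (T - 1) ≤ n := by exact_mod_cast h1.le
    have h4 := Real.log_le_log (by positivity) h3
    rw [Real.log_pow, Nat.cast_sub hT] at h4
    simpa using h4
  have h3 := Real.log_le_log (by norm_num) hn'
  have h4 := Real.log_two_gt_d9
  nlinarith [(Nat.cast_nonneg T : (0 : ℝ) ≤ T)]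

theorem roundCount_le_mul_clog (c n m k : ℕ) : roundCount c n m k ≤ c * Nat.clog 2 n :=
  min_le_right _ _

theorem roundCount_le_two_mul_left (c n : ℕ) {m : ℕ} (k : ℕ) (hm : 1 ≤ m) :
    roundCount c n m k ≤ 2 * m := by
  unfold roundCount; omega

theorem roundCount_le_two_mul_right (c n m : ℕ) {k : ℕ} (hk : 1 ≤ k) :
    roundCount c n m k ≤ 2 * k := by
  unfold roundCount; omega

/-- Coding takes time `n m` for each shift, and the number of shifts is `O(log n)`; sorting takes
time `n log n` for each shift, and the number of shifts is `O(m)`. Each part of the running time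
needs its own bound on the number `R` of shifts. -/
theorem preprocess_time_le (c : ℕ) {n m T R : ℕ} (hn : 1 ≤ n) (hm : 1 ≤ m) (hT : 1 ≤ T)
    (h1 : R ≤ c * T) (h2 : R ≤ 2 * m) :
    150 + 20 * T + (170 + (40 + 100 * m) * n + (80 + 110 * n) * T) * R ≤
      (310 * c + 550) * (n * m * T) := by
  have hnm : 1 ≤ n * m := Nat.mul_pos hn hm
  have hn' : n ≤ n * m := Nat.le_mul_of_pos_right n hm
  have hT' : T ≤ n * m * T := Nat.le_mul_of_pos_left T hnm
  have a1 : (170 + (40 + 100 * m) * n) * R ≤ (310 * (n * m)) * (c * T) :=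
    Nat.mul_le_mul (by nlinarith) h1
  have a2 : (80 + 110 * n) * T * R ≤ (190 * n * T) * (2 * m) :=
    Nat.mul_le_mul (Nat.mul_le_mul_right T (by omega)) h2
  calc _ = 150 + 20 * T + ((170 + (40 + 100 * m) * n) * R + (80 + 110 * n) * T * R) := by ring
    _ ≤ 170 * (n * m * T) + ((310 * (n * m)) * (c * T) + (190 * n * T) * (2 * m)) := by omega
    _ = (310 * c + 550) * (n * m * T) := by ring

theorem tableBase_le (c : ℕ) {n T R : ℕ} (hn : 1 ≤ n) (hT : 1 ≤ T) (h1 : R ≤ c * T) :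
    tableBase n R ≤ (4 * c + 5) * (n * T) := by
  have hnT : 1 ≤ n * T := Nat.mul_pos hn hT
  have a1 : R * (2 * n + 2) ≤ (c * T) * (4 * n) := Nat.mul_le_mul h1 (by omega)
  calc tableBase n R = 5 + R * (2 * n + 2) := rfl
    _ ≤ 5 * (n * T) + (c * T) * (4 * n) := by omega
    _ = (4 * c + 5) * (n * T) := by ring

/-- As for the preprocessing, the coding part uses that the number of shifts is `O(log n)`, and the
searching part that it is `O(k)`. -/
theorem query_time_le (c : ℕ) {k T R : ℕ} (hk : 1 ≤ k) (hT : 1 ≤ T) (h1 : R ≤ c * T)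
    (h2 : R ≤ 2 * k) :
    50 + (150 + 100 * k + 50 * T) * R ≤ (250 * c + 150) * (k * T) := by
  have hkT : 1 ≤ k * T := Nat.mul_pos hk hT
  have a1 : (150 + 100 * k) * R ≤ (250 * k) * (c * T) := Nat.mul_le_mul (by omega) h1
  have a2 : 50 * T * R ≤ 50 * T * (2 * k) := Nat.mul_le_mul_left _ h2
  calc _ = 50 + ((150 + 100 * k) * R + 50 * T * R) := by ring
    _ ≤ 50 * (k * T) + ((250 * k) * (c * T) + 50 * T * (2 * k)) := by omega
    _ = _ := by ring

theorem mainTheorem3 (c : ℕ) :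
    ∃ (P Q : Prog) (C : ℝ), ∀ (n m k : ℕ) (r : ℝ) (X : Fin n → Fin m → ℝ),
      2 ≤ n → 1 ≤ m → 1 ≤ k → 0 < r →
      -- expected preprocessing time
      (∫⁻ ω, runTime P (preprocessStart k r X ω) ∂randomStream
          ≤ ENNReal.ofReal (C * ((n : ℝ) * (m : ℝ) * Real.log n))) ∧
      -- space and worst-case query time
      (∀ (ω : ℕ → unitInterval) (t : ℕ) (s : State),
        Exec P (preprocessStart k r X ω) t s →
          (s.used : ℝ) ≤ C * ((n : ℝ) * Real.log n + (n : ℝ) * (m : ℝ)) ∧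
          ∀ y : Fin k → ℝ, ∃ (t' : ℕ) (a : Option (Fin n)),
            Answers Q s.mem y t' a ∧ (t' : ℝ) ≤ C * ((k : ℝ) * Real.log n)) ∧
      -- success probability for a fixed query
      (∀ y : Fin k → ℝ,
        1 - 1 / (n : ℝ) ^ c ≤
          randomStream.real
            {ω | PreprocessSucceeds P Q (24 * (k : ℝ) + 1) r X y ω}) := by
  refine ⟨preprocessProg c, queryProg, 3 * (310 * c + 550), ?_⟩
  intro n m k r X hn hm hk hr
  have hn1 : 1 ≤ n := by omega
  have hT : 1 ≤ Nat.clog 2 n := Nat.clog_pos (by norm_num) (by omega)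
  have hlog := clog_le_three_mul_log hn
  have hk' : (1 : ℝ) ≤ k := by exact_mod_cast hk
  have hR1 := roundCount_le_mul_clog c n m k
  have hR2 := roundCount_le_two_mul_left c n k hm
  have hR3 := roundCount_le_two_mul_right c n m hk
  have : IsProbabilityMeasure randomStream := by
    unfold randomStream; infer_instance
  -- converts a bound in terms of `⌈log₂ n⌉` into one in terms of `log n`
  have conv : ∀ t a b : ℕ, a ≤ 310 * c + 550 → t ≤ a * (b * Nat.clog 2 n) →
      (t : ℝ) ≤ 3 * (310 * c + 550) * (b * Real.log n) := by
    intro t a b ha h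
    have h1 : (t : ℝ) ≤ a * (b * Nat.clog 2 n) := by exact_mod_cast h
    have h2 : (a : ℝ) ≤ 310 * c + 550 := by exact_mod_cast ha
    calc (t : ℝ) ≤ a * (b * Nat.clog 2 n) := h1
      _ ≤ (310 * c + 550) * (b * (3 * Real.log n)) := by gcongr
      _ = _ := by ring
  have hlog0 : 0 ≤ Real.log n := Real.log_natCast_nonneg n
  refine ⟨?_, ?_, ?_⟩
  · calc ∫⁻ ω, runTime (preprocessProg c) (preprocessStart k r X ω) ∂randomStream
        ≤ ∫⁻ _, ENNReal.ofReal (3 * (310 * c + 550) * ((n : ℝ) * (m : ℝ) * Real.log n))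
            ∂randomStream := by
          refine lintegral_mono fun ω => ?_
          obtain ⟨t, s, hexec, -, -, ht⟩ :=
            wp_preprocessProg c hn1 hm (k := k) (r := r) (X := X) (ω := ω)
          rw [Nat.zero_add] at ht
          refine (iInf₂_le t ⟨s, hexec⟩).trans ?_
          rw [← ENNReal.ofReal_natCast]
          apply ENNReal.ofReal_le_ofReal
          have := conv t (310 * c + 550) (n * m) le_rfl
            (ht.trans (preprocess_time_le c hn1 hm hT hR1 hR2))
          push_cast at this
          exact this
      _ = _ := by rw [lintegral_const, measure_univ, mul_one]
  · intro ω t s hexec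
    obtain ⟨t', s', hexec', hD, hu, -⟩ :=
      wp_preprocessProg c hn1 hm (k := k) (r := r) (X := X) (ω := ω)
    obtain ⟨rfl, rfl⟩ := hexec.unique hexec'
    constructor
    · have h1 := conv s.used (4 * c + 5) n (by omega) (hu.trans (tableBase_le c hn1 hT hR1))
      refine h1.trans ?_
      gcongr
      exact le_add_of_nonneg_right (by positivity)
    · intro y
      obtain ⟨t'', s'', hq, ⟨a, ha, -⟩, ht⟩ := wp_queryProg hn1 hk hD y
      rw [Nat.zero_add] at ht
      exact ⟨t'', a, ⟨s'', hq, ha⟩,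
        conv t'' (250 * c + 150) k (by omega) (ht.trans (query_time_le c hk hT hR1 hR3))⟩
  · intro y
    set w := 12 * (k : ℝ) * r with hw
    by_cases hdet : min m k + 1 ≤ c * Nat.clog 2 n
    · -- equally spaced shifts: one is clear of the vertices of the curve with fewer vertices
      have hR : roundCount c n m k = min m k + 1 := min_eq_left hdet
      have hall : {ω | PreprocessSucceeds (preprocessProg c) queryProg (24 * (k : ℝ) + 1) r X y ω} =
          Set.univ := by
        refine Set.eq_univ_of_forall fun ω => ?_
        refine preprocessSucceeds_of_key_eq c hn1 hm hk hr fun i hi => ?_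
        have hδ : 2 * (1 / (8 * (k : ℝ))) * (roundCount c n m k : ℝ) ≤ 1 := by
          have h1 : (roundCount c n m k : ℝ) ≤ 2 * k := by exact_mod_cast hR3
          calc _ ≤ 2 * (1 / (8 * (k : ℝ))) * (2 * k) := by gcongr
            _ = 1 / 2 := by field_simp; norm_num
            _ ≤ 1 := by norm_num
        have hsh : ∀ j, shiftOf c n m k ω j = (j : ℝ) / roundCount c n m k := fun j => if_pos hdet
        rcases le_total m k with hmk | hmk
        · obtain ⟨j, hj, hc⟩ := exists_clear_shift (fun l => vertexAt (X i) l / w) (v := m)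
            (R := roundCount c n m k) (by omega) hδ
          exact ⟨j, hj, inputKey_eq_of_clear hm hk hr hi (Or.inl (by rw [hsh]; exact hc))⟩
        · obtain ⟨j, hj, hc⟩ := exists_clear_shift (fun l => vertexAt y l / w) (v := k)
            (R := roundCount c n m k) (by omega) hδ
          exact ⟨j, hj, inputKey_eq_of_clear hm hk hr hi (Or.inr (by rw [hsh]; exact hc))⟩
      rw [hall, probReal_univ]
      have : (0 : ℝ) ≤ 1 / (n : ℝ) ^ c := by positivity
      linarith
    · have hR : roundCount c n m k = c * Nat.clog 2 n := min_eq_right (by omega)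
      have hsh : ∀ ω j, shiftOf c n m k ω j = ω j := fun ω j => if_neg hdet
      have hprob := one_sub_le_randomStream (y := fun l => vertexAt y l / w) hk
        (roundCount c n m k)
        (S := {ω | PreprocessSucceeds (preprocessProg c) queryProg (24 * (k : ℝ) + 1) r X y ω}) ?_
      · refine le_trans ?_ hprob
        have h1 : (n : ℝ) ≤ 2 ^ Nat.clog 2 n := by
          exact_mod_cast Nat.le_pow_clog (by norm_num) n
        have hn0 : (0 : ℝ) < n := by exact_mod_cast hn1
        have h2 : (n : ℝ) ^ c ≤ 2 ^ (c * Nat.clog 2 n) := by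
          rw [mul_comm, pow_mul]
          exact pow_le_pow_left₀ hn0.le h1 c
        rw [hR, one_div_pow]
        have := one_div_le_one_div_of_le (by positivity) h2
        linarith
      · rintro ω ⟨j, hj, hc⟩
        refine preprocessSucceeds_of_key_eq c hn1 hm hk hr fun i hi => ⟨j, hj, ?_⟩
        exact inputKey_eq_of_clear hm hk hr hi (Or.inr (by rw [hsh]; exact hc))
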